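/- Let $H_{\rm GW}=\mathbb C[p]/(p^4)$ and $H_{\rm FJRW}=\mathbb C[H^{(1)}]/((H^{(1)})^2)\oplus\mathbb C[H^{(2)}]/((H^{(2)})^2)$, the second a product of rings with identity elements $\mathbb 1^{(1)},\mathbb 1^{(2)}$ of the two factors (these are the state spaces of the Gromov--Witten theory of the complete intersection $X_{3,3}\subset\mathbb P^5$ of two cubics, restricted to the classes generated by the hyperplane class $p$, and of the corresponding FJRW theory). The gradings $\mathrm{Gr}$ and $\deg_0$ are $$\mathrm{Gr}(p^k)=\deg_0(p^k)=2k,\qquad \mathrm{Gr}(\mathbb 1^{(1)},H^{(1)},\mathbb 1^{(2)},H^{(2)})=(0,2,4,6),\qquad \deg_0(\mathbb 1^{(k)})=-4,\ \deg_0(H^{(k)})=-2,$$ and $c^{\mathrm{Gr}/2}$, $c^{\deg_0/2}$ denote the linear operators that multiply a homogeneous element by the corresponding power of $c$. Functions of nilpotent elements are defined by Taylor expansion, and $v^{a}=e^{a\log v}$, $u^a=e^{a\log u}$, so that everything below is a function of $\log v$, respectively $\log u$, and of $z\in\mathbb C\setminus\{0\}$. Put $$I_{\rm GW}(v,z)=\sum_{n\ge0}z\,v^{\frac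 pz+n}\,\frac{\prod_{0<b\le 3n}(3p+bz)^2}{\prod_{0<b\le n}(p+bz)^6},$$ $$I_{\rm FJRW}(u,z)=\sum_{\substack{d\ge0\\ d\not\equiv-1\,(3)}}\frac{z\,u^{d+1+\frac{H^{(d+1)}}z}}{3^{6\lfloor d/3\rfloor}}\,\frac{\prod_{0<b\le d,\ b\equiv d+1\,(3)}(H^{(d+1)}+bz)^6}{\prod_{0<b\le d}(H^{(d+1)}+bz)^2}\,\mathbb 1^{(d+1)},$$ with upper indices $(d+1)$ read modulo $3$, and $$\Gamma_{\rm GW}=\frac{\Gamma(1+p)^6}{\Gamma(1+3p)^2},\qquad \Gamma_{\rm FJRW}=\Gamma\big(\tfrac23-\tfrac{H^{(1)}}3\big)^6\Gamma(1+H^{(1)})^2\,\mathbb 1^{(1)}+\Gamma\big(\tfrac13-\tfrac{H^{(2)}}3\big)^6\Gamma(1+H^{(2)})^2\,\mathbb 1^{(2)}.$$ In each theory the function $\mathfrak H$ is defined by $$I=z^{-\mathrm{Gr}/2}\big(\Gamma\cdot(2\pi i)^{\deg_0/2}\,\mathfrak H\big).$$ For $l\in\mathbb Z$ and $\zeta=e^{2\pi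 i/3}$ let $\mathbb U_l\colon H_{\rm FJRW}\to H_{\rm GW}$ be the linear map with $$\mathbb 1^{(k)}\mapsto\frac l9\,\frac{(\zeta^ke^p)^l}{1-\zeta^ke^p}+\frac19\,\frac{(\zeta^ke^p)^{l+1}}{(1-\zeta^ke^p)^2},\qquad H^{(k)}\mapsto\frac13\,\frac{(\zeta^ke^p)^l}{1-\zeta^ke^p}\qquad(k=1,2),$$ and let the window $w_l$ be the open segment of the line $\mathrm{Re}(\log v)=-6\log3$ in the $(\log v)$-plane on which $2(l-1)\pi<\mathrm{Im}(\log v)<2l\pi$. **Theorem.** Let $l\in\mathbb Z$ and $z\in\mathbb C\setminus\{0\}$. The series $I_{\rm GW}$ converges for $\mathrm{Re}(\log v)<-6\log 3$, and the series $I_{\rm FJRW}$ converges for $\mathrm{Re}(-3\log u)>-6\log 3$. The function $\mathfrak H_{\rm GW}(v,z)$ of $\log v$, given on $\mathrm{Re}(\log v)<-6\log 3$, has an analytic continuation through the window $w_l$, that is, to $$\{\mathrm{Re}(\log v)<-6\log3\}\ \cup\ w_l\ \cup\ \{\mathrm{Re}(\log v)>-6\log3\},$$ and this continuation coincides on $\{\mathrm{Re}(\log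 v)>-6\log3\}$ with $\mathbb U_l(\mathfrak H_{\rm FJRW}(u,z))$ after the change of variable $\log v=-3\log u$. -/

import Mathlib

open Polynomial

noncomputable section

/-- The truncated polynomial algebra `ℂ[x]/(xⁿ)`. -/
abbrev TruncAlg (n : ℕ) : Type := AdjoinRoot (X ^ n : ℂ[X])

namespace TruncAlg

/-- The generator `x` of `ℂ[x]/(xⁿ)`. -/
def gen (n : ℕ) : TruncAlg n := AdjoinRoot.root (X ^ n)

/-- The coefficient of `xⁱ`. -/
def coeff (n i : ℕ) : TruncAlg n →ₗ[ℂ] ℂ :=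
  (Polynomial.lcoeff ℂ i).comp (AdjoinRoot.modByMonicHom (monic_X_pow n))

/-- The vector of the coefficients of `1, x, …, xⁿ⁻¹`. -/
def coeffs (n : ℕ) : TruncAlg n →ₗ[ℂ] (Fin n → ℂ) := LinearMap.pi fun i => coeff n i

theorem eq_sum_coeff (n : ℕ) (a : TruncAlg n) :
    a = ∑ i ∈ Finset.range n, coeff n i a • gen n ^ i := by
  have h1 := AdjoinRoot.mk_leftInverse (monic_X_pow (R := ℂ) n) a
  have h2 : (AdjoinRoot.modByMonicHom (monic_X_pow (R := ℂ) n) a).degree < n := by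
    obtain ⟨f, rfl⟩ := AdjoinRoot.mk_surjective a
    rw [AdjoinRoot.modByMonicHom_mk]
    simpa using Polynomial.degree_modByMonic_lt f (monic_X_pow (R := ℂ) n)
  have h3 := Polynomial.as_sum_range' (AdjoinRoot.modByMonicHom (monic_X_pow (R := ℂ) n) a) n
  by_cases hp : AdjoinRoot.modByMonicHom (monic_X_pow (R := ℂ) n) a = 0
  · rw [hp, map_zero] at h1
    simp [← h1]
  · have h4 := h3 ((Polynomial.natDegree_lt_iff_degree_lt hp).2 h2)
    conv_lhs => rw [← h1, h4, map_sum]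
    refine Finset.sum_congr rfl fun i _ => ?_
    rw [← C_mul_X_pow_eq_monomial, map_mul, map_pow, AdjoinRoot.mk_X, AdjoinRoot.mk_C,
      Algebra.smul_def]
    rfl

theorem coeffs_injective (n : ℕ) : Function.Injective (coeffs n) := by
  intro a b hab
  rw [eq_sum_coeff n a, eq_sum_coeff n b]
  refine Finset.sum_congr rfl fun i hi => ?_
  have := congrFun hab ⟨i, Finset.mem_range.1 hi⟩
  have h' : coeff n i a = coeff n i b := this
  rw [h']

/-- The norm on the finite-dimensional space `ℂ[x]/(xⁿ)`: the supremum of the moduli of the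
coefficients. -/
instance normedAddCommGroup (n : ℕ) : NormedAddCommGroup (TruncAlg n) :=
  NormedAddCommGroup.induced (TruncAlg n) (Fin n → ℂ) (coeffs n) (coeffs_injective n)

instance normedSpace (n : ℕ) : NormedSpace ℂ (TruncAlg n) :=
  NormedSpace.induced ℂ (TruncAlg n) (Fin n → ℂ) (coeffs n)

/-- The linear operator `xⁱ ↦ c ^ (i + m) xⁱ`. -/
def scale (n : ℕ) (m : ℤ) (c : ℂ) : TruncAlg n →ₗ[ℂ] TruncAlg n :=
  ∑ i ∈ Finset.range n, c ^ ((i : ℤ) + m) • (coeff n i).smulRight (gen n ^ i)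

/-- For `f` holomorphic near `a`, the element `f (a + c x)` of `ℂ[x]/(xⁿ)`, defined by the
Taylor expansion of `f` at `a`. -/
def taylor (n : ℕ) (f : ℂ → ℂ) (a c : ℂ) : TruncAlg n :=
  ∑ k ∈ Finset.range n, (iteratedDeriv k f a / (k.factorial : ℂ)) • (c • gen n) ^ k

end TruncAlg

open TruncAlg

/-! ### State spaces -/

/-- `H_GW = ℂ1 ⊕ ℂp ⊕ ℂp² ⊕ ℂp³`, with the cup product (`p⁴ = 0`). -/
abbrev HGW : Type := TruncAlg 4

/-- `H_FJRW = H^*(ℙ(3,3)) ⊕ H^*(ℙ(3,3))`, with the cup product on each summand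
(`(H⁽¹⁾)² = 0 = (H⁽²⁾)²`). -/
abbrev HFJRW : Type := TruncAlg 2 × TruncAlg 2

/-- The hyperplane class of `X_{3,3}`. -/
abbrev pGW : HGW := gen 4

/-- `𝟙⁽¹⁾`. -/
def one1 : HFJRW := (1, 0)
/-- `H⁽¹⁾`. -/
def hyp1 : HFJRW := (gen 2, 0)
/-- `𝟙⁽²⁾`. -/
def one2 : HFJRW := (0, 1)
/-- `H⁽²⁾`. -/
def hyp2 : HFJRW := (0, gen 2)

/-- `c ^ (Gr / 2)` on `H_GW`, where `Gr (pᵏ) = 2k`. -/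
def powGrGW (c : ℂ) : HGW →ₗ[ℂ] HGW := scale 4 0 c

/-- `c ^ (deg₀ / 2)` on `H_GW`, where `deg₀ (pᵏ) = 2k`. -/
def powDegGW (c : ℂ) : HGW →ₗ[ℂ] HGW := scale 4 0 c

/-- `c ^ (Gr / 2)` on `H_FJRW`, where `Gr 𝟙⁽¹⁾ = 0`, `Gr H⁽¹⁾ = 2`, `Gr 𝟙⁽²⁾ = 4`,
`Gr H⁽²⁾ = 6`. -/
def powGrFJRW (c : ℂ) : HFJRW →ₗ[ℂ] HFJRW := (scale 2 0 c).prodMap (scale 2 2 c)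

/-- `c ^ (deg₀ / 2)` on `H_FJRW`, where `deg₀ 𝟙⁽ᵏ⁾ = -4` and `deg₀ H⁽ᵏ⁾ = -2`. -/
def powDegFJRW (c : ℂ) : HFJRW →ₗ[ℂ] HFJRW := (scale 2 (-2) c).prodMap (scale 2 (-2) c)

/-! ### Gamma classes -/

/-- `Γ(1 + p)⁶ / Γ(1 + 3p)²`, the Gamma class of the tangent bundle of `X_{3,3}`. -/
def gammaGW : HGW :=
  taylor 4 Complex.Gamma 1 1 ^ 6 * Ring.inverse (taylor 4 Complex.Gamma 1 3 ^ 2)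

/-- `Γ(2/3 - H⁽¹⁾/3)⁶ Γ(1 + H⁽¹⁾)² 𝟙⁽¹⁾ + Γ(1/3 - H⁽²⁾/3)⁶ Γ(1 + H⁽²⁾)² 𝟙⁽²⁾`, the narrow part
of the Gamma class of the tangent bundle of the total space of `𝒪(-1)^{⊕6}` over `ℙ(3,3)`. -/
def gammaFJRW : HFJRW :=
  (taylor 2 Complex.Gamma (2 / 3) (-1 / 3) ^ 6 * taylor 2 Complex.Gamma 1 1 ^ 2,
   taylor 2 Complex.Gamma (1 / 3) (-1 / 3) ^ 6 * taylor 2 Complex.Gamma 1 1 ^ 2)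

/-! ### The `I`-functions, as functions of `x = log v` and `y = log u` -/

/-- The `n`-th term
`z v^{p/z + n} ∏_{0 < b ≤ 3n} (3p + bz)² / ∏_{0 < b ≤ n} (p + bz)⁶` of `I_GW`, `v = exp x`. -/
def termGW (x z : ℂ) (n : ℕ) : HGW :=
  (z * Complex.exp (n * x)) • (IsNilpotent.exp ((x / z) • pGW) *
    (∏ b ∈ Finset.Icc 1 (3 * n), ((3 : ℂ) • pGW + algebraMap ℂ HGW (b * z))) ^ 2 *
    Ring.inverse ((∏ b ∈ Finset.Icc 1 n, (pGW + algebraMap ℂ HGW (b * z))) ^ 6))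

/-- `I_GW(v, z)` with `v = exp x`. -/
def IGW (x z : ℂ) : HGW := ∑' n : ℕ, termGW x z n

/-- The factor
`z u^{d + 1 + H/z} 3^{-6⌊d/3⌋} ∏_{0 < b ≤ d, b ≡ d + 1 mod 3} (H + bz)⁶ / ∏_{0 < b ≤ d} (H + bz)²`
in `H^*(ℙ(3,3))`, where `u = exp y`. -/
def factorFJRW (y z : ℂ) (d : ℕ) : TruncAlg 2 :=
  (z * Complex.exp ((d + 1) * y) / 3 ^ (6 * (d / 3))) • (IsNilpotent.exp ((y / z) • gen 2) *
    (∏ b ∈ (Finset.Icc 1 d).filter (fun b => b % 3 = (d + 1) % 3),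
      (gen 2 + algebraMap ℂ (TruncAlg 2) (b * z))) ^ 6 *
    Ring.inverse ((∏ b ∈ Finset.Icc 1 d, (gen 2 + algebraMap ℂ (TruncAlg 2) (b * z))) ^ 2))

/-- The `d`-th term of `I_FJRW`: it lies in the summand of `𝟙⁽ᵈ⁺¹⁾` (upper index modulo `3`),
and is absent for `d ≡ -1 mod 3`. -/
def termFJRW (y z : ℂ) (d : ℕ) : HFJRW :=
  if d % 3 = 0 then (factorFJRW y z d, 0)
  else if d % 3 = 1 then (0, factorFJRW y z d)
  else 0

/-- `I_FJRW(u, z)` with `u = exp y`. -/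
def IFJRW (y z : ℂ) : HFJRW := ∑' d : ℕ, termFJRW y z d

/-! ### The `𝔥`-functions: the solutions of `I = z^{-Gr/2} (Γ · (2πi)^{deg₀/2} 𝔥)` -/

/-- `𝔥_GW(v, z)` with `v = exp x`. -/
def hGW (x z : ℂ) : HGW :=
  powDegGW (2 * Real.pi * Complex.I)⁻¹ (Ring.inverse gammaGW * powGrGW z (IGW x z))

/-- `𝔥_FJRW(u, z)` with `u = exp y`. -/
def hFJRW (y z : ℂ) : HFJRW :=
  powDegFJRW (2 * Real.pi * Complex.I)⁻¹ (Ring.inverse gammaFJRW * powGrFJRW z (IFJRW y z))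

namespace TruncAlg

theorem gen_pow (n : ℕ) : gen n ^ n = 0 := by
  have h := AdjoinRoot.eval₂_root (X ^ n : ℂ[X])
  rwa [eval₂_X_pow] at h

theorem gen_nilpotent (n : ℕ) : IsNilpotent (gen n) := ⟨n, gen_pow n⟩

theorem coeff_gen_pow (n i j : ℕ) (hj : j < n) : coeff n i (gen n ^ j) = if i = j then 1 else 0 := by
  have h : gen n ^ j = AdjoinRoot.mk (X ^ n : ℂ[X]) (X ^ j) := by
    rw [map_pow, AdjoinRoot.mk_X]; rfl
  have h2 : (X ^ j : ℂ[X]) %ₘ X ^ n = X ^ j := by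
    rw [Polynomial.modByMonic_eq_self_iff (monic_X_pow n), degree_X_pow, degree_X_pow]
    exact_mod_cast hj
  rw [h, coeff, LinearMap.comp_apply, AdjoinRoot.modByMonicHom_mk, h2, lcoeff_apply, coeff_X_pow]

theorem coeff_scale (n : ℕ) (m : ℤ) (c : ℂ) (a : TruncAlg n) (j : ℕ) (hj : j < n) :
    coeff n j (scale n m c a) = c ^ ((j : ℤ) + m) * coeff n j a := by
  simp only [scale, LinearMap.sum_apply, LinearMap.smul_apply, LinearMap.smulRight_apply, map_sum,
    map_smul, smul_eq_mul]
  rw [Finset.sum_eq_single j]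
  · rw [coeff_gen_pow n j j hj]; simp
  · intro i hi hij
    rw [coeff_gen_pow n j i (Finset.mem_range.1 hi), if_neg (Ne.symm hij)]; simp
  · intro h; exact absurd (Finset.mem_range.2 hj) h

theorem scale_scale_inv (n : ℕ) (m : ℤ) (c : ℂ) (hc : c ≠ 0) (a : TruncAlg n) :
    scale n m c (scale n m c⁻¹ a) = a := by
  apply coeffs_injective n
  funext j
  change coeff n j _ = coeff n j a
  rw [coeff_scale n m c _ j j.2, coeff_scale n m c⁻¹ _ j j.2, inv_zpow, ← mul_assoc,
    mul_inv_cancel₀ (zpow_ne_zero _ hc), one_mul]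

theorem isUnit_taylor (n : ℕ) (f : ℂ → ℂ) (a c : ℂ) (hf : f a ≠ 0) : IsUnit (taylor n f a c) := by
  rcases n with _ | n
  · have h : (0 : TruncAlg 0) = 1 := by simpa using (gen_pow 0).symm
    rw [show taylor 0 f a c = 1 by simpa [taylor] using h]
    exact isUnit_one
  · rw [taylor, Finset.sum_range_succ']
    refine IsNilpotent.isUnit_add_right_of_commute ?_ ?_ (Commute.all _ _)
    · refine isNilpotent_sum fun k _ => ?_
      refine IsNilpotent.smul ?_ _
      exact (IsNilpotent.smul (gen_nilpotent _) c).pow_succ k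
    · have : (iteratedDeriv 0 f a / ((Nat.factorial 0 : ℕ) : ℂ)) • (c • gen (n + 1)) ^ 0
          = algebraMap ℂ (TruncAlg (n + 1)) (f a) := by
        rw [Algebra.algebraMap_eq_smul_one]
        simp
      rw [this]
      exact (isUnit_iff_ne_zero.2 hf).map _

end TruncAlg

theorem isUnit_gammaGW : IsUnit gammaGW := by
  have h : Complex.Gamma 1 ≠ 0 := by simp
  exact ((isUnit_taylor 4 _ 1 1 h).pow 6).mul
    (isUnit_ringInverse.2 ((isUnit_taylor 4 _ 1 3 h).pow 2))

theorem isUnit_gammaFJRW : IsUnit gammaFJRW := by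
  have h : Complex.Gamma 1 ≠ 0 := by simp
  have h1 : Complex.Gamma (2 / 3) ≠ 0 := Complex.Gamma_ne_zero_of_re_pos (by norm_num)
  have h2 : Complex.Gamma (1 / 3) ≠ 0 := Complex.Gamma_ne_zero_of_re_pos (by norm_num)
  rw [Prod.isUnit_iff]
  exact ⟨((isUnit_taylor 2 _ _ _ h1).pow 6).mul ((isUnit_taylor 2 _ _ _ h).pow 2),
    ((isUnit_taylor 2 _ _ _ h2).pow 6).mul ((isUnit_taylor 2 _ _ _ h).pow 2)⟩

/-- The defining equation of `𝔥_GW`. -/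
theorem IGW_eq (x z : ℂ) (hz : z ≠ 0) :
    IGW x z = powGrGW z⁻¹ (gammaGW * powDegGW (2 * Real.pi * Complex.I) (hGW x z)) := by
  have h := scale_scale_inv 4 0 z⁻¹ (inv_ne_zero hz) (IGW x z)
  rw [inv_inv] at h
  rw [hGW, powDegGW, powDegGW, scale_scale_inv _ _ _ Complex.two_pi_I_ne_zero, ← mul_assoc,
    Ring.mul_inverse_cancel _ isUnit_gammaGW, one_mul, powGrGW, powGrGW, h]

/-- The defining equation of `𝔥_FJRW`. -/
theorem IFJRW_eq (y z : ℂ) (hz : z ≠ 0) :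
    IFJRW y z = powGrFJRW z⁻¹ (gammaFJRW * powDegFJRW (2 * Real.pi * Complex.I) (hFJRW y z)) := by
  have h1 := scale_scale_inv 2 0 z⁻¹ (inv_ne_zero hz) (IFJRW y z).1
  have h2 := scale_scale_inv 2 2 z⁻¹ (inv_ne_zero hz) (IFJRW y z).2
  rw [inv_inv] at h1 h2
  have h3 : ∀ a : HFJRW, powDegFJRW (2 * Real.pi * Complex.I)
      (powDegFJRW (2 * Real.pi * Complex.I)⁻¹ a) = a := fun a =>
    Prod.ext (scale_scale_inv 2 (-2) _ Complex.two_pi_I_ne_zero a.1)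
      (scale_scale_inv 2 (-2) _ Complex.two_pi_I_ne_zero a.2)
  rw [hFJRW, h3, ← mul_assoc, Ring.mul_inverse_cancel _ isUnit_gammaFJRW, one_mul]
  exact Prod.ext h1.symm h2.symm

/-! ### The linear maps `𝕌_l` -/

/-- `ζ = exp(2πi/3)`. -/
def zeta : ℂ := Complex.exp (2 * Real.pi * Complex.I / 3)

theorem zeta_ne_zero : zeta ≠ 0 := Complex.exp_ne_zero _

/-- The unit `ζᵏ eᵖ` of `H_GW`. -/
def zetaExp (k : ℕ) : HGWˣ where
  val := zeta ^ k • IsNilpotent.exp pGW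
  inv := (zeta ^ k)⁻¹ • IsNilpotent.exp (-pGW)
  val_inv := by
    rw [smul_mul_smul_comm, IsNilpotent.exp_mul_exp_neg_self (gen_nilpotent 4),
      mul_inv_cancel₀ (pow_ne_zero _ zeta_ne_zero), one_smul]
  inv_val := by
    rw [smul_mul_smul_comm, IsNilpotent.exp_neg_mul_exp_self (gen_nilpotent 4),
      inv_mul_cancel₀ (pow_ne_zero _ zeta_ne_zero), one_smul]

/-- `(l/9) (ζᵏeᵖ)ˡ / (1 - ζᵏeᵖ) + (1/9) (ζᵏeᵖ)ˡ⁺¹ / (1 - ζᵏeᵖ)²`, the image of `𝟙⁽ᵏ⁾`. -/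
def imageOne (l : ℤ) (k : ℕ) : HGW :=
  ((l : ℂ) / 9) • (((zetaExp k ^ l : HGWˣ) : HGW) * Ring.inverse (1 - (zetaExp k : HGW))) +
  (1 / 9 : ℂ) • (((zetaExp k ^ (l + 1) : HGWˣ) : HGW) *
    Ring.inverse ((1 - (zetaExp k : HGW)) ^ 2))

/-- `(1/3) (ζᵏeᵖ)ˡ / (1 - ζᵏeᵖ)`, the image of `H⁽ᵏ⁾`. -/
def imageHyp (l : ℤ) (k : ℕ) : HGW :=
  (1 / 3 : ℂ) • (((zetaExp k ^ l : HGWˣ) : HGW) * Ring.inverse (1 - (zetaExp k : HGW)))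

/-- The linear map `𝕌_l : H_FJRW → H_GW` with the prescribed values on the basis
`𝟙⁽¹⁾, H⁽¹⁾, 𝟙⁽²⁾, H⁽²⁾`. -/
def U (l : ℤ) : HFJRW →ₗ[ℂ] HGW :=
  ((coeff 2 0).smulRight (imageOne l 1) + (coeff 2 1).smulRight (imageHyp l 1)).coprod
    ((coeff 2 0).smulRight (imageOne l 2) + (coeff 2 1).smulRight (imageHyp l 2))

theorem U_one1 (l : ℤ) : U l one1 = imageOne l 1 := by
  have h0 := coeff_gen_pow 2 0 0 (by norm_num)
  have h1 := coeff_gen_pow 2 1 0 (by norm_num)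
  rw [pow_zero] at h0 h1
  simp [U, one1, h0, h1]

theorem U_one2 (l : ℤ) : U l one2 = imageOne l 2 := by
  have h0 := coeff_gen_pow 2 0 0 (by norm_num)
  have h1 := coeff_gen_pow 2 1 0 (by norm_num)
  rw [pow_zero] at h0 h1
  simp [U, one2, h0, h1]

theorem U_hyp1 (l : ℤ) : U l hyp1 = imageHyp l 1 := by
  have h0 := coeff_gen_pow 2 0 1 (by norm_num)
  have h1 := coeff_gen_pow 2 1 1 (by norm_num)
  rw [pow_one] at h0 h1
  simp [U, hyp1, h0, h1]

theorem U_hyp2 (l : ℤ) : U l hyp2 = imageHyp l 2 := by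
  have h0 := coeff_gen_pow 2 0 1 (by norm_num)
  have h1 := coeff_gen_pow 2 1 1 (by norm_num)
  rw [pow_one] at h0 h1
  simp [U, hyp2, h0, h1]

/-- `1 - ζᵏeᵖ` is invertible for `k = 1, 2`. -/
theorem isUnit_one_sub_zetaExp (k : ℕ) (hk : k = 1 ∨ k = 2) : IsUnit (1 - (zetaExp k : HGW)) := by
  have hz : IsPrimitiveRoot zeta 3 := by
    simpa [zeta] using Complex.isPrimitiveRoot_exp 3 (by norm_num)
  have hne : 1 - zeta ^ k ≠ 0 := by
    rw [sub_ne_zero]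
    exact (hz.pow_ne_one_of_pos_of_lt (by omega) (by omega)).symm
  have h : 1 - (zetaExp k : HGW) = algebraMap ℂ HGW (1 - zeta ^ k) +
      (-zeta ^ k) • (IsNilpotent.exp pGW - 1) := by
    rw [Algebra.algebraMap_eq_smul_one]
    simp only [zetaExp]
    module
  rw [h]
  exact IsNilpotent.isUnit_add_left_of_commute
    (IsNilpotent.smul (IsNilpotent.isNilpotent_exp_sub_one (gen_nilpotent 4)) _)
    ((isUnit_iff_ne_zero.2 hne).map _) (Commute.all _ _)

/-! ### The window `w_l` in the `log v`-plane -/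

/-- The `log v`-plane, cut along the line `Re (log v) = -6 log 3` except for the window `w_l`,
which is the open segment of that line with `2(l-1)π < Im (log v) < 2lπ`. -/
def windowDomain (l : ℤ) : Set ℂ :=
  {x | x.re = -6 * Real.log 3 → 2 * (l - 1) * Real.pi < x.im ∧ x.im < 2 * l * Real.pi}

end

/-! ### Jets in the truncated polynomial algebra. -/

namespace TruncAlg

variable {n : ℕ}

/-! Write x = log v and ε = p/(2πi), so that ε⁴ = 0. Dividing by the Gamma class turns the products
in `IGW` into Gamma quotients: 𝔥_GW = z ∑ₙ q(n+ε) e^{(n+ε)x} with q(s) = Γ(1+3s)²/Γ(1+s)⁶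
(`hGW_term`). Together with the reflection formula, the same manipulation turns the term d = 3m+r of
the FJRW series into z times the 1-jet of `residueFun` at t = m+(r+1)/3 in the direction H/3, up to
the (2πi)-grading (`hFJRW_factor`).

Both series are residue sums of one Barnes integral: q(s) e^{sx} K(s-ε) along Re s = -1/6, with the
1-periodic kernel K(u) = e^{-2πilu}/(1-e^{-2πiu}). Here q is bounded, while K behaves like e^{2πl Im
u} as Im u → -∞ and like e^{2π(l-1) Im u} as Im u → +∞. Hence the integral converges for 2π(l-1) <
Im x < 2πl, with no condition on Re x: this strip meets the critical line exactly in the window.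

To the right lie the simple poles n+ε of K, whose residues are the terms of 𝔥_GW
(`hasSum_gammaQuot`). To the left put t = -s; by reflection q(-t) is Γ(t)⁶/Γ(3t)² times sin⁶(πt)/(π⁴
sin²(3πt)) (`gammaQuot_neg`). The double poles at t ≡ 1/3, 2/3 mod 1 pair the value and the
derivative of `residueFun` with K and K'; since e^{2πiε} = e^p, these are the images prescribed by
𝕌_l (`taylor_residueJet`). The poles of K at t = n+1-ε contribute multiples of sin⁴(πε), which
vanish because ε⁴ = 0 (`taylor_integerResidue`).

The line of integration is moved one strip at a time instead of closing a contour. The functional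
equations bound the integral over the n-th line by a constant times (3⁶e^{Re x})ⁿ to the right and
(3⁻⁶e^{-Re x})ⁿ to the left, so the sums telescope on the respective sides of Re x = -6 log 3.

Analysis is done with complex ε, |ε| ≤ 1/12. Jets are taken at the end by Cauchy integrals over |ε|
= 1/12 (`circleTaylor`), which commute with dominated sums and preserve holomorphy in x. The
integral then glues the two half-planes, and the identity theorem on the connected domain settles
every other continuation. -/

theorem coeff_mk (f : ℂ[X]) {i : ℕ} (hi : i < n) :
    coeff n i (AdjoinRoot.mk (X ^ n) f) = f.coeff i := by
  rw [coeff, LinearMap.comp_apply, AdjoinRoot.modByMonicHom_mk, lcoeff_apply]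
  conv_rhs => rw [← modByMonic_add_div f (X ^ n : ℂ[X])]
  rw [coeff_add, coeff_X_pow_mul', if_neg (by omega), add_zero]

theorem ext_coeff {a b : TruncAlg n} (h : ∀ i < n, coeff n i a = coeff n i b) : a = b :=
  coeffs_injective n (funext fun i => h i i.2)

theorem coeff_mul (a b : TruncAlg n) {i : ℕ} (hi : i < n) :
    coeff n i (a * b) = ∑ j ∈ Finset.range (i + 1), coeff n j a * coeff n (i - j) b := by
  obtain ⟨f, rfl⟩ := AdjoinRoot.mk_surjective a
  obtain ⟨g, rfl⟩ := AdjoinRoot.mk_surjective b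
  rw [← map_mul, coeff_mk _ hi, Polynomial.coeff_mul,
    Finset.Nat.sum_antidiagonal_eq_sum_range_succ_mk]
  refine Finset.sum_congr rfl fun j hj => ?_
  have := Finset.mem_range.1 hj
  rw [coeff_mk _ (by omega), coeff_mk _ (by omega)]

theorem coeff_taylor (f : ℂ → ℂ) (a c : ℂ) {k : ℕ} (hk : k < n) :
    coeff n k (taylor n f a c) = iteratedDeriv k f a / (k.factorial : ℂ) * c ^ k := by
  rw [taylor, map_sum, Finset.sum_eq_single k]
  · rw [_root_.smul_pow, map_smul, map_smul, coeff_gen_pow n k k hk]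
    simp
  · intro i hi hik
    rw [_root_.smul_pow, map_smul, map_smul, coeff_gen_pow n k i (Finset.mem_range.1 hi), if_neg hik.symm]
    simp
  · intro h
    exact absurd (Finset.mem_range.2 hk) h

theorem taylor_congr {f g : ℂ → ℂ} {a : ℂ} (h : f =ᶠ[nhds a] g) (c : ℂ) :
    taylor n f a c = taylor n g a c :=
  ext_coeff fun i hi => by rw [coeff_taylor _ _ _ hi, coeff_taylor _ _ _ hi, h.iteratedDeriv_eq]

/-- Leibniz rule. Because jets are multiplicative, identities between holomorphic germs transfer to
the truncated algebra. -/
theorem taylor_mul {f g : ℂ → ℂ} {a : ℂ} (hf : AnalyticAt ℂ f a) (hg : AnalyticAt ℂ g a) (c : ℂ) :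
    taylor n (fun s => f s * g s) a c = taylor n f a c * taylor n g a c := by
  refine ext_coeff fun i hi => ?_
  rw [coeff_taylor _ _ _ hi, coeff_mul _ _ hi,
    iteratedDeriv_fun_mul hf.contDiffAt hg.contDiffAt, Finset.sum_div, Finset.sum_mul]
  refine Finset.sum_congr rfl fun j hj => ?_
  have hj : j ≤ i := by have := Finset.mem_range.1 hj; omega
  rw [coeff_taylor _ _ _ (by omega), coeff_taylor _ _ _ (by omega), Nat.cast_choose ℂ hj,
    show c ^ i = c ^ j * c ^ (i - j) by rw [← pow_add]; congr 1; omega]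
  have h : (i.factorial : ℂ) ≠ 0 := Nat.cast_ne_zero.2 i.factorial_ne_zero
  field_simp

theorem taylor_const_mul (w : ℂ) (f : ℂ → ℂ) (a c : ℂ) :
    taylor n (fun s => w * f s) a c = w • taylor n f a c := by
  refine ext_coeff fun i hi => ?_
  have := iteratedDeriv_fun_const_smul_field (n := i) (x := a) w f
  simp only [smul_eq_mul] at this
  rw [map_smul, coeff_taylor _ _ _ hi, coeff_taylor _ _ _ hi, this, smul_eq_mul]
  ring

theorem taylor_add {f g : ℂ → ℂ} {a : ℂ} (hf : AnalyticAt ℂ f a) (hg : AnalyticAt ℂ g a) (c : ℂ) :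
    taylor n (fun s => f s + g s) a c = taylor n f a c + taylor n g a c := by
  refine ext_coeff fun i hi => ?_
  have := iteratedDeriv_add (n := i) hf.contDiffAt hg.contDiffAt
  rw [map_add, coeff_taylor _ _ _ hi, coeff_taylor _ _ _ hi, coeff_taylor _ _ _ hi,
    show (fun s => f s + g s) = f + g from rfl, this]
  ring

theorem iteratedDeriv_comp_affine (f : ℂ → ℂ) (a c : ℂ) (k : ℕ) :
    iteratedDeriv k (fun s => f (a + c * s)) = fun s => c ^ k * iteratedDeriv k f (a + c * s) := by
  induction k with
  | zero => simp
  | succ k ih =>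
    funext s
    rw [iteratedDeriv_succ, ih, deriv_const_mul_field,
      deriv_comp_mul_left c (fun u => iteratedDeriv k f (a + u)), deriv_comp_const_add,
      ← iteratedDeriv_succ, smul_eq_mul]
    ring

theorem taylor_comp_affine (f : ℂ → ℂ) (a c d : ℂ) :
    taylor n (fun s => f (a + c * s)) 0 d = taylor n f a (c * d) := by
  refine ext_coeff fun i hi => ?_
  rw [coeff_taylor _ _ _ hi, coeff_taylor _ _ _ hi, iteratedDeriv_comp_affine]
  simp only [mul_zero, add_zero]
  ring

theorem taylor_const (w a c : ℂ) : taylor n (fun _ => w) a c = algebraMap ℂ (TruncAlg n) w := by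
  rcases n with _ | n
  · exact ext_coeff fun i hi => absurd hi (Nat.not_lt_zero i)
  · rw [taylor, Finset.sum_eq_single 0, Algebra.algebraMap_eq_smul_one]
    · simp
    · intro i _ hi
      rw [iteratedDeriv_const, if_neg hi]
      simp
    · simp

theorem taylor_one (a c : ℂ) : taylor n (fun _ => 1) a c = 1 := by
  rw [taylor_const, map_one]

theorem taylor_pow {f : ℂ → ℂ} {a : ℂ} (hf : AnalyticAt ℂ f a) (c : ℂ) (m : ℕ) :
    taylor n (fun s => f s ^ m) a c = taylor n f a c ^ m := by
  induction m with
  | zero => simpa using taylor_one a c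
  | succ m ih =>
    simp only [pow_succ]
    rw [taylor_mul (hf.fun_pow m) hf, ih]

theorem taylor_prod {ι : Type*} (S : Finset ι) {f : ι → ℂ → ℂ} {a : ℂ}
    (hf : ∀ i ∈ S, AnalyticAt ℂ (f i) a) (c : ℂ) :
    taylor n (fun s => ∏ i ∈ S, f i s) a c = ∏ i ∈ S, taylor n (f i) a c := by
  classical
  induction S using Finset.induction_on with
  | empty => simpa using taylor_one a c
  | insert i S hi ih =>
    simp only [Finset.prod_insert hi]
    rw [taylor_mul (hf i (Finset.mem_insert_self i S))
      (Finset.analyticAt_fun_prod _ fun j hj => hf j (Finset.mem_insert_of_mem hj)),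
      ih fun j hj => hf j (Finset.mem_insert_of_mem hj)]

theorem taylor_inv {f : ℂ → ℂ} {a : ℂ} (hf : AnalyticAt ℂ f a) (h0 : f a ≠ 0) (c : ℂ) :
    taylor n (fun s => (f s)⁻¹) a c = Ring.inverse (taylor n f a c) := by
  have h : taylor n f a c * taylor n (fun s => (f s)⁻¹) a c = 1 := by
    rw [← taylor_mul hf (hf.fun_inv h0), ← taylor_one a c]
    refine taylor_congr ?_ c
    filter_upwards [hf.continuousAt.eventually_ne h0] with s hs
    exact mul_inv_cancel₀ hs
  rw [← one_mul (taylor n (fun s => (f s)⁻¹) a c),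
    ← Ring.inverse_mul_cancel _ (isUnit_taylor n f a c h0), mul_assoc, h, mul_one]

theorem taylor_affine (hn : 2 ≤ n) (w v c : ℂ) :
    taylor n (fun s => v * s + w) 0 c = (v * c) • gen n + algebraMap ℂ (TruncAlg n) w := by
  rw [taylor_add (by fun_prop) (by fun_prop), taylor_const, taylor_const_mul]
  congr 1
  refine ext_coeff fun i hi => ?_
  rw [map_smul, map_smul, coeff_taylor _ _ _ hi, ← pow_one (gen n), coeff_gen_pow n i 1 (by omega)]
  rcases i with _ | _ | i
  · simp
  · simp
  · have : iteratedDeriv (i + 2) (fun s : ℂ => s) 0 = 0 := by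
      rw [iteratedDeriv_succ', iteratedDeriv_succ']
      simp
    simp [this]

theorem taylor_exp (w c : ℂ) :
    taylor n (fun s => Complex.exp (w * s)) 0 c = IsNilpotent.exp ((w * c) • gen n) := by
  have h : ((w * c) • gen n) ^ n = 0 := by rw [_root_.smul_pow, gen_pow, smul_zero]
  rw [IsNilpotent.exp_eq_sum h, taylor]
  refine Finset.sum_congr rfl fun k _ => ?_
  rw [iteratedDeriv_cexp_const_mul]
  simp only [mul_zero, Complex.exp_zero, mul_one]
  rw [_root_.smul_pow, _root_.smul_pow, smul_smul, ← Rat.cast_smul_eq_qsmul ℂ, smul_smul]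
  congr 1
  push_cast
  ring

/-- A grading operator rescales the nilpotent variable; this is how the powers of z and 2πi are
absorbed into the arguments of functions. -/
theorem scale_taylor (f : ℂ → ℂ) (a c d : ℂ) :
    scale n 0 c (taylor n f a d) = taylor n f a (c * d) := by
  refine ext_coeff fun i hi => ?_
  rw [coeff_scale _ _ _ _ _ hi, coeff_taylor _ _ _ hi, coeff_taylor _ _ _ hi, add_zero,
    zpow_natCast]
  ring

instance finiteDimensional : FiniteDimensional ℂ (TruncAlg n) :=
  (monic_X_pow n).finite_adjoinRoot

end TruncAlg

/-! ### The terms of the two series as jets of Gamma quotients. -/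

section Series

open TruncAlg Complex Filter Topology

/-- The quotient `Γ(1 + 3s)² / Γ(1 + s)⁶`. -/
noncomputable def gammaQuot (s : ℂ) : ℂ := Gamma (1 + 3 * s) ^ 2 / Gamma (1 + s) ^ 6

/-- The quotient `Γ(t)⁶ / Γ(3t)²`. -/
noncomputable def gammaDual (t : ℂ) : ℂ := Gamma t ^ 6 / Gamma (3 * t) ^ 2

/-- The numerator `e^{-xt} (Γ(t)⁶ / Γ(3t)²) (sin(πt) / π)⁶` of the residues. -/
noncomputable def residueFun (x t : ℂ) : ℂ :=
  exp (-(x * t)) * gammaDual t * (sin (Real.pi * t) / Real.pi) ^ 6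

theorem Gamma_add_one_add_nat {w : ℂ} (hw : -1 < w.re) (m : ℕ) :
    Gamma (1 + w + m) = Gamma (1 + w) * ∏ b ∈ Finset.Icc 1 m, (w + b) := by
  induction m with
  | zero => simp
  | succ m ih =>
    have h : 1 + w + m ≠ 0 := by
      intro h
      have := congrArg re h
      simp at this
      linarith [(Nat.cast_nonneg m : (0 : ℝ) ≤ m)]
    rw [Finset.prod_Icc_succ_top (by omega), ← mul_assoc, ← ih, mul_comm,
      show w + ((m + 1 : ℕ) : ℂ) = 1 + w + m by push_cast; ring, ← Gamma_add_one _ h]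
    push_cast
    ring_nf

theorem Gamma_add_nat {w : ℂ} (hw : 0 < w.re) (m : ℕ) :
    Gamma (w + m) = Gamma w * ∏ j ∈ Finset.range m, (w + j) := by
  induction m with
  | zero => simp
  | succ m ih =>
    have h : w + m ≠ 0 := by
      intro h
      have := congrArg re h
      simp at this
      linarith [(Nat.cast_nonneg m : (0 : ℝ) ≤ m)]
    rw [Finset.prod_range_succ, ← mul_assoc, ← ih, mul_comm, ← Gamma_add_one _ h]
    push_cast
    ring_nf

theorem analyticAt_Gamma {s : ℂ} (hs : 0 < s.re) : AnalyticAt ℂ Gamma s := by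
  have h : DifferentiableOn ℂ Gamma {s : ℂ | 0 < s.re} := fun t ht =>
    (differentiableAt_Gamma t fun m hm => by
      have := congrArg re hm
      simp at this
      have h2 : 0 < t.re := ht
      linarith [(Nat.cast_nonneg m : (0 : ℝ) ≤ m)]).differentiableWithinAt
  exact h.analyticAt ((isOpen_lt continuous_const continuous_re).mem_nhds hs)

theorem gammaGW_eq_taylor :
    gammaGW = taylor 4 (fun s => Gamma (1 + s) ^ 6 * (Gamma (1 + 3 * s) ^ 2)⁻¹) 0 1 := by
  have h1 : AnalyticAt ℂ (fun s : ℂ => Gamma (1 + s)) 0 :=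
    AnalyticAt.fun_comp (by simpa using analyticAt_Gamma (s := 1) (by simp)) (by fun_prop)
  have h3 : AnalyticAt ℂ (fun s : ℂ => Gamma (1 + 3 * s)) 0 :=
    AnalyticAt.fun_comp (by simpa using analyticAt_Gamma (s := 1) (by simp)) (by fun_prop)
  rw [taylor_mul (h1.fun_pow 6) ((h3.fun_pow 2).fun_inv (by simp)),
    taylor_inv (h3.fun_pow 2) (by simp), taylor_pow h1, taylor_pow h3,
    taylor_comp_affine Gamma 1 3 1]
  have := taylor_comp_affine (n := 4) Gamma 1 1 1
  simp only [one_mul, mul_one] at this ⊢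
  rw [this, gammaGW]

theorem termGW_eq_taylor (x z : ℂ) (hz : z ≠ 0) (n : ℕ) :
    termGW x z n = taylor 4 (fun s => (z * exp (n * x)) * (exp (x / z * s) *
      (∏ b ∈ Finset.Icc 1 (3 * n), (3 * s + b * z)) ^ 2 *
      ((∏ b ∈ Finset.Icc 1 n, (1 * s + b * z)) ^ 6)⁻¹)) 0 1 := by
  have hA : AnalyticAt ℂ (fun s : ℂ => exp (x / z * s)) 0 := by fun_prop
  have hB : AnalyticAt ℂ (fun s : ℂ => ∏ b ∈ Finset.Icc 1 (3 * n), (3 * s + b * z)) 0 :=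
    Finset.analyticAt_fun_prod _ fun b _ => by fun_prop
  have hC : AnalyticAt ℂ (fun s : ℂ => ∏ b ∈ Finset.Icc 1 n, (1 * s + b * z)) 0 :=
    Finset.analyticAt_fun_prod _ fun b _ => by fun_prop
  have hC0 : (∏ b ∈ Finset.Icc 1 n, (1 * (0 : ℂ) + b * z)) ^ 6 ≠ 0 := by
    refine pow_ne_zero _ (Finset.prod_ne_zero_iff.2 fun b hb => ?_)
    have := (Finset.mem_Icc.1 hb).1
    simp [hz]
    omega
  rw [taylor_const_mul, taylor_mul (hA.fun_mul (hB.fun_pow 2)) ((hC.fun_pow 6).fun_inv hC0),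
    taylor_mul hA (hB.fun_pow 2), taylor_inv (hC.fun_pow 6) hC0, taylor_pow hB, taylor_pow hC,
    taylor_prod _ fun b _ => by fun_prop, taylor_prod _ fun b _ => by fun_prop, taylor_exp]
  simp only [taylor_affine (n := 4) (by norm_num), mul_one, one_smul]
  rfl

/-- After s ↦ zs both products contribute z^{6n}, which cancels. The remaining Pochhammer products
merge with the Gamma class by Γ(w+1) = wΓ(w), and (2πi)⁻¹ becomes the direction of the jet. -/
theorem hGW_term (x z : ℂ) (hz : z ≠ 0) (n : ℕ) :
    powDegGW (2 * Real.pi * I)⁻¹ (Ring.inverse gammaGW * powGrGW z (termGW x z n)) =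
      z • taylor 4 (fun s => gammaQuot (n + s) * exp ((n + s) * x)) 0 (2 * Real.pi * I)⁻¹ := by
  have h1 : AnalyticAt ℂ (fun s : ℂ => Gamma (1 + s)) 0 :=
    AnalyticAt.fun_comp (by simpa using analyticAt_Gamma (s := 1) (by simp)) (by fun_prop)
  have h3 : AnalyticAt ℂ (fun s : ℂ => Gamma (1 + 3 * s)) 0 :=
    AnalyticAt.fun_comp (by simpa using analyticAt_Gamma (s := 1) (by simp)) (by fun_prop)
  have hg := (h1.fun_pow 6).fun_mul ((h3.fun_pow 2).fun_inv (by simp))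
  rw [powGrGW, powDegGW, termGW_eq_taylor x z hz, scale_taylor, gammaGW_eq_taylor,
    ← taylor_inv hg (by simp), mul_one, ← mul_one z, ← taylor_comp_affine _ 0 z 1, ← taylor_mul
      (hg.fun_inv (by simp)), scale_taylor, ← taylor_const_mul]
  · simp only [mul_one]
    refine taylor_congr ?_ _
    -- In this ball 1+3s has positive real part, so all the Gamma values involved are nonzero.
    filter_upwards [Metric.ball_mem_nhds (0 : ℂ) (show (0 : ℝ) < 1 / 4 by norm_num)] with s hs
    have hs' : |s.re| < 1 / 4 := (abs_re_le_norm s).trans_lt (by simpa using hs)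
    obtain ⟨hs1, hs2⟩ := abs_lt.1 hs'
    have e1 := Gamma_add_one_add_nat (w := s) (by linarith) n
    have e2 := Gamma_add_one_add_nat (w := 3 * s) (by simp; linarith) (3 * n)
    have n1 : Gamma (1 + s) ≠ 0 := Gamma_ne_zero_of_re_pos (by simp; linarith)
    have n2 : Gamma (1 + 3 * s) ≠ 0 := Gamma_ne_zero_of_re_pos (by simp; linarith)
    have n3 : Gamma (1 + s + n) ≠ 0 := Gamma_ne_zero_of_re_pos (by
      simp; linarith [(Nat.cast_nonneg n : (0 : ℝ) ≤ n)])
    have p1 : ∀ b : ℕ, 3 * (0 + z * s) + b * z = z * (3 * s + b) := fun b => by ring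
    have p2 : ∀ b : ℕ, 1 * (0 + z * s) + b * z = z * (s + b) := fun b => by ring
    rw [gammaQuot, show 1 + 3 * (n + s) = 1 + 3 * s + ((3 * n : ℕ) : ℂ) by push_cast; ring,
      show 1 + (n + s) = 1 + s + n by ring, e2, e1,
      show x / z * (0 + z * s) = s * x by field_simp; ring, add_mul, exp_add]
    simp only [p1, p2, Finset.prod_mul_distrib, Finset.prod_const, Nat.card_Icc]
    rw [e1] at n3
    have n4 := (mul_ne_zero_iff.1 n3).2
    simp only [Nat.add_sub_cancel]
    field_simp
    ring
  · simp only [mul_one]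
    have hC0 : (∏ b ∈ Finset.Icc 1 n, (1 * (0 + z * 0 : ℂ) + b * z)) ^ 6 ≠ 0 := by
      refine pow_ne_zero _ (Finset.prod_ne_zero_iff.2 fun b hb => ?_)
      have := (Finset.mem_Icc.1 hb).1
      simp [hz]
      omega
    have hB : AnalyticAt ℂ (fun s : ℂ => ∏ b ∈ Finset.Icc 1 (3 * n), (3 * (0 + z * s) + b * z)) 0 :=
      Finset.analyticAt_fun_prod _ fun b _ => by fun_prop
    have hC : AnalyticAt ℂ (fun s : ℂ => ∏ b ∈ Finset.Icc 1 n, (1 * (0 + z * s) + b * z)) 0 :=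
      Finset.analyticAt_fun_prod _ fun b _ => by fun_prop
    have hC' := (hC.fun_pow 6).fun_inv hC0
    fun_prop

/-- The factor of the FJRW Gamma class on the summand of `𝟙⁽ʳ⁺¹⁾`. -/
noncomputable def gammaFJRWComponent (r : ℕ) : TruncAlg 2 :=
  taylor 2 Gamma ((2 - r) / 3) (-1 / 3) ^ 6 * taylor 2 Gamma 1 1 ^ 2

theorem gammaFJRW_eq : gammaFJRW = (gammaFJRWComponent 0, gammaFJRWComponent 1) := by
  simp only [gammaFJRW, gammaFJRWComponent]
  norm_num

theorem analyticAt_Gamma_sub (r : ℕ) (hr : r ≤ 1) :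
    AnalyticAt ℂ (fun s : ℂ => Gamma ((2 - r) / 3 + (-1 / 3) * s)) 0 := by
  refine AnalyticAt.fun_comp (g := Gamma) ?_ (by fun_prop)
  apply analyticAt_Gamma
  interval_cases r <;> norm_num

theorem gammaFJRWComponent_eq_taylor (r : ℕ) (hr : r ≤ 1) :
    gammaFJRWComponent r = taylor 2 (fun s => Gamma ((2 - r) / 3 + (-1 / 3) * s) ^ 6 *
      Gamma (1 + 1 * s) ^ 2) 0 1 := by
  have h1 : AnalyticAt ℂ (fun s : ℂ => Gamma (1 + 1 * s)) 0 :=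
    AnalyticAt.fun_comp (by simpa using analyticAt_Gamma (s := 1) (by simp)) (by fun_prop)
  have h2 := analyticAt_Gamma_sub r hr
  rw [taylor_mul (h2.fun_pow 6) (h1.fun_pow 2), taylor_pow h1, taylor_pow h2,
    taylor_comp_affine Gamma, taylor_comp_affine Gamma, gammaFJRWComponent]
  simp only [mul_one]

theorem factorFJRW_eq_taylor (y z : ℂ) (hz : z ≠ 0) (d : ℕ) :
    factorFJRW y z d = taylor 2 (fun s => (z * exp ((d + 1) * y) / 3 ^ (6 * (d / 3))) *
      (exp (y / z * s) *
      (∏ b ∈ (Finset.Icc 1 d).filter (fun b => b % 3 = (d + 1) % 3), (1 * s + b * z)) ^ 6 *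
      ((∏ b ∈ Finset.Icc 1 d, (1 * s + b * z)) ^ 2)⁻¹)) 0 1 := by
  have hA : AnalyticAt ℂ (fun s : ℂ => exp (y / z * s)) 0 := by fun_prop
  have hB : AnalyticAt ℂ (fun s : ℂ =>
      ∏ b ∈ (Finset.Icc 1 d).filter (fun b => b % 3 = (d + 1) % 3), (1 * s + b * z)) 0 :=
    Finset.analyticAt_fun_prod _ fun b _ => by fun_prop
  have hC : AnalyticAt ℂ (fun s : ℂ => ∏ b ∈ Finset.Icc 1 d, (1 * s + b * z)) 0 :=
    Finset.analyticAt_fun_prod _ fun b _ => by fun_prop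
  have hC0 : (∏ b ∈ Finset.Icc 1 d, (1 * (0 : ℂ) + b * z)) ^ 2 ≠ 0 := by
    refine pow_ne_zero _ (Finset.prod_ne_zero_iff.2 fun b hb => ?_)
    have := (Finset.mem_Icc.1 hb).1
    simp [hz]
    omega
  rw [taylor_const_mul, taylor_mul (hA.fun_mul (hB.fun_pow 6)) ((hC.fun_pow 2).fun_inv hC0),
    taylor_mul hA (hB.fun_pow 6), taylor_inv (hC.fun_pow 2) hC0, taylor_pow hB, taylor_pow hC,
    taylor_prod _ fun b _ => by fun_prop, taylor_prod _ fun b _ => by fun_prop, taylor_exp]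
  simp only [taylor_affine (n := 2) le_rfl, mul_one, one_smul]
  rfl

theorem prod_filter_mod_three (m r : ℕ) (hr : r ≤ 1) (f : ℕ → ℂ) :
    ∏ b ∈ (Finset.Icc 1 (3 * m + r)).filter (fun b => b % 3 = (3 * m + r + 1) % 3), f b =
      ∏ j ∈ Finset.range m, f (3 * j + r + 1) := by
  symm
  refine Finset.prod_bij (fun j _ => 3 * j + r + 1) ?_ ?_ ?_ fun _ _ => rfl
  · intro j hj
    have := Finset.mem_range.1 hj
    simp only [Finset.mem_filter, Finset.mem_Icc]
    omega
  · intro i _ j _ h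
    omega
  · intro b hb
    simp only [Finset.mem_filter, Finset.mem_Icc] at hb
    exact ⟨b / 3, Finset.mem_range.2 (by omega), by omega⟩

theorem sin_pi_mul_add_nat_pow_even (w : ℂ) (m : ℕ) {k : ℕ} (hk : Even k) :
    sin (Real.pi * (w + m)) ^ k = sin (Real.pi * w) ^ k := by
  rw [show (Real.pi : ℂ) * (w + m) = Real.pi * w + m * Real.pi by ring,
    sin_antiperiodic.add_nat_mul_eq, mul_pow, ← pow_mul, mul_comm m k, pow_mul, hk.neg_one_pow,
    one_pow, one_mul]

/-- With w = (s+r+1)/3 the Gamma class contains Γ(1-w)⁶, and reflection trades its inverse for (Γ(w)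
sin(πw)/π)⁶. The factors b ≡ d+1 are 3z(w+j): their 3^{6m} cancels the denominator, and z^{2r}, the
degree of 𝟙⁽²⁾, balances the powers of z. -/
theorem hFJRW_factor (y z : ℂ) (hz : z ≠ 0) (m r : ℕ) (hr : r ≤ 1) :
    Ring.inverse (gammaFJRWComponent r) * (z ^ (2 * r) • scale 2 0 z (factorFJRW y z (3 * m + r))) =
      z • taylor 2 (fun s => residueFun (-3 * y) ((m + (r + 1) / 3) + 1 / 3 * s)) 0 1 := by
  have h1 : AnalyticAt ℂ (fun s : ℂ => Gamma (1 + 1 * s)) 0 :=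
    AnalyticAt.fun_comp (by simpa using analyticAt_Gamma (s := 1) (by simp)) (by fun_prop)
  have h2 := analyticAt_Gamma_sub r hr
  have hg := (h2.fun_pow 6).fun_mul (h1.fun_pow 2)
  have hg0 : Gamma ((2 - r) / 3 + (-1 / 3) * 0) ^ 6 * Gamma (1 + 1 * 0) ^ 2 ≠ 0 := by
    have : Gamma ((2 - r) / 3) ≠ 0 :=
      Gamma_ne_zero_of_re_pos (by interval_cases r <;> norm_num)
    simpa using this
  rw [factorFJRW_eq_taylor y z hz, scale_taylor, gammaFJRWComponent_eq_taylor r hr,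
    ← taylor_inv hg hg0, mul_one, ← mul_one z, ← taylor_comp_affine _ 0 z 1, ← taylor_const_mul,
    ← taylor_mul (hg.fun_inv hg0), ← taylor_const_mul]
  · simp only [mul_one]
    refine taylor_congr ?_ _
    filter_upwards [Metric.ball_mem_nhds (0 : ℂ) (show (0 : ℝ) < 1 / 4 by norm_num)] with s hs
    have hs' : |s.re| < 1 / 4 := (abs_re_le_norm s).trans_lt (by simpa using hs)
    obtain ⟨hs1, hs2⟩ := abs_lt.1 hs'
    have hm0 : (0 : ℝ) ≤ m := Nat.cast_nonneg m
    have hr0 : (0 : ℝ) ≤ r := Nat.cast_nonneg r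
    have hr1 : (r : ℝ) ≤ 1 := by exact_mod_cast hr
    -- From |Re s| < 1/4 it follows that 0 < Re w < 1, so both sides of the reflection formula are
    -- regular at w.
    obtain ⟨w, hw⟩ : ∃ w : ℂ, w = (s + r + 1) / 3 := ⟨_, rfl⟩
    have hwr : w.re = (s.re + r + 1) / 3 := by rw [hw]; simp
    have e1 := Gamma_add_one_add_nat (w := s) (by linarith) (3 * m + r)
    have e2 := Gamma_add_nat (w := w) (by rw [hwr]; linarith) m
    have e3 := Gamma_mul_Gamma_one_sub w
    have n1 : Gamma (1 + s) ≠ 0 := Gamma_ne_zero_of_re_pos (by simp; linarith)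
    have n2 : Gamma w ≠ 0 := Gamma_ne_zero_of_re_pos (by rw [hwr]; linarith)
    have n3 : Gamma (1 - w) ≠ 0 := Gamma_ne_zero_of_re_pos (by simp [hwr]; linarith)
    have n4 : Gamma (1 + s + (3 * m + r : ℕ)) ≠ 0 := Gamma_ne_zero_of_re_pos (by
      push_cast; simp; linarith)
    have n5 : sin (Real.pi * w) ≠ 0 := by
      intro h
      rw [h, div_zero] at e3
      exact mul_ne_zero n2 n3 e3
    have npi : (Real.pi : ℂ) ≠ 0 := ofReal_ne_zero.2 Real.pi_ne_zero
    have e4 : sin (Real.pi * w) = Real.pi / (Gamma w * Gamma (1 - w)) := by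
      rw [e3]
      field_simp
    have p1 : ∀ b : ℕ, 1 * (0 + z * s) + b * z = z * (s + b) := fun b => by ring
    have p2 : ∀ j : ℕ, z * (s + ((3 * j + r + 1 : ℕ) : ℂ)) = z * 3 * (w + j) := fun b => by
      rw [hw]; push_cast; ring
    rw [prod_filter_mod_three m r hr]
    simp only [p1, p2, Finset.prod_mul_distrib, Finset.prod_const, Nat.card_Icc, Finset.card_range]
    rw [residueFun, gammaDual, show (m + (r + 1) / 3 : ℂ) + 1 / 3 * s = w + m by rw [hw]; ring,
      show 3 * (w + m) = 1 + s + ((3 * m + r : ℕ) : ℂ) by rw [hw]; push_cast; ring,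
      div_pow (sin _), sin_pi_mul_add_nat_pow_even w m (k := 6) (by decide), e4, e1, e2,
      show (2 - r) / 3 + -1 / 3 * s = 1 - w by rw [hw]; ring, one_mul,
      show -(-3 * y * (w + m)) = (((3 * m + r : ℕ) : ℂ) + 1) * y + s * y by
        rw [hw]; push_cast; ring, exp_add,
      show y / z * (0 + z * s) = s * y by field_simp; ring,
      show (3 * m + r) / 3 = m by omega]
    rw [e1] at n4
    have n6 := (mul_ne_zero_iff.1 n4).2
    simp only [Nat.add_sub_cancel]
    field_simp
    ring
  · simp only [mul_one]
    have hC0 : (∏ b ∈ Finset.Icc 1 (3 * m + r), (1 * (0 + z * 0 : ℂ) + b * z)) ^ 2 ≠ 0 := by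
      refine pow_ne_zero _ (Finset.prod_ne_zero_iff.2 fun b hb => ?_)
      have := (Finset.mem_Icc.1 hb).1
      simp [hz]
      omega
    have hB : AnalyticAt ℂ (fun s : ℂ => ∏ b ∈ (Finset.Icc 1 (3 * m + r)).filter
        (fun b => b % 3 = (3 * m + r + 1) % 3), (1 * (0 + z * s) + b * z)) 0 :=
      Finset.analyticAt_fun_prod _ fun b _ => by fun_prop
    have hC : AnalyticAt ℂ (fun s : ℂ => ∏ b ∈ Finset.Icc 1 (3 * m + r),
        (1 * (0 + z * s) + b * z)) 0 :=
      Finset.analyticAt_fun_prod _ fun b _ => by fun_prop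
    have hC' := (hC.fun_pow 2).fun_inv hC0
    fun_prop

end Series

/-! ### A residue theorem for vertical strips. -/

section LineIntegrals

open MeasureTheory Filter Topology Complex

theorem integrable_of_norm_le_inv_one_add_sq {g : ℝ → ℂ} (hg : Continuous g) {C : ℝ}
    (hC : ∀ t : ℝ, 1 ≤ |t| → ‖g t‖ ≤ C / (1 + t ^ 2)) : Integrable g := by
  obtain ⟨K, hK⟩ := (isCompact_Icc (a := (-1 : ℝ)) (b := 1)).exists_bound_of_continuousOn
    hg.continuousOn
  refine ((integrable_inv_one_add_sq).const_mul (|C| + 2 * |K|)).mono' hg.aestronglyMeasurable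
    (Eventually.of_forall fun t => ?_)
  have hp : 0 < 1 + t ^ 2 := by positivity
  rw [← div_eq_mul_inv, le_div_iff₀ hp]
  rcases le_total 1 |t| with h | h
  · have := hC t h
    rw [le_div_iff₀ hp] at this
    linarith [le_abs_self C, abs_nonneg K]
  · have h1 := hK t (Set.mem_Icc.2 (abs_le.1 h))
    have h2 : t ^ 2 ≤ 1 := (sq_le_one_iff_abs_le_one t).2 h
    have h3 : ‖g t‖ * (1 + t ^ 2) ≤ |K| * 2 :=
      mul_le_mul (h1.trans (le_abs_self K)) (by linarith) (by positivity) (abs_nonneg K)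
    linarith [abs_nonneg C]

theorem line_ne_zero {c : ℝ} (hc : c ≠ 0) (t : ℝ) : (c : ℂ) + t * I ≠ 0 := fun h => hc (by
  simpa using congrArg re h)

theorem norm_line_sq (c t : ℝ) : ‖(c : ℂ) + t * I‖ ^ 2 = c ^ 2 + t ^ 2 := by
  rw [← normSq_eq_norm_sq, normSq_add_mul_I]

theorem continuous_line (c : ℝ) : Continuous fun t : ℝ => (c : ℂ) + t * I := by fun_prop

theorem integrable_inv_sq_line {c : ℝ} (hc : c ≠ 0) :
    Integrable fun t : ℝ => (((c : ℂ) + t * I) ^ 2)⁻¹ := by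
  refine integrable_of_norm_le_inv_one_add_sq (C := 2)
    (((continuous_line c).pow 2).inv₀ fun t => pow_ne_zero _ (line_ne_zero hc t)) fun t ht => ?_
  have h1 : 1 ≤ t ^ 2 := (one_le_sq_iff_one_le_abs t).2 ht
  rw [norm_inv, norm_pow, norm_line_sq, le_div_iff₀ (by positivity), inv_mul_le_iff₀ (by positivity)]
  nlinarith [sq_nonneg c]

theorem tendsto_inv_line (c : ℝ) {l : Filter ℝ} (hl : Tendsto (fun t : ℝ => |t|) l atTop) :
    Tendsto (fun t : ℝ => ((c : ℂ) + t * I)⁻¹) l (𝓝 0) := by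
  rw [tendsto_zero_iff_norm_tendsto_zero]
  refine squeeze_zero' (Eventually.of_forall fun _ => norm_nonneg _) ?_
    (tendsto_inv_atTop_zero.comp hl)
  filter_upwards [hl.eventually_gt_atTop 0] with t ht
  rw [norm_inv]
  refine inv_anti₀ ht ?_
  simpa using abs_im_le_norm ((c : ℂ) + t * I)

theorem integral_inv_sq_line {c : ℝ} (hc : c ≠ 0) :
    ∫ t : ℝ, (((c : ℂ) + t * I) ^ 2)⁻¹ = 0 := by
  have h : ∀ t : ℝ, HasDerivAt (fun t : ℝ => I * ((c : ℂ) + t * I)⁻¹)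
      (((c : ℂ) + t * I) ^ 2)⁻¹ t := by
    intro t
    have h1 : HasDerivAt (fun t : ℝ => (c : ℂ) + t * I) I t := by
      simpa using ((hasDerivAt_id t).ofReal_comp.mul_const I).const_add (c : ℂ)
    have h2 := (h1.inv (line_ne_zero hc t)).const_mul I
    have e : I * (-I / ((c : ℂ) + t * I) ^ 2) = (((c : ℂ) + t * I) ^ 2)⁻¹ := by
      rw [mul_div_assoc', mul_neg, I_mul_I, neg_neg, one_div]
    rw [← e]
    exact h2
  have h1 := (tendsto_inv_line c tendsto_abs_atBot_atTop).const_mul I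
  have h2 := (tendsto_inv_line c tendsto_abs_atTop_atTop).const_mul I
  rw [integral_of_hasDerivAt_of_tendsto h (integrable_inv_sq_line hc) h1 h2, sub_self]

/-- Neither term is integrable alone; the difference is O(t⁻²), which avoids principal values. -/
theorem integrable_inv_sub_inv_line {a b : ℝ} (ha : a ≠ 0) (hb : b ≠ 0) :
    Integrable fun t : ℝ => ((b : ℂ) + t * I)⁻¹ - ((a : ℂ) + t * I)⁻¹ := by
  refine integrable_of_norm_le_inv_one_add_sq (C := 2 * |a - b|)
    (((continuous_line b).inv₀ (line_ne_zero hb)).sub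
      ((continuous_line a).inv₀ (line_ne_zero ha))) fun t ht => ?_
  have h1 : 1 ≤ t ^ 2 := (one_le_sq_iff_one_le_abs t).2 ht
  rw [inv_sub_inv (line_ne_zero hb t) (line_ne_zero ha t), norm_div, norm_mul,
    show (a : ℂ) + t * I - (b + t * I) = ((a - b : ℝ) : ℂ) by push_cast; ring, norm_real,
    Real.norm_eq_abs]
  have h2 : ∀ c : ℝ, |t| ≤ ‖(c : ℂ) + t * I‖ := fun c => by
    simpa using abs_im_le_norm ((c : ℂ) + t * I)
  have h3 : t ^ 2 ≤ ‖(b : ℂ) + t * I‖ * ‖(a : ℂ) + t * I‖ := by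
    rw [← sq_abs, sq]
    exact mul_le_mul (h2 b) (h2 a) (abs_nonneg t) (norm_nonneg _)
  rw [div_le_div_iff₀ (by linarith) (by positivity)]
  nlinarith [abs_nonneg (a - b)]

theorem integral_inv_one_add_div_sq {c : ℝ} (hc : 0 < c) :
    ∫ t : ℝ, c / (c ^ 2 + t ^ 2) = Real.pi := by
  have h := Measure.integral_comp_div (fun t : ℝ => (1 + t ^ 2)⁻¹) c
  rw [integral_univ_inv_one_add_sq, abs_of_pos hc, smul_eq_mul] at h
  rw [← mul_right_inj' hc.ne', ← h, ← integral_const_mul]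
  refine integral_congr_ae (Eventually.of_forall fun t => ?_)
  have : c ^ 2 + t ^ 2 ≠ 0 := by positivity
  simp only
  field_simp

/-- Adding the values at t and -t removes the odd imaginary part and leaves multiples of Cauchy
densities, each of mass π. -/
theorem integral_inv_sub_inv_line {a b : ℝ} (ha : a < 0) (hb : 0 < b) :
    ∫ t : ℝ, (((b : ℂ) + t * I)⁻¹ - ((a : ℂ) + t * I)⁻¹) = 2 * Real.pi := by
  set G : ℝ → ℂ := fun t => ((b : ℂ) + t * I)⁻¹ - ((a : ℂ) + t * I)⁻¹ with hG
  have hi : Integrable G := integrable_inv_sub_inv_line ha.ne hb.ne'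
  have h1 : ∫ t, G (-t) = ∫ t, G t := integral_neg_eq_self G volume
  have h2 : ∫ t, (G t + G (-t)) = (∫ t, G t) + ∫ t, G t := by
    rw [integral_add hi hi.comp_neg, h1]
  have h3 : ∀ t, G t + G (-t) =
      ((2 * (b / (b ^ 2 + t ^ 2) + (-a) / ((-a) ^ 2 + t ^ 2)) : ℝ) : ℂ) := by
    intro t
    have e : ∀ c : ℝ, c ≠ 0 → ((c : ℂ) + t * I)⁻¹ + ((c : ℂ) + (-t : ℝ) * I)⁻¹ =
        ((2 * (c / (c ^ 2 + t ^ 2)) : ℝ) : ℂ) := by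
      intro c hc
      have n1 := line_ne_zero hc t
      have n2 := line_ne_zero hc (-t)
      have n3 : ((c : ℂ) + t * I) * ((c : ℂ) + (-t : ℝ) * I) = ((c ^ 2 + t ^ 2 : ℝ) : ℂ) := by
        push_cast
        linear_combination (-(t : ℂ) ^ 2) * I_sq
      have n4 : ((c ^ 2 + t ^ 2 : ℝ) : ℂ) ≠ 0 := by rw [← n3]; exact mul_ne_zero n1 n2
      rw [inv_add_inv n1 n2, n3, ofReal_mul, ofReal_div]
      push_cast
      ring
    have e1 := e b hb.ne'
    have e2 := e a ha.ne
    simp only [hG]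
    rw [show ∀ p q r s : ℂ, p - q + (r - s) = (p + r) - (q + s) from fun p q r s => by ring, e1, e2]
    push_cast
    ring
  -- A non-integrable function has integral `0` by convention, which contradicts the value π.
  have i1 : ∀ c : ℝ, 0 < c → Integrable fun t : ℝ => c / (c ^ 2 + t ^ 2) := fun c hc => by
    by_contra h
    have := integral_undef h
    rw [integral_inv_one_add_div_sq hc] at this
    exact Real.pi_ne_zero this
  have h4 : ∫ t, (G t + G (-t)) = ((4 * Real.pi : ℝ) : ℂ) := by
    simp only [h3]
    rw [integral_complex_ofReal, integral_const_mul, integral_add (i1 b hb) (i1 (-a) (by linarith)),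
      integral_inv_one_add_div_sq hb, integral_inv_one_add_div_sq (by linarith : 0 < -a)]
    norm_num
    ring
  have h5 : 2 * ∫ t, G t = 4 * Real.pi := by
    rw [two_mul, ← h2, h4]
    push_cast
    ring
  linear_combination h5 / 2

/-- The residue theorem for a strip with at most one pole, of order at most two. -/
theorem integral_line_sub_integral_line {F φ : ℂ → ℂ} {a b : ℝ} {s₀ : ℂ} (ha : a < s₀.re)
    (hb : s₀.re < b) {V : Set ℂ} (hV : IsOpen V) (hVs : ∀ s : ℂ, a ≤ s.re → s.re ≤ b → s ∈ V)
    (hφ : DifferentiableOn ℂ φ V)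
    (hF : ∀ s : ℂ, a ≤ s.re → s.re ≤ b → s ≠ s₀ → F s = φ s / (s - s₀) ^ 2) {C : ℝ}
    (hC : ∀ s : ℂ, a ≤ s.re → s.re ≤ b → 1 ≤ |s.im| → ‖F s‖ ≤ C / (1 + s.im ^ 2)) :
    Integrable (fun t : ℝ => F (a + t * I)) ∧ Integrable (fun t : ℝ => F (b + t * I)) ∧
      (∫ t : ℝ, F (b + t * I)) - ∫ t : ℝ, F (a + t * I) = 2 * Real.pi * deriv φ s₀ := by
  have hab : a < b := ha.trans hb
  have hline : ∀ c : ℝ, a ≤ c → c ≤ b → c ≠ s₀.re → Integrable (fun t : ℝ => F (c + t * I)) := by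
    intro c hac hcb hc
    have hne : ∀ t : ℝ, (c : ℂ) + t * I ≠ s₀ := fun t h => hc (by simpa using congrArg re h)
    refine integrable_of_norm_le_inv_one_add_sq (C := C) ?_ fun t ht => ?_
    · have : (fun t : ℝ => F (c + t * I)) =
          fun t : ℝ => φ (c + t * I) / ((c : ℂ) + t * I - s₀) ^ 2 :=
        funext fun t => hF _ (by simpa using hac) (by simpa using hcb) (hne t)
      rw [this]
      refine Continuous.div ?_ (by fun_prop) fun t => pow_ne_zero _ (sub_ne_zero.2 (hne t))
      exact hφ.continuousOn.comp_continuous (continuous_line c) fun t =>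
        hVs _ (by simpa using hac) (by simpa using hcb)
    · simpa using hC (c + t * I) (by simpa using hac) (by simpa using hcb) (by simpa using ht)
  have ia := hline a le_rfl hab.le ha.ne
  have ib := hline b hab.le le_rfl hb.ne'
  refine ⟨ia, ib, ?_⟩
  have hs0 : V ∈ 𝓝 s₀ := hV.mem_nhds (hVs s₀ ha.le hb.le)
  -- The second divided difference of φ is F minus its principal part, and it is holomorphic at s₀
  -- too.
  set R : ℂ → ℂ := dslope (dslope φ s₀) s₀ with hR
  have hRd : DifferentiableOn ℂ R V :=
    (differentiableOn_dslope hs0).2 ((differentiableOn_dslope hs0).2 hφ)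
  have hReq : ∀ s, a ≤ s.re → s.re ≤ b → s ≠ s₀ →
      R s = F s - φ s₀ * ((s - s₀) ^ 2)⁻¹ - deriv φ s₀ * (s - s₀)⁻¹ := by
    intro s h1 h2 hs
    have hs' := sub_ne_zero.2 hs
    rw [hF s h1 h2 hs, hR, dslope_of_ne _ hs, slope_def_field, dslope_same, dslope_of_ne _ hs,
      slope_def_field]
    field_simp
  -- the integrals of the principal part
  have hre : ∀ (c : ℝ) (t : ℝ), (c : ℂ) + t * I - s₀ = ((c - s₀.re : ℝ) : ℂ) + (t - s₀.im : ℝ) * I := by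
    intro c t
    conv_lhs => rw [← re_add_im s₀]
    push_cast
    ring
  have hca : a - s₀.re < 0 := by linarith
  have hcb : 0 < b - s₀.re := by linarith
  have d2i : ∀ c : ℝ, c - s₀.re ≠ 0 → Integrable fun t : ℝ => (((c : ℂ) + t * I - s₀) ^ 2)⁻¹ := by
    intro c hc
    simp only [hre]
    exact (integrable_inv_sq_line hc).comp_sub_right s₀.im
  have d2 : ∀ c : ℝ, c - s₀.re ≠ 0 → ∫ t : ℝ, (((c : ℂ) + t * I - s₀) ^ 2)⁻¹ = 0 := by
    intro c hc
    simp only [hre]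
    rw [integral_sub_right_eq_self (fun t : ℝ => ((((c - s₀.re : ℝ) : ℂ) + t * I) ^ 2)⁻¹) s₀.im,
      integral_inv_sq_line hc]
  have d1i : Integrable fun t : ℝ => ((b : ℂ) + t * I - s₀)⁻¹ - ((a : ℂ) + t * I - s₀)⁻¹ := by
    simp only [hre]
    exact (integrable_inv_sub_inv_line hca.ne hcb.ne').comp_sub_right s₀.im
  have d1 : ∫ t : ℝ, (((b : ℂ) + t * I - s₀)⁻¹ - ((a : ℂ) + t * I - s₀)⁻¹) = 2 * Real.pi := by
    simp only [hre]
    rw [integral_sub_right_eq_self (fun t : ℝ => (((b - s₀.re : ℝ) : ℂ) + t * I)⁻¹ -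
      (((a - s₀.re : ℝ) : ℂ) + t * I)⁻¹) s₀.im, integral_inv_sub_inv_line hca hcb]
  have hlr : ∀ t : ℝ, R (b + t * I) - R (a + t * I) = (F (b + t * I) - F (a + t * I)) -
      φ s₀ * ((((b : ℂ) + t * I - s₀) ^ 2)⁻¹ - (((a : ℂ) + t * I - s₀) ^ 2)⁻¹) -
      deriv φ s₀ * (((b : ℂ) + t * I - s₀)⁻¹ - ((a : ℂ) + t * I - s₀)⁻¹) := by
    intro t
    rw [hReq (b + t * I) (by simpa using hab.le) (by simp) (fun h => hb.ne' (by
      simpa using congrArg re h)), hReq (a + t * I) (by simp) (by simpa using hab.le)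
      (fun h => ha.ne (by simpa using congrArg re h))]
    ring
  have i3 : Integrable fun t : ℝ =>
      φ s₀ * ((((b : ℂ) + t * I - s₀) ^ 2)⁻¹ - (((a : ℂ) + t * I - s₀) ^ 2)⁻¹) :=
    ((d2i b hcb.ne').sub (d2i a hca.ne)).const_mul (φ s₀)
  have i4 := d1i.const_mul (deriv φ s₀)
  have iba : Integrable fun t : ℝ => F (b + t * I) - F (a + t * I) := ib.sub ia
  have iba3 : Integrable fun t : ℝ => F (b + t * I) - F (a + t * I) -
      φ s₀ * ((((b : ℂ) + t * I - s₀) ^ 2)⁻¹ - (((a : ℂ) + t * I - s₀) ^ 2)⁻¹) := iba.sub i3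
  have i5 : Integrable fun t : ℝ => R (b + t * I) - R (a + t * I) := by
    simp only [hlr]
    exact iba3.sub i4
  have e1 : ∫ t : ℝ, (R (b + t * I) - R (a + t * I)) =
      ((∫ t : ℝ, F (b + t * I)) - ∫ t : ℝ, F (a + t * I)) - 2 * Real.pi * deriv φ s₀ := by
    simp only [hlr]
    rw [integral_sub iba3 i4, integral_sub iba i3, integral_sub ib ia,
      integral_const_mul, integral_const_mul, d1, integral_sub (d2i b hcb.ne') (d2i a hca.ne),
      d2 b hcb.ne', d2 a hca.ne]
    ring
  -- Two limits of the truncated integrals are compared: the full integral, and 0 by Cauchy on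
  -- rectangles, whose horizontal sides tend to 0. Here dt = ds/i, hence the final 2π instead of
  -- 2πi.
  have t1 := intervalIntegral_tendsto_integral i5 tendsto_neg_atTop_atBot
    (tendsto_id (α := ℝ) (x := atTop))
  have hcont : ∀ c : ℝ, a ≤ c → c ≤ b → Continuous fun t : ℝ => R (c + t * I) := fun c h1 h2 =>
    hRd.continuousOn.comp_continuous (continuous_line c) fun t =>
      hVs _ (by simpa using h1) (by simpa using h2)
  have t2 : ∀ T : ℝ, ∫ t in (-T)..T, (R (b + t * I) - R (a + t * I)) =
      I * ((∫ x in a..b, R (x + (-T : ℝ) * I)) - ∫ x in a..b, R (x + T * I)) := by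
    intro T
    have hrect := integral_boundary_rect_eq_zero_of_differentiableOn R (a + (-T : ℝ) * I)
      (b + T * I) (hRd.mono fun s hs => by
        have h1 := hs.1
        simp only [Set.mem_preimage, add_re, ofReal_re, mul_re, I_re, mul_zero, ofReal_im, I_im,
          mul_one, sub_self, add_zero, Set.uIcc_of_le hab.le, Set.mem_Icc] at h1
        exact hVs s h1.1 h1.2)
    simp only [add_re, ofReal_re, mul_re, I_re, mul_zero, ofReal_im, I_im, mul_one, sub_self,
      add_zero, add_im, mul_im, zero_add, smul_eq_mul] at hrect
    rw [intervalIntegral.integral_sub ((hcont b hab.le le_rfl).intervalIntegrable _ _)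
      ((hcont a le_rfl hab.le).intervalIntegrable _ _)]
    linear_combination (-I) * hrect + ((∫ t in (-T)..T, R (b + t * I)) -
      ∫ t in (-T)..T, R (a + t * I)) * I_sq
  have t3 : Tendsto (fun T : ℝ => ∫ t in (-T)..T, (R (b + t * I) - R (a + t * I))) atTop (𝓝 0) := by
    simp only [t2]
    have hb1 : ∀ T : ℝ, 1 + |s₀.im| ≤ |T| → ‖∫ x in a..b, R (x + T * I)‖ ≤
        (C / (1 + T ^ 2) + ‖φ s₀‖ * ((|T| - |s₀.im|) ^ 2)⁻¹ + ‖deriv φ s₀‖ * (|T| - |s₀.im|)⁻¹) *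
          |b - a| := by
      intro T hT
      refine intervalIntegral.norm_integral_le_of_norm_le_const fun x hx => ?_
      rw [Set.uIoc_of_le hab.le] at hx
      have h0 : 0 < |T| - |s₀.im| := by linarith
      have h1 : |T| - |s₀.im| ≤ ‖(x : ℂ) + T * I - s₀‖ := by
        refine le_trans ?_ (abs_im_le_norm _)
        simpa using abs_sub_abs_le_abs_sub T s₀.im
      rw [hReq _ (by simpa using hx.1.le) (by simpa using hx.2) (fun h => by
        rw [h, sub_self, norm_zero] at h1; linarith)]
      refine (norm_sub_le _ _).trans (add_le_add ((norm_sub_le _ _).trans (add_le_add ?_ ?_)) ?_)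
      · simpa using hC (x + T * I) (by simpa using hx.1.le) (by simpa using hx.2)
          (by simpa using (le_add_of_nonneg_right (abs_nonneg _)).trans hT)
      · rw [norm_mul, norm_inv, norm_pow]
        gcongr
      · rw [norm_mul, norm_inv]
        gcongr
    have hlim : Tendsto (fun T : ℝ => (C / (1 + T ^ 2) + ‖φ s₀‖ * ((|T| - |s₀.im|) ^ 2)⁻¹ +
        ‖deriv φ s₀‖ * (|T| - |s₀.im|)⁻¹) * |b - a|) atTop (𝓝 0) := by
      have l0 : Tendsto (fun T : ℝ => |T| - |s₀.im|) atTop atTop :=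
        tendsto_atTop_add_const_right _ _ tendsto_abs_atTop_atTop
      have l1 : Tendsto (fun T : ℝ => C / (1 + T ^ 2)) atTop (𝓝 0) :=
        tendsto_const_nhds.div_atTop
          (tendsto_atTop_add_const_left _ _ (tendsto_pow_atTop (by norm_num)))
      have l2 := ((tendsto_inv_atTop_zero.comp ((tendsto_pow_atTop (n := 2)
        (by norm_num)).comp l0)).const_mul ‖φ s₀‖)
      have l3 := ((tendsto_inv_atTop_zero.comp l0).const_mul ‖deriv φ s₀‖)
      simpa using ((l1.add l2).add l3).mul_const |b - a|
    have hz : ∀ f : ℝ → ℝ, (∀ T, |f T| = |T|) →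
        Tendsto (fun T : ℝ => ∫ x in a..b, R (x + f T * I)) atTop (𝓝 0) := by
      intro f hf
      refine squeeze_zero_norm' ?_ hlim
      filter_upwards [eventually_ge_atTop (1 + |s₀.im|)] with T hT
      have := hb1 (f T) (by rw [hf]; exact hT.trans (le_abs_self T))
      rwa [hf, ← sq_abs, hf, sq_abs] at this
    have := ((hz (fun T => -T) fun T => abs_neg T).sub (hz (fun T => T) fun T => rfl)).const_mul I
    simpa using this
  have := tendsto_nhds_unique t1 t3
  rw [e1] at this
  linear_combination this

end LineIntegrals

/-! ### Poles of sine type and the Barnes kernel. -/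

section Kernel

open MeasureTheory Filter Topology Complex

theorem sin_pi_mul_eq_zero_iff (s : ℂ) : sin (Real.pi * s) = 0 ↔ ∃ k : ℤ, s = k := by
  have hpi : (Real.pi : ℂ) ≠ 0 := ofReal_ne_zero.2 Real.pi_ne_zero
  rw [sin_eq_zero_iff]
  refine exists_congr fun k => ?_
  rw [mul_comm, mul_left_inj' hpi]

theorem deriv_eq_zero_of_symm {f : ℂ → ℂ} {a : ℂ} (h : ∀ u, f (a - u) = f (a + u)) :
    deriv f a = 0 := by
  have h1 := deriv_comp_const_add f a 0
  have h2 := deriv_comp_const_sub f a 0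
  simp only [h, h1, sub_zero, add_zero] at h2
  linear_combination h2 / 2

/-- The residue theorem for a strip and a quotient by `sin²(πα(s - s₀))`. -/
theorem integral_line_sub_of_sin_sq {F ψ : ℂ → ℂ} {a b α : ℝ} {s₀ : ℂ} (hα : 0 < α)
    (ha : a < s₀.re) (hb : s₀.re < b) (ha' : α * (s₀.re - a) < 1) (hb' : α * (b - s₀.re) < 1)
    {V : Set ℂ} (hV : IsOpen V) (hVs : ∀ s : ℂ, a ≤ s.re → s.re ≤ b → s ∈ V)
    (hψ : DifferentiableOn ℂ ψ V)
    (hF : ∀ s : ℂ, a ≤ s.re → s.re ≤ b → s ≠ s₀ →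
      F s = ψ s / sin (Real.pi * (α * (s - s₀))) ^ 2) {C : ℝ}
    (hC : ∀ s : ℂ, a ≤ s.re → s.re ≤ b → 1 ≤ |s.im| → ‖F s‖ ≤ C / (1 + s.im ^ 2)) :
    Integrable (fun t : ℝ => F (a + t * I)) ∧ Integrable (fun t : ℝ => F (b + t * I)) ∧
      (∫ t : ℝ, F (b + t * I)) - ∫ t : ℝ, F (a + t * I) =
        2 * Real.pi * (deriv ψ s₀ / (Real.pi * α) ^ 2) := by
  have hpi : (Real.pi : ℂ) ≠ 0 := ofReal_ne_zero.2 Real.pi_ne_zero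
  have hα0 : (α : ℂ) ≠ 0 := ofReal_ne_zero.2 hα.ne'
  set q : ℂ → ℂ := fun s => sin (Real.pi * (α * (s - s₀))) with hq
  set D : ℂ → ℂ := dslope q s₀ with hD
  have hqd : Differentiable ℂ q := by fun_prop
  have hDd : Differentiable ℂ D := by
    rw [← differentiableOn_univ]
    exact (differentiableOn_dslope univ_mem).2 hqd.differentiableOn
  have hq0 : q s₀ = 0 := by simp [hq]
  have hDne : ∀ s, s ≠ s₀ → D s = q s / (s - s₀) := fun s hs => by
    rw [hD, dslope_of_ne _ hs, slope_def_field, hq0, sub_zero]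
  have hD0 : D s₀ = Real.pi * α := by
    have h1 : HasDerivAt q (Real.pi * α) s₀ := by
      have h2 : HasDerivAt (fun s : ℂ => (Real.pi : ℂ) * (α * (s - s₀))) (Real.pi * (α * 1)) s₀ :=
        (((hasDerivAt_id s₀).sub_const s₀).const_mul _).const_mul _
      simpa using h2.csin
    rw [hD, dslope_same, h1.deriv]
  -- The quotient sin(πα(s-s₀))/(s-s₀) is even about s₀.
  have hDd0 : deriv D s₀ = 0 := by
    refine deriv_eq_zero_of_symm fun u => ?_
    rcases eq_or_ne u 0 with rfl | hu
    · simp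
    · rw [hDne _ (by simpa using hu), hDne _ (by simpa using hu)]
      simp only [hq, sub_sub_cancel_left, add_sub_cancel_left, mul_neg, sin_neg]
      rw [neg_div_neg_eq]
  -- In this strip s₀ is the only zero of the sine.
  set W : Set ℂ := {s : ℂ | α * |s.re - s₀.re| < 1} with hW
  have hWo : IsOpen W := isOpen_lt (by fun_prop) continuous_const
  have hDW : ∀ s ∈ W, D s ≠ 0 := by
    intro s hs
    rcases eq_or_ne s s₀ with rfl | hne
    · rw [hD0]
      exact mul_ne_zero hpi hα0
    · rw [hDne s hne]
      refine div_ne_zero (fun h => hne ?_) (sub_ne_zero.2 hne)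
      obtain ⟨k, hk⟩ := (sin_pi_mul_eq_zero_iff _).1 h
      have h1 : α * (s.re - s₀.re) = k := by simpa using congrArg re hk
      have h2 : |(k : ℝ)| < 1 := by
        rw [← h1, abs_mul, abs_of_pos hα]
        exact hs
      have h3 : k = 0 := by
        rw [← Int.cast_abs] at h2
        exact Int.abs_lt_one_iff.1 (by exact_mod_cast h2)
      rw [h3, Int.cast_zero, mul_eq_zero, sub_eq_zero] at hk
      exact hk.resolve_left hα0
  have hWs : ∀ s : ℂ, a ≤ s.re → s.re ≤ b → s ∈ W := by
    intro s h1 h2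
    have h3 : |s.re - s₀.re| ≤ max (s₀.re - a) (b - s₀.re) := by
      rw [abs_le]
      constructor
      · linarith [le_max_left (s₀.re - a) (b - s₀.re)]
      · linarith [le_max_right (s₀.re - a) (b - s₀.re)]
    have h4 : α * max (s₀.re - a) (b - s₀.re) < 1 := by
      rcases max_choice (s₀.re - a) (b - s₀.re) with h | h <;> rw [h] <;> assumption
    exact (mul_le_mul_of_nonneg_left h3 hα.le).trans_lt h4
  have hmain := integral_line_sub_integral_line (F := F) (φ := fun s => ψ s / D s ^ 2) ha hb
    (hV.inter hWo) (fun s h1 h2 => ⟨hVs s h1 h2, hWs s h1 h2⟩)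
    ((hψ.mono Set.inter_subset_left).div (hDd.differentiableOn.pow 2)
      fun s hs => pow_ne_zero _ (hDW s hs.2)) (fun s h1 h2 hs => by
        have hs' := sub_ne_zero.2 hs
        rw [hF s h1 h2 hs, hDne s hs]
        have : q s ≠ 0 := by
          have := hDW s (hWs s h1 h2)
          rw [hDne s hs] at this
          exact (div_ne_zero_iff.1 this).1
        simp only [hq] at this ⊢
        field_simp) hC
  have hs0 : s₀ ∈ V := hVs s₀ ha.le hb.le
  have hψ0 : HasDerivAt ψ (deriv ψ s₀) s₀ := (hψ.differentiableAt (hV.mem_nhds hs0)).hasDerivAt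
  have hD2 : HasDerivAt D 0 s₀ := by
    rw [← hDd0]
    exact (hDd s₀).hasDerivAt
  -- Since D'(s₀) = 0, the value of ψ at s₀ does not enter the residue.
  have hder : deriv (fun s => ψ s / D s ^ 2) s₀ = deriv ψ s₀ / (Real.pi * α) ^ 2 := by
    have h1 := (hψ0.div (hD2.fun_pow 2) (by
      rw [hD0]
      exact pow_ne_zero _ (mul_ne_zero hpi hα0))).deriv
    have h2 : (fun s => ψ s / D s ^ 2) = ψ / fun s => D s ^ 2 := rfl
    rw [h2, h1, hD0]
    field_simp
    ring
  rw [← hder]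
  exact hmain

/-- The kernel `e^{-2πilu} / (1 - e^{-2πiu})` of the Barnes integral. -/
noncomputable def barnesKernel (l : ℤ) (u : ℂ) : ℂ :=
  exp (l * (-(2 * Real.pi * I) * u)) / (1 - exp (-(2 * Real.pi * I) * u))

/-- Periodicity needs l to be an integer. It lets every strip be compared with the first one. -/
theorem barnesKernel_sub_int (l m : ℤ) (u : ℂ) : barnesKernel l (u - m) = barnesKernel l u := by
  have h : ∀ k : ℤ, exp ((k : ℂ) * (-(2 * Real.pi * I) * (u - m))) =
      exp ((k : ℂ) * (-(2 * Real.pi * I) * u)) := fun k => by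
    rw [show (k : ℂ) * (-(2 * Real.pi * I) * (u - m)) =
      (k : ℂ) * (-(2 * Real.pi * I) * u) + ((k * m : ℤ) : ℂ) * (2 * Real.pi * I) by push_cast; ring,
      exp_periodic.int_mul (k * m)]
  have h1 := h 1
  simp only [Int.cast_one, one_mul] at h1
  rw [barnesKernel, barnesKernel, h, h1]

theorem barnesKernel_neg (l : ℤ) (u : ℂ) : barnesKernel l (-u) = -barnesKernel (1 - l) u := by
  have h0 : ∀ w : ℂ, exp (-w) / (1 - exp (-w)) = -(1 / (1 - exp w)) := by
    intro w
    rw [exp_neg]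
    have hw := exp_ne_zero w
    by_cases h : exp w = 1
    · simp [h]
    · have h1 : 1 - exp w ≠ 0 := sub_ne_zero.2 (Ne.symm h)
      have h2 : exp w - 1 ≠ 0 := sub_ne_zero.2 h
      have h3 : 1 - (exp w)⁻¹ ≠ 0 := by
        rw [sub_ne_zero]
        intro h4
        exact h (by rw [← inv_inv (exp w), ← h4, inv_one])
      field_simp
      ring
  have h1 := h0 (-(2 * Real.pi * I) * u)
  rw [barnesKernel, barnesKernel, show (l : ℂ) * (-(2 * Real.pi * I) * -u) =
    ((1 - l : ℤ) : ℂ) * (-(2 * Real.pi * I) * u) + -(-(2 * Real.pi * I) * u) by push_cast; ring,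
    exp_add, mul_div_assoc, show -(2 * Real.pi * I) * -u = -(-(2 * Real.pi * I) * u) by ring, h1]
  ring

theorem one_sub_exp_eq_sin (u : ℂ) :
    1 - exp (-(2 * Real.pi * I) * u) = 2 * I * exp (-(Real.pi * I * u)) * sin (Real.pi * u) := by
  rw [sin, show -(2 * Real.pi * I) * u = -(Real.pi * I * u) + -(Real.pi * I * u) by ring, exp_add,
    show -(Real.pi * u) * I = -(Real.pi * I * u) by ring,
    show Real.pi * u * I = Real.pi * I * u by ring]
  have h : exp (-(Real.pi * I * u)) * exp (Real.pi * I * u) = 1 := by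
    rw [← exp_add, neg_add_cancel, exp_zero]
  linear_combination (-exp (-(Real.pi * I * u)) ^ 2 + 1) * I_sq + I ^ 2 * h

theorem norm_exp_two_pi (u : ℂ) : ‖exp (-(2 * Real.pi * I) * u)‖ = Real.exp (2 * Real.pi * u.im) := by
  rw [norm_exp]
  simp

theorem one_sub_exp_ne_zero {u : ℂ} (hu : ∀ k : ℤ, u ≠ k) :
    1 - exp (-(2 * Real.pi * I) * u) ≠ 0 := by
  rw [one_sub_exp_eq_sin]
  refine mul_ne_zero (mul_ne_zero (mul_ne_zero two_ne_zero I_ne_zero) (exp_ne_zero _)) fun h => ?_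
  obtain ⟨k, hk⟩ := (sin_pi_mul_eq_zero_iff u).1 h
  exact hu k hk

theorem differentiableAt_barnesKernel (l : ℤ) {u : ℂ} (hu : ∀ k : ℤ, u ≠ k) :
    DifferentiableAt ℂ (barnesKernel l) u := by
  have := one_sub_exp_ne_zero hu
  unfold barnesKernel
  fun_prop (disch := assumption)

/-- Up to the constant, the two summands are those in the image of 𝟙⁽ᵏ⁾ under 𝕌_l. -/
theorem deriv_barnesKernel (l : ℤ) {u : ℂ} (hu : ∀ k : ℤ, u ≠ k) :
    deriv (barnesKernel l) u = -(2 * Real.pi * I) * (l * barnesKernel l u +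
      exp ((l + 1) * (-(2 * Real.pi * I) * u)) / (1 - exp (-(2 * Real.pi * I) * u)) ^ 2) := by
  have h0 := one_sub_exp_ne_zero hu
  have h1 : HasDerivAt (fun u : ℂ => -(2 * Real.pi * I) * u) (-(2 * Real.pi * I)) u := by
    simpa using (hasDerivAt_id u).const_mul (-(2 * Real.pi * I))
  have h2 := ((h1.const_mul (l : ℂ)).cexp.div (h1.cexp.const_sub 1) h0).deriv
  have h3 : barnesKernel l = (fun u : ℂ => exp (l * (-(2 * Real.pi * I) * u))) /
    fun u : ℂ => 1 - exp (-(2 * Real.pi * I) * u) := rfl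
  rw [h3, h2, Pi.div_apply, add_mul, exp_add, one_mul]
  field_simp
  ring

/-- The residue theorem for a strip and a simple pole of the Barnes kernel. -/
theorem integral_line_sub_of_barnesKernel {F f : ℂ → ℂ} {a b : ℝ} {s₀ : ℂ} (l : ℤ)
    (ha : a < s₀.re) (hb : s₀.re < b) (ha' : s₀.re - a < 1) (hb' : b - s₀.re < 1)
    {V : Set ℂ} (hV : IsOpen V) (hVs : ∀ s : ℂ, a ≤ s.re → s.re ≤ b → s ∈ V)
    (hf : DifferentiableOn ℂ f V)
    (hF : ∀ s : ℂ, a ≤ s.re → s.re ≤ b → s ≠ s₀ → F s = f s * barnesKernel l (s - s₀)) {C : ℝ}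
    (hC : ∀ s : ℂ, a ≤ s.re → s.re ≤ b → 1 ≤ |s.im| → ‖F s‖ ≤ C / (1 + s.im ^ 2)) :
    Integrable (fun t : ℝ => F (a + t * I)) ∧ Integrable (fun t : ℝ => F (b + t * I)) ∧
      (∫ t : ℝ, F (b + t * I)) - ∫ t : ℝ, F (a + t * I) = -I * f s₀ := by
  have hpi : (Real.pi : ℂ) ≠ 0 := ofReal_ne_zero.2 Real.pi_ne_zero
  set g : ℂ → ℂ := fun s => f s * (exp (l * (-(2 * Real.pi * I) * (s - s₀))) *
    exp (Real.pi * I * (s - s₀)) / (2 * I)) with hg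
  have hgd : DifferentiableOn ℂ g V := hf.mul (by fun_prop)
  -- The simple pole is written as g·sin/sin², so that the double-pole statement applies; the
  -- derivative of g·sin at s₀ is πg(s₀).
  have h := integral_line_sub_of_sin_sq (F := F)
    (ψ := fun s => g s * sin (Real.pi * (s - s₀))) (α := 1) one_pos ha hb (by linarith)
    (by linarith) hV hVs (hgd.mul (by fun_prop)) (fun s h1 h2 hs => by
      rw [hF s h1 h2 hs, barnesKernel, one_sub_exp_eq_sin, ofReal_one, one_mul, hg, exp_neg]
      have h3 := exp_ne_zero (Real.pi * I * (s - s₀))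
      by_cases h4 : sin (Real.pi * (s - s₀)) = 0
      · simp [h4]
      · have := I_ne_zero
        field_simp) hC
  refine ⟨h.1, h.2.1, h.2.2.trans ?_⟩
  have hs0 : s₀ ∈ V := hVs s₀ ha.le hb.le
  have h1 : HasDerivAt g (deriv g s₀) s₀ := (hgd.differentiableAt (hV.mem_nhds hs0)).hasDerivAt
  have h2 : HasDerivAt (fun s : ℂ => (Real.pi : ℂ) * (s - s₀)) (Real.pi * 1) s₀ :=
    ((hasDerivAt_id s₀).sub_const s₀).const_mul _
  have h3 := (h1.mul h2.csin).deriv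
  have h4 : (fun s => g s * sin (Real.pi * (s - s₀))) = g * fun s => sin (Real.pi * (s - s₀)) := rfl
  rw [h4, h3]
  simp only [hg, sub_self, mul_zero, sin_zero, cos_zero, exp_zero, ofReal_one, mul_one, zero_add,
    one_div]
  have := I_ne_zero
  field_simp
  rw [I_sq]
  ring

/-- With W = e^{-2πiu}, away from the poles |1-W| is at least 1/2 and at least |W|/2. The first
bound is sharp in order as Im u → -∞, the second as Im u → +∞; together they determine the window.
-/
theorem norm_barnesKernel_le (l : ℤ) {u : ℂ}
    (hu : 1 / 2 ≤ |u.im| ∨ 1 / 2 ≤ |Real.sin (2 * Real.pi * u.re)|) :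
    ‖barnesKernel l u‖ ≤ 2 * Real.exp (2 * Real.pi * l * u.im) ∧
      ‖barnesKernel l u‖ ≤ 2 * Real.exp (2 * Real.pi * (l - 1) * u.im) := by
  set W : ℂ := exp (-(2 * Real.pi * I) * u) with hW
  have hWn : ‖W‖ = Real.exp (2 * Real.pi * u.im) := norm_exp_two_pi u
  have hnum : ‖exp (l * (-(2 * Real.pi * I) * u))‖ = Real.exp (2 * Real.pi * l * u.im) := by
    rw [norm_exp]
    congr 1
    simp
    ring
  have hWim : W.im = -(‖W‖ * Real.sin (2 * Real.pi * u.re)) := by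
    rw [hWn, hW, exp_im]
    simp
  have hWp : 0 < ‖W‖ := by rw [hWn]; exact Real.exp_pos _
  have key : 1 / 2 ≤ ‖1 - W‖ ∧ ‖W‖ / 2 ≤ ‖1 - W‖ := by
    rcases hu with hu | hu
    · have h1 : ‖W‖ - 1 ≤ ‖1 - W‖ := by
        have := norm_sub_norm_le W 1
        rwa [norm_one, norm_sub_rev] at this
      have h2 : 1 - ‖W‖ ≤ ‖1 - W‖ := by
        have := norm_sub_norm_le 1 W
        rwa [norm_one] at this
      rcases abs_cases u.im with ⟨h3, -⟩ | ⟨h3, -⟩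
      · have : 2 ≤ ‖W‖ := by
          rw [hWn]
          have := Real.add_one_le_exp (2 * Real.pi * u.im)
          nlinarith [Real.pi_gt_three]
        constructor <;> linarith
      · have : ‖W‖ * 2 ≤ 1 := by
          have h4 := Real.add_one_le_exp (-(2 * Real.pi * u.im))
          rw [Real.exp_neg, ← hWn] at h4
          have h5 : 2 ≤ ‖W‖⁻¹ := by nlinarith [Real.pi_gt_three]
          calc ‖W‖ * 2 ≤ ‖W‖ * ‖W‖⁻¹ := by gcongr
            _ = 1 := mul_inv_cancel₀ hWp.ne'
        constructor <;> linarith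
    · have h1 : ‖W‖ / 2 ≤ ‖1 - W‖ := by
        refine le_trans ?_ (abs_im_le_norm _)
        rw [sub_im, one_im, zero_sub, abs_neg, hWim, abs_neg, abs_mul, abs_norm]
        nlinarith
      have h2 : 1 / 2 ≤ ‖1 - W‖ := by
        have h3 : W.re = ‖W‖ * Real.cos (2 * Real.pi * u.re) := by
          rw [hWn, hW, exp_re]
          simp
        have h4 : ‖1 - W‖ ^ 2 = (1 - W.re) ^ 2 + W.im ^ 2 := by
          rw [← normSq_eq_norm_sq, normSq_apply]
          simp
          ring
        -- The distance from 1 to W is at least the distance from 1 to the real line spanned by W,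
        -- namely |sin(arg W)|.
        have h5 : Real.sin (2 * Real.pi * u.re) ^ 2 ≤ ‖1 - W‖ ^ 2 := by
          rw [h4, hWim, h3]
          nlinarith [sq_nonneg (Real.cos (2 * Real.pi * u.re) - ‖W‖),
            Real.sin_sq_add_cos_sq (2 * Real.pi * u.re)]
        exact hu.trans (abs_le_of_sq_le_sq h5 (norm_nonneg _))
      exact ⟨h2, h1⟩
  have hd : 0 < ‖1 - W‖ := by linarith [key.1]
  rw [barnesKernel, norm_div, hnum, ← hW]
  constructor
  · rw [div_le_iff₀ hd]
    nlinarith [Real.exp_pos (2 * Real.pi * l * u.im), key.1]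
  · rw [div_le_iff₀ hd, show 2 * Real.pi * l * u.im = 2 * Real.pi * (l - 1) * u.im +
      2 * Real.pi * u.im by ring, Real.exp_add, ← hWn]
    nlinarith [Real.exp_pos (2 * Real.pi * (l - 1) * u.im), key.2]

end Kernel

/-! ### Bounds for the Gamma quotients and the integrand. -/

section Bounds

open MeasureTheory Filter Topology Complex

/-- On (0, 1) both power factors are dominated by those with real exponent c-1. -/
theorem exists_norm_betaIntegral_le {c : ℝ} (hc : 0 < c) :
    ∃ K : ℝ, ∀ u v : ℂ, c ≤ u.re → c ≤ v.re → ‖betaIntegral u v‖ ≤ K := by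
  have hi := betaIntegral_convergent (u := c) (v := c) (by simpa using hc) (by simpa using hc)
  refine ⟨∫ x in (0 : ℝ)..1, ‖(x : ℂ) ^ ((c : ℂ) - 1) * (1 - (x : ℂ)) ^ ((c : ℂ) - 1)‖,
    fun u v hu hv => ?_⟩
  refine intervalIntegral.norm_integral_le_of_norm_le zero_le_one ?_ hi.norm
  have h1 : ∀ᵐ x : ℝ, x ≠ 1 := by simp [ae_iff, measure_singleton]
  filter_upwards [h1] with x hx1 hx
  have hx0 : 0 < x := hx.1
  have hx2 : 0 < 1 - x := by linarith [lt_of_le_of_ne hx.2 hx1]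
  have e : (1 - (x : ℂ)) = ((1 - x : ℝ) : ℂ) := by push_cast; ring
  rw [e, norm_mul, norm_mul, norm_cpow_eq_rpow_re_of_pos hx0, norm_cpow_eq_rpow_re_of_pos hx0,
    norm_cpow_eq_rpow_re_of_pos hx2, norm_cpow_eq_rpow_re_of_pos hx2]
  simp only [sub_re, one_re, ofReal_re]
  exact mul_le_mul (Real.rpow_le_rpow_of_exponent_ge hx0 hx.2 (by linarith))
    (Real.rpow_le_rpow_of_exponent_ge hx2 (by linarith) (by linarith)) (by positivity)
    (by positivity)

/-- `gammaDual t` is the square of B(2t,t)·B(t,t), so Stirling's formula is not needed. -/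
theorem exists_norm_gammaDual_le {c : ℝ} (hc : 0 < c) :
    ∃ K : ℝ, 0 < K ∧ ∀ t : ℂ, c ≤ t.re → ‖gammaDual t‖ ≤ K := by
  obtain ⟨K, hK⟩ := exists_norm_betaIntegral_le hc
  refine ⟨(|K| * |K|) ^ 2 + 1, by positivity, fun t ht => ?_⟩
  have h0 : 0 < t.re := hc.trans_le ht
  have h2 : (2 * t).re = 2 * t.re := by simp
  have h3 : (3 * t).re = 3 * t.re := by simp
  have e1 := Gamma_mul_Gamma_eq_betaIntegral h0 h0
  have e2 := Gamma_mul_Gamma_eq_betaIntegral (s := 2 * t) (by linarith) h0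
  rw [← two_mul] at e1
  rw [show 2 * t + t = 3 * t by ring] at e2
  have n3 : Gamma (3 * t) ≠ 0 := Gamma_ne_zero_of_re_pos (by linarith)
  have e3 : gammaDual t = (betaIntegral (2 * t) t * betaIntegral t t) ^ 2 := by
    rw [gammaDual, show Gamma t ^ 6 = (Gamma t * Gamma t * Gamma t) ^ 2 by ring, e1,
      show Gamma (2 * t) * betaIntegral t t * Gamma t =
        Gamma (2 * t) * Gamma t * betaIntegral t t by ring, e2]
    field_simp
  rw [e3, norm_pow, norm_mul]
  have b1 := (hK t t ht ht).trans (le_abs_self K)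
  have b2 := (hK (2 * t) t (by linarith) ht).trans (le_abs_self K)
  have : (‖betaIntegral (2 * t) t‖ * ‖betaIntegral t t‖) ^ 2 ≤ (|K| * |K|) ^ 2 := by gcongr
  linarith

theorem gammaDual_add_one {t : ℂ} (ht : 0 < t.re) :
    gammaDual (t + 1) = gammaDual t * (t ^ 4 / (9 * (3 * t + 1) ^ 2 * (3 * t + 2) ^ 2)) := by
  have hne : ∀ w : ℂ, 0 < w.re → w ≠ 0 := fun w hw h => by simp [h] at hw
  have h0 := hne t ht
  have h3 : 3 * t ≠ 0 := hne _ (by simpa using ht)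
  have h31 : 3 * t + 1 ≠ 0 := hne _ (by simp; linarith)
  have h32 : 3 * t + 1 + 1 ≠ 0 := hne _ (by simp; linarith)
  have n3 : Gamma (3 * t) ≠ 0 := Gamma_ne_zero_of_re_pos (by simpa using ht)
  have h32' : 3 * t + 2 ≠ 0 := by
    rw [show 3 * t + 2 = 3 * t + 1 + 1 by ring]
    exact h32
  rw [gammaDual, gammaDual, Gamma_add_one t h0, show 3 * (t + 1) = 3 * t + 1 + 1 + 1 by ring,
    Gamma_add_one _ h32, Gamma_add_one _ h31, Gamma_add_one _ h3,
    show 3 * t + 1 + 1 = 3 * t + 2 by ring]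
  field_simp
  ring

/-- Each unit shift multiplies by at most 1/(9·3⁴) = 3⁻⁶, because 3|w| ≤ |3w+a| when Re w > 0 and a
≥ 0. This constant gives the critical line. -/
theorem norm_gammaDual_add_nat_le {t : ℂ} (ht : 0 < t.re) (m : ℕ) :
    ‖gammaDual (t + m)‖ ≤ ((3 : ℝ) ^ 6)⁻¹ ^ m * ‖gammaDual t‖ := by
  induction m with
  | zero => simp
  | succ m ih =>
    have hm : (0 : ℝ) ≤ m := Nat.cast_nonneg m
    set w : ℂ := t + m with hw
    have hwr : 0 < w.re := by
      simp only [hw, add_re, natCast_re]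
      linarith
    have key : ∀ a : ℝ, 0 ≤ a → 3 * ‖w‖ ≤ ‖3 * w + a‖ := by
      intro a ha
      have h1 : (3 * ‖w‖) ^ 2 ≤ ‖3 * w + a‖ ^ 2 := by
        rw [mul_pow, ← normSq_eq_norm_sq, ← normSq_eq_norm_sq, normSq_apply, normSq_apply]
        simp
        nlinarith [mul_nonneg hwr.le ha]
      exact le_of_sq_le_sq h1 (norm_nonneg _)
    have k1 := key 1 zero_le_one
    have k2 := key 2 zero_le_two
    push_cast at k1 k2
    have hw0 : 0 < ‖w‖ := norm_pos_iff.2 fun h => by simp [h] at hwr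
    have hq : ‖w ^ 4 / (9 * (3 * w + 1) ^ 2 * (3 * w + 2) ^ 2)‖ ≤ ((3 : ℝ) ^ 6)⁻¹ := by
      rw [norm_div, norm_mul, norm_mul, norm_pow, norm_pow, norm_pow, div_le_iff₀ (by
        have : 0 < ‖3 * w + 1‖ := by linarith
        have : 0 < ‖3 * w + 2‖ := by linarith
        have : 0 < ‖(9 : ℂ)‖ := by simp
        positivity)]
      have h1 : (3 * ‖w‖) ^ 2 * (3 * ‖w‖) ^ 2 ≤ ‖3 * w + 1‖ ^ 2 * ‖3 * w + 2‖ ^ 2 := by gcongr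
      have h9 : ‖(9 : ℂ)‖ = 9 := by simp
      rw [h9]
      linarith
    rw [show t + ((m + 1 : ℕ) : ℂ) = w + 1 by rw [hw]; push_cast; ring, gammaDual_add_one hwr,
      norm_mul, pow_succ]
    calc ‖gammaDual w‖ * ‖w ^ 4 / (9 * (3 * w + 1) ^ 2 * (3 * w + 2) ^ 2)‖
        ≤ (((3 : ℝ) ^ 6)⁻¹ ^ m * ‖gammaDual t‖) * ((3 : ℝ) ^ 6)⁻¹ := by gcongr
      _ = _ := by ring

theorem gammaQuot_add_one {s : ℂ} (h1 : 3 * s + 1 ≠ 0) (h2 : 3 * s + 2 ≠ 0) (h3 : s + 1 ≠ 0) :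
    gammaQuot (s + 1) = gammaQuot s * (9 * (3 * s + 2) ^ 2 * (3 * s + 1) ^ 2 / (s + 1) ^ 4) := by
  have e1 : 1 + 3 * (s + 1) = 1 + 3 * s + 1 + 1 + 1 := by ring
  have n1 : 1 + 3 * s ≠ 0 := by rwa [add_comm]
  have n2 : 1 + 3 * s + 1 ≠ 0 := by rwa [show 1 + 3 * s + 1 = 3 * s + 2 by ring]
  have n3 : 1 + 3 * s + 1 + 1 ≠ 0 := by
    rw [show 1 + 3 * s + 1 + 1 = 3 * (s + 1) by ring]
    exact mul_ne_zero three_ne_zero h3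
  have n4 : 1 + s ≠ 0 := by rwa [add_comm]
  rw [gammaQuot, gammaQuot, e1, Gamma_add_one _ n3, Gamma_add_one _ n2, Gamma_add_one _ n1,
    show 1 + (s + 1) = 1 + s + 1 by ring, Gamma_add_one _ n4,
    show 1 + 3 * s + 1 + 1 = 3 * (s + 1) by ring, show 1 + 3 * s + 1 = 3 * s + 2 by ring,
    show 1 + 3 * s = 3 * s + 1 by ring, show 1 + s = s + 1 by ring, mul_pow (s + 1),
    div_mul_div_comm, mul_comm ((s + 1) ^ 6), div_eq_div_iff_comm, ← sub_eq_zero]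
  -- If the denominator has the conventional value `0`, both sides are `0`.
  by_cases h : Gamma (s + 1) = 0
  · simp [h]
  · field_simp
    ring

/-- Each unit shift multiplies by at most 9·3⁴ = 3⁶, because |3w+a| ≤ 3|w+1| for a between 1 and 2
and Re w > -1/3. -/
theorem norm_gammaQuot_add_nat_le {s : ℂ} (hs : -1 / 3 < s.re) (m : ℕ) :
    ‖gammaQuot (s + m)‖ ≤ ((3 : ℝ) ^ 6) ^ m * ‖gammaQuot s‖ := by
  induction m with
  | zero => simp
  | succ m ih =>
    have hm : (0 : ℝ) ≤ m := Nat.cast_nonneg m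
    set w : ℂ := s + m with hw
    have hwr : -1 / 3 < w.re := by
      simp only [hw, add_re, natCast_re]
      linarith
    have hne : ∀ w : ℂ, 0 < w.re → w ≠ 0 := fun w hw h => by simp [h] at hw
    have key : ∀ a : ℝ, 1 ≤ a → a ≤ 2 → ‖3 * w + a‖ ≤ 3 * ‖w + 1‖ := by
      intro a ha ha'
      have h1 : ‖3 * w + a‖ ^ 2 ≤ (3 * ‖w + 1‖) ^ 2 := by
        rw [mul_pow, ← normSq_eq_norm_sq, ← normSq_eq_norm_sq, normSq_apply, normSq_apply]
        simp
        nlinarith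
      exact le_of_sq_le_sq h1 (by positivity)
    have k1 := key 1 le_rfl one_le_two
    have k2 := key 2 one_le_two le_rfl
    push_cast at k1 k2
    have h1 : w + 1 ≠ 0 := hne _ (by simp; linarith)
    have hw0 : 0 < ‖w + 1‖ := norm_pos_iff.2 h1
    have hq : ‖9 * (3 * w + 2) ^ 2 * (3 * w + 1) ^ 2 / (w + 1) ^ 4‖ ≤ (3 : ℝ) ^ 6 := by
      rw [norm_div, norm_mul, norm_mul, norm_pow, norm_pow, norm_pow, div_le_iff₀ (by positivity)]
      have h1 : ‖3 * w + 2‖ ^ 2 * ‖3 * w + 1‖ ^ 2 ≤ (3 * ‖w + 1‖) ^ 2 * (3 * ‖w + 1‖) ^ 2 := by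
        gcongr
      have h9 : ‖(9 : ℂ)‖ = 9 := by simp
      rw [h9]
      linarith
    rw [show s + ((m + 1 : ℕ) : ℂ) = w + 1 by rw [hw]; push_cast; ring,
      gammaQuot_add_one (hne _ (by simp; linarith)) (hne _ (by simp; linarith)) h1,
      norm_mul, pow_succ]
    calc ‖gammaQuot w‖ * ‖9 * (3 * w + 2) ^ 2 * (3 * w + 1) ^ 2 / (w + 1) ^ 4‖
        ≤ (((3 : ℝ) ^ 6) ^ m * ‖gammaQuot s‖) * (3 : ℝ) ^ 6 := by gcongr
      _ = _ := by ring

/-- The trigonometric factor that relates `Γ(1 - 3t)² / Γ(1 - t)⁶` to `Γ(t)⁶ / Γ(3t)²`. -/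
noncomputable def sinFactor (t : ℂ) : ℂ :=
  sin (Real.pi * t) ^ 4 / (Real.pi ^ 4 * (3 - 4 * sin (Real.pi * t) ^ 2) ^ 2)

/-- The reflection formula produces the right-hand side. Cancelling sin²(πt) by the triple-angle
formula gives the definition, which stays regular at integers. -/
theorem sinFactor_eq {t : ℂ} (ht : sin (Real.pi * t) ≠ 0) :
    sinFactor t = sin (Real.pi * t) ^ 6 / (Real.pi ^ 4 * sin (Real.pi * (3 * t)) ^ 2) := by
  rw [show (Real.pi : ℂ) * (3 * t) = 3 * (Real.pi * t) by ring, sin_three_mul,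
    show 3 * sin (Real.pi * t) - 4 * sin (Real.pi * t) ^ 3 =
      sin (Real.pi * t) * (3 - 4 * sin (Real.pi * t) ^ 2) by ring, sinFactor, mul_pow]
  rw [show Real.pi ^ 4 * (sin (Real.pi * t) ^ 2 * (3 - 4 * sin (Real.pi * t) ^ 2) ^ 2) =
    sin (Real.pi * t) ^ 2 * ((Real.pi : ℂ) ^ 4 * (3 - 4 * sin (Real.pi * t) ^ 2) ^ 2) by ring,
    show sin (Real.pi * t) ^ 6 = sin (Real.pi * t) ^ 2 * sin (Real.pi * t) ^ 4 by ring,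
    mul_div_mul_left _ _ (pow_ne_zero 2 ht)]

theorem sinFactor_add_nat (t : ℂ) (m : ℕ) : sinFactor (t + m) = sinFactor t := by
  rw [sinFactor, sinFactor, sin_pi_mul_add_nat_pow_even t m (by decide),
    sin_pi_mul_add_nat_pow_even t m (by decide)]

theorem three_sub_four_sin_sq_ne_zero {t : ℂ} (ht : ∀ j : ℤ, 3 * t = j → 3 ∣ j) :
    3 - 4 * sin (Real.pi * t) ^ 2 ≠ 0 := by
  intro h
  have h1 : sin (Real.pi * (3 * t)) = 0 := by
    rw [show (Real.pi : ℂ) * (3 * t) = 3 * (Real.pi * t) by ring, sin_three_mul]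
    linear_combination sin (Real.pi * t) * h
  obtain ⟨j, hj⟩ := (sin_pi_mul_eq_zero_iff _).1 h1
  obtain ⟨k, rfl⟩ := ht j hj
  have h2 : t = k := by
    push_cast at hj
    linear_combination hj / 3
  rw [(sin_pi_mul_eq_zero_iff t).2 ⟨k, h2⟩] at h
  norm_num at h

/-- Reflection formula at t and at 3t. -/
theorem gammaQuot_neg {t : ℂ} (ht : 0 < t.re) (h : sin (Real.pi * (3 * t)) ≠ 0) :
    gammaQuot (-t) = gammaDual t * sinFactor t := by
  have hs : sin (Real.pi * t) ≠ 0 := by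
    intro hs
    apply h
    rw [show (Real.pi : ℂ) * (3 * t) = 3 * (Real.pi * t) by ring, sin_three_mul, hs]
    ring
  have hpi : (Real.pi : ℂ) ≠ 0 := ofReal_ne_zero.2 Real.pi_ne_zero
  have n1 : Gamma t ≠ 0 := Gamma_ne_zero_of_re_pos ht
  have n3 : Gamma (3 * t) ≠ 0 := Gamma_ne_zero_of_re_pos (by simpa using ht)
  have e1 : Gamma (1 - t) = Real.pi / (sin (Real.pi * t) * Gamma t) := by
    rw [eq_div_iff (mul_ne_zero hs n1)]
    have := Gamma_mul_Gamma_one_sub t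
    rw [eq_div_iff hs] at this
    linear_combination this
  have e3 : Gamma (1 - 3 * t) = Real.pi / (sin (Real.pi * (3 * t)) * Gamma (3 * t)) := by
    rw [eq_div_iff (mul_ne_zero h n3)]
    have := Gamma_mul_Gamma_one_sub (3 * t)
    rw [eq_div_iff h] at this
    linear_combination this
  rw [sinFactor_eq hs, gammaQuot, gammaDual, show 1 + 3 * -t = 1 - 3 * t by ring,
    show 1 + -t = 1 - t by ring, e1, e3]
  field_simp

theorem norm_sinFactor_le_of_norm_sin {t : ℂ}
    (h : ‖sin (Real.pi * t) ^ 2‖ ≤ ‖3 - 4 * sin (Real.pi * t) ^ 2‖) : ‖sinFactor t‖ ≤ 1 := by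
  have hpi : (1 : ℝ) ≤ Real.pi ^ 4 := one_le_pow₀ (by linarith [Real.pi_gt_three])
  have e : sin (Real.pi * t) ^ 4 = (sin (Real.pi * t) ^ 2) ^ 2 := by ring
  rw [sinFactor, e, norm_div, norm_mul, norm_pow (_ ^ 2), norm_pow (3 - _), norm_pow (Real.pi : ℂ),
    norm_real, Real.norm_eq_abs, abs_of_pos Real.pi_pos]
  refine div_le_one_of_le₀ ?_ (by positivity)
  calc ‖sin (Real.pi * t) ^ 2‖ ^ 2 ≤ 1 * ‖3 - 4 * sin (Real.pi * t) ^ 2‖ ^ 2 := by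
        rw [one_mul]
        gcongr
    _ ≤ _ := by gcongr

/-- Here |sin²(πt)| ≥ 1, so |3 - 4 sin²| ≥ 4|sin²| - 3 ≥ |sin²|. -/
theorem norm_sinFactor_le_of_im {t : ℂ} (ht : 1 ≤ |t.im|) : ‖sinFactor t‖ ≤ 1 := by
  apply norm_sinFactor_le_of_norm_sin
  have h1 : 1 ≤ ‖sin (Real.pi * t)‖ ^ 2 := by
    obtain ⟨w, hw⟩ : ∃ w : ℂ, w = Real.pi * t := ⟨_, rfl⟩
    have hwi : 1 ≤ |w.im| := by
      rw [hw, im_ofReal_mul, abs_mul, abs_of_pos Real.pi_pos]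
      nlinarith [Real.pi_gt_three]
    have h4 : |w.im| ≤ |Real.sinh w.im| := by
      rw [Real.abs_sinh]
      exact Real.self_le_sinh_iff.2 (abs_nonneg _)
    have h5 : 1 ≤ Real.sinh w.im ^ 2 := (one_le_sq_iff_one_le_abs _).2 (hwi.trans h4)
    have h6 : sin w = ((Real.sin w.re * Real.cosh w.im : ℝ) : ℂ) +
        ((Real.cos w.re * Real.sinh w.im : ℝ) : ℂ) * I := by
      rw [sin_eq]
      push_cast
      rfl
    rw [← hw, h6, norm_line_sq, mul_pow, mul_pow, Real.cosh_sq]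
    nlinarith [Real.sin_sq_add_cos_sq w.re, sq_nonneg (Real.sin w.re)]
  have h3 := norm_sub_norm_le (4 * sin (Real.pi * t) ^ 2) 3
  rw [norm_sub_rev, norm_mul] at h3
  simp only [Complex.norm_ofNat, norm_pow] at h3 ⊢
  linarith

/-- On this line cos(2πt) = a+ib with a ≥ 0, and then |1-(a+ib)|/2 ≤ |1+2(a+ib)|; the two sides are
|sin²(πt)| and |3-4sin²(πt)|. -/
theorem norm_sinFactor_le_of_re {t : ℂ} (ht : t.re = 1 / 6) : ‖sinFactor t‖ ≤ 1 := by
  apply norm_sinFactor_le_of_norm_sin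
  have e1 : (Real.pi : ℂ) * t = ((Real.pi / 6 : ℝ) : ℂ) + ((Real.pi * t.im : ℝ) : ℂ) * I := by
    conv_lhs => rw [← re_add_im t, ht]
    push_cast
    ring
  set y : ℝ := 2 * (Real.pi * t.im) with hy
  have e2 : cos (2 * (Real.pi * t)) = ((Real.cosh y / 2 : ℝ) : ℂ) +
      ((-(Real.sin (Real.pi / 3) * Real.sinh y) : ℝ) : ℂ) * I := by
    rw [e1, show (2 : ℂ) * (((Real.pi / 6 : ℝ) : ℂ) + ((Real.pi * t.im : ℝ) : ℂ) * I) =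
      ((Real.pi / 3 : ℝ) : ℂ) + (y : ℂ) * I by rw [hy]; push_cast; ring, cos_add_mul_I,
      ← ofReal_cos, ← ofReal_sin, ← ofReal_cosh, ← ofReal_sinh, Real.cos_pi_div_three]
    push_cast
    ring
  have e3 : sin (Real.pi * t) ^ 2 = (1 - cos (2 * (Real.pi * t))) / 2 := by
    rw [cos_two_mul, cos_sq']
    ring
  have e4 : 3 - 4 * sin (Real.pi * t) ^ 2 = 1 + 2 * cos (2 * (Real.pi * t)) := by
    rw [e3]
    ring
  rw [e4, e3, e2]
  set a : ℝ := Real.cosh y / 2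
  set b : ℝ := -(Real.sin (Real.pi / 3) * Real.sinh y)
  have ha : 0 ≤ a := by have := Real.one_le_cosh y; positivity
  refine le_of_sq_le_sq ?_ (norm_nonneg _)
  rw [show (1 - ((a : ℂ) + b * I)) / 2 = (((1 - a) / 2 : ℝ) : ℂ) + ((-b / 2 : ℝ) : ℂ) * I by
    push_cast; ring, show 1 + 2 * ((a : ℂ) + b * I) =
    ((1 + 2 * a : ℝ) : ℂ) + ((2 * b : ℝ) : ℂ) * I by push_cast; ring, norm_line_sq, norm_line_sq]
  nlinarith [sq_nonneg b]

theorem sin_three_mul_ne_zero_of_im {t : ℂ} (ht : t.im ≠ 0) : sin (Real.pi * (3 * t)) ≠ 0 := by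
  intro h
  obtain ⟨k, hk⟩ := (sin_pi_mul_eq_zero_iff _).1 h
  have := congrArg im hk
  simp at this
  exact ht this

theorem sin_three_mul_ne_zero_of_re {t : ℂ} (ht : t.re = 1 / 6) : sin (Real.pi * (3 * t)) ≠ 0 := by
  intro h
  obtain ⟨k, hk⟩ := (sin_pi_mul_eq_zero_iff _).1 h
  have := congrArg re hk
  rw [show (3 * t).re = 3 * t.re by simp, ht, intCast_re] at this
  have h2 : ((2 * k : ℤ) : ℝ) = ((1 : ℤ) : ℝ) := by
    push_cast
    linarith
  have := Int.cast_injective h2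
  omega

theorem exists_norm_gammaQuot_le : ∃ K : ℝ, 0 < K ∧ ∀ s : ℂ, -1 / 6 ≤ s.re → s.re ≤ 5 / 6 →
    (1 ≤ |s.im| ∨ s.re = -1 / 6) → ‖gammaQuot s‖ ≤ K := by
  obtain ⟨K, hK0, hK⟩ := exists_norm_gammaDual_le (c := 1 / 6) (by norm_num)
  have h1 : ∀ t : ℂ, 1 / 6 ≤ t.re → (1 ≤ |t.im| ∨ t.re = 1 / 6) → ‖gammaQuot (-t)‖ ≤ K := by
    intro t ht h
    have h0 : sin (Real.pi * (3 * t)) ≠ 0 := by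
      rcases h with h | h
      · refine sin_three_mul_ne_zero_of_im fun h' => ?_
        rw [h', abs_zero] at h
        linarith
      · exact sin_three_mul_ne_zero_of_re h
    rw [gammaQuot_neg (by linarith) h0, norm_mul, ← mul_one K]
    refine mul_le_mul (hK t ht) ?_ (norm_nonneg _) hK0.le
    rcases h with h | h
    · exact norm_sinFactor_le_of_im h
    · exact norm_sinFactor_le_of_re h
  -- For |Im s| ≥ 1 the argument is moved to s-1, where reflection applies; the recursion factor is
  -- at most 9·4²·5² = 3600.
  refine ⟨K * 3600, by positivity, fun s hs1 hs2 h => ?_⟩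
  rcases h with h | h
  · have hne : ∀ w : ℂ, w.im ≠ 0 → w ≠ 0 := fun w hw h => by simp [h] at hw
    have him : s.im ≠ 0 := fun h' => by
      rw [h', abs_zero] at h
      linarith
    have hs := h1 (1 - s) (by simp; linarith) (Or.inl (by simpa using h))
    rw [neg_sub] at hs
    have hrec := gammaQuot_add_one (s := s - 1) (hne _ (by simpa using him))
      (hne _ (by simpa using him)) (hne _ (by simpa using him))
    rw [sub_add_cancel] at hrec
    rw [hrec, norm_mul]
    refine mul_le_mul hs ?_ (norm_nonneg _) hK0.le
    have hs0 : 1 ≤ ‖s‖ := h.trans (abs_im_le_norm s)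
    have k1 : ‖3 * (s - 1) + 1‖ ≤ 5 * ‖s‖ := by
      rw [show 3 * (s - 1) + 1 = 3 * s - 2 by ring]
      refine (norm_sub_le _ _).trans ?_
      rw [norm_mul]
      simp only [Complex.norm_ofNat]
      linarith
    have k2 : ‖3 * (s - 1) + 2‖ ≤ 4 * ‖s‖ := by
      rw [show 3 * (s - 1) + 2 = 3 * s - 1 by ring]
      refine (norm_sub_le _ _).trans ?_
      rw [norm_mul]
      simp only [Complex.norm_ofNat, norm_one]
      linarith
    rw [norm_div, norm_mul, norm_mul, norm_pow, norm_pow, norm_pow, div_le_iff₀ (by positivity)]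
    have : ‖3 * (s - 1) + 2‖ ^ 2 * ‖3 * (s - 1) + 1‖ ^ 2 ≤ (4 * ‖s‖) ^ 2 * (5 * ‖s‖) ^ 2 := by gcongr
    simp only [Complex.norm_ofNat]
    linarith
  · have := h1 (-s) (by simp; linarith) (Or.inr (by simp; linarith))
    rw [neg_neg] at this
    linarith

theorem one_add_sq_mul_exp_neg_le {δ : ℝ} (hδ : 0 < δ) (τ : ℝ) :
    Real.exp (-(δ * |τ|)) ≤ (1 + 2 / δ ^ 2) / (1 + τ ^ 2) := by
  have h1 := Real.quadratic_le_exp_of_nonneg (show 0 ≤ δ * |τ| by positivity)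
  have h2 : (1 + τ ^ 2) ≤ (1 + 2 / δ ^ 2) * Real.exp (δ * |τ|) := by
    have h3 : (1 + 2 / δ ^ 2) * (1 + (δ * |τ|) ^ 2 / 2) ≤ (1 + 2 / δ ^ 2) * Real.exp (δ * |τ|) := by
      gcongr
      have : 0 ≤ δ * |τ| := by positivity
      linarith
    refine le_trans ?_ h3
    rw [mul_pow, sq_abs]
    have h4 : 2 / δ ^ 2 * (δ ^ 2 * τ ^ 2 / 2) = τ ^ 2 := by field_simp
    have h5 : 0 ≤ δ ^ 2 * τ ^ 2 / 2 := by positivity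
    have h6 : 0 ≤ 2 / δ ^ 2 := by positivity
    nlinarith
  rw [Real.exp_neg, inv_eq_one_div, div_le_div_iff₀ (Real.exp_pos _) (by positivity)]
  linarith

/-- The factor e^{-Im s·Im x} beats the growth of the kernel at both ends, with exponential rate δ,
the margin of Im x inside the window. -/
theorem norm_exp_mul_barnesKernel_le (l : ℤ) {x ε s : ℂ} {δ : ℝ} (hε : ‖ε‖ ≤ 1 / 12)
    (hs : 1 ≤ |s.im| ∨ s.re = -1 / 6) (hx1 : 2 * Real.pi * (l - 1) + δ ≤ x.im)
    (hx2 : x.im ≤ 2 * Real.pi * l - δ) :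
    ‖exp (s * x) * barnesKernel l (s - ε)‖ ≤
      2 * Real.exp (Real.pi * (|(l : ℝ)| + 1)) * Real.exp (s.re * x.re) *
        Real.exp (-(δ * |s.im|)) := by
  have hre := abs_le.1 ((abs_re_le_norm ε).trans hε)
  have him := abs_le.1 ((abs_im_le_norm ε).trans hε)
  have hpi := Real.pi_pos
  have hu : 1 / 2 ≤ |(s - ε).im| ∨ 1 / 2 ≤ |Real.sin (2 * Real.pi * (s - ε).re)| := by
    rcases hs with hs | hs
    · left
      rw [sub_im]
      have := abs_sub_abs_le_abs_sub s.im ε.im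
      have := (abs_im_le_norm ε).trans hε
      linarith
    · right
      -- The radius 1/12 keeps Re(s-ε) in [-1/4, -1/12], where sin(2πu) ≤ -1/2.
      have h1 : Real.sin (2 * Real.pi * (s - ε).re) ≤ Real.sin (-(Real.pi / 6)) := by
        rw [sub_re, hs]
        exact Real.sin_le_sin_of_le_of_le_pi_div_two (by nlinarith) (by linarith) (by nlinarith)
      rw [Real.sin_neg, Real.sin_pi_div_six] at h1
      rw [abs_of_nonpos (by linarith)]
      linarith
  obtain ⟨hk1, hk2⟩ := norm_barnesKernel_le l hu
  have hl := abs_nonneg (l : ℝ)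
  have hl1 := le_abs_self (l : ℝ)
  have hl2 := neg_abs_le (l : ℝ)
  have hexp : ‖exp (s * x)‖ = Real.exp (s.re * x.re - s.im * x.im) := by
    rw [norm_exp, mul_re]
  have hL : ∀ a b : ℝ, Real.exp a * (2 * Real.exp b) = 2 * Real.exp (a + b) := fun a b => by
    rw [Real.exp_add]
    ring
  have hR : ∀ a b c : ℝ, 2 * Real.exp a * Real.exp b * Real.exp c = 2 * Real.exp (a + b + c) :=
    fun a b c => by
      rw [Real.exp_add, Real.exp_add]
      ring
  rw [norm_mul, hexp]
  rcases le_total s.im 0 with h | h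
  · refine (mul_le_mul_of_nonneg_left hk1 (Real.exp_pos _).le).trans ?_
    rw [hL, hR]
    refine mul_le_mul_of_nonneg_left (Real.exp_le_exp.2 ?_) zero_le_two
    rw [abs_of_nonpos h, sub_im]
    have h1 : -(l * ε.im) ≤ |(l : ℝ)| * (1 / 12) := by
      refine (neg_le_abs _).trans ?_
      rw [abs_mul]
      exact mul_le_mul_of_nonneg_left (abs_le.2 him) hl
    nlinarith
  · refine (mul_le_mul_of_nonneg_left hk2 (Real.exp_pos _).le).trans ?_
    rw [hL, hR]
    refine mul_le_mul_of_nonneg_left (Real.exp_le_exp.2 ?_) zero_le_two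
    rw [abs_of_nonneg h, sub_im]
    have h1 : -(((l : ℝ) - 1) * ε.im) ≤ (|(l : ℝ)| + 1) * (1 / 12) := by
      refine (neg_le_abs _).trans ?_
      rw [abs_mul]
      refine mul_le_mul ((abs_sub _ _).trans (by simp)) (abs_le.2 him) (abs_nonneg _) (by linarith)
    nlinarith

end Bounds

/-! ### Moving the line of integration to the right and to the left. -/

section Barnes

open MeasureTheory Filter Topology Complex

/-- The integrand of the Barnes integral. -/
noncomputable def barnesIntegrand (l : ℤ) (x ε s : ℂ) : ℂ :=
  gammaQuot s * exp (s * x) * barnesKernel l (s - ε)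

/-- The integrand of the Barnes integral in the variable `t = -s`, after reflection. -/
noncomputable def dualIntegrand (l : ℤ) (x ε t : ℂ) : ℂ :=
  gammaDual t * exp (-(t * x)) * sinFactor t * barnesKernel l (-t - ε)

/-- The Barnes integral along `Re s = -1/6`. -/
noncomputable def barnesIntegral (l : ℤ) (x ε : ℂ) : ℂ :=
  ∫ t : ℝ, barnesIntegrand l x ε (((-1 / 6 : ℝ) : ℂ) + t * I)

theorem exp_mul_re_lt_one {x : ℂ} (hx : x.re < -6 * Real.log 3) :
    (3 : ℝ) ^ 6 * Real.exp x.re < 1 := by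
  have h : Real.exp x.re < Real.exp (-6 * Real.log 3) := Real.exp_lt_exp.2 hx
  have h2 : Real.exp (-6 * Real.log 3) = ((3 : ℝ) ^ 6)⁻¹ := by
    rw [neg_mul, Real.exp_neg, mul_comm, Real.exp_mul, Real.exp_log (by norm_num)]
    norm_num
  rw [h2] at h
  calc (3 : ℝ) ^ 6 * Real.exp x.re < (3 : ℝ) ^ 6 * ((3 : ℝ) ^ 6)⁻¹ := by gcongr
    _ = 1 := by norm_num

theorem exp_neg_mul_re_lt_one {x : ℂ} (hx : -6 * Real.log 3 < x.re) :
    ((3 : ℝ) ^ 6)⁻¹ * Real.exp (-x.re) < 1 := by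
  have h : Real.exp (-x.re) < Real.exp (6 * Real.log 3) := Real.exp_lt_exp.2 (by linarith)
  have h2 : Real.exp (6 * Real.log 3) = (3 : ℝ) ^ 6 := by
    rw [mul_comm, Real.exp_mul, Real.exp_log (by norm_num)]
    norm_num
  rw [h2] at h
  calc ((3 : ℝ) ^ 6)⁻¹ * Real.exp (-x.re) < ((3 : ℝ) ^ 6)⁻¹ * (3 : ℝ) ^ 6 := by gcongr
    _ = 1 := by norm_num

theorem norm_gammaQuot_mul_exp_le {s : ℂ} (hs : -1 / 3 < s.re) (x : ℂ) (m : ℕ) :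
    ‖gammaQuot (m + s) * exp ((m + s) * x)‖ ≤
      ((3 : ℝ) ^ 6 * Real.exp x.re) ^ m * ‖gammaQuot s * exp (s * x)‖ := by
  have h := norm_gammaQuot_add_nat_le hs m
  have h2 : ‖exp ((m + s) * x)‖ = Real.exp x.re ^ m * ‖exp (s * x)‖ := by
    rw [add_mul, exp_add, norm_mul, exp_nat_mul, norm_pow, norm_exp x]
  rw [norm_mul, norm_mul, h2, add_comm, mul_pow]
  calc ‖gammaQuot (s + m)‖ * (Real.exp x.re ^ m * ‖exp (s * x)‖)
      ≤ (((3 : ℝ) ^ 6) ^ m * ‖gammaQuot s‖) * (Real.exp x.re ^ m * ‖exp (s * x)‖) := by gcongr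
    _ = _ := by ring

theorem norm_barnesIntegrand_le (l : ℤ) (x ε : ℂ) {s : ℂ} (hs : -1 / 3 < s.re) (m : ℕ) :
    ‖barnesIntegrand l x ε (m + s)‖ ≤
      ((3 : ℝ) ^ 6 * Real.exp x.re) ^ m * ‖barnesIntegrand l x ε s‖ := by
  have hk : barnesKernel l (m + s - ε) = barnesKernel l (s - ε) := by
    rw [← barnesKernel_sub_int l m (m + s - ε)]
    congr 1
    push_cast
    ring
  rw [barnesIntegrand, barnesIntegrand, hk, norm_mul, norm_mul _ (barnesKernel l _), ← mul_assoc]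
  gcongr
  exact norm_gammaQuot_mul_exp_le hs x m

theorem norm_gammaDual_mul_exp_le {t : ℂ} (ht : 0 < t.re) (x : ℂ) (m : ℕ) :
    ‖gammaDual (m + t) * exp (-((m + t) * x))‖ ≤
      (((3 : ℝ) ^ 6)⁻¹ * Real.exp (-x.re)) ^ m * ‖gammaDual t * exp (-(t * x))‖ := by
  have h := norm_gammaDual_add_nat_le ht m
  have h2 : ‖exp (-((m + t) * x))‖ = Real.exp (-x.re) ^ m * ‖exp (-(t * x))‖ := by
    rw [show -((m + t) * x) = m * (-x) + -(t * x) by ring, exp_add, norm_mul, exp_nat_mul, norm_pow,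
      norm_exp (-x), neg_re]
  rw [norm_mul, norm_mul, h2, add_comm, mul_pow]
  calc ‖gammaDual (t + m)‖ * (Real.exp (-x.re) ^ m * ‖exp (-(t * x))‖)
      ≤ (((3 : ℝ) ^ 6)⁻¹ ^ m * ‖gammaDual t‖) * (Real.exp (-x.re) ^ m * ‖exp (-(t * x))‖) := by
        gcongr
    _ = _ := by ring

theorem norm_dualIntegrand_le (l : ℤ) (x ε : ℂ) {t : ℂ} (ht : 0 < t.re) (m : ℕ) :
    ‖dualIntegrand l x ε (m + t)‖ ≤
      (((3 : ℝ) ^ 6)⁻¹ * Real.exp (-x.re)) ^ m * ‖dualIntegrand l x ε t‖ := by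
  have hk : barnesKernel l (-(m + t) - ε) = barnesKernel l (-t - ε) := by
    rw [← barnesKernel_sub_int l m (-t - ε)]
    congr 1
    push_cast
    ring
  have hs : sinFactor (m + t) = sinFactor t := by rw [add_comm, sinFactor_add_nat]
  rw [dualIntegrand, dualIntegrand, hk, hs, norm_mul, norm_mul _ (barnesKernel l _),
    norm_mul, norm_mul _ (sinFactor t), ← mul_assoc, ← mul_assoc]
  gcongr
  exact norm_gammaDual_mul_exp_le ht x m

/-- The open strip in which the Barnes integral converges. -/
def windowStrip (l : ℤ) : Set ℂ :=
  {x | 2 * Real.pi * (l - 1) < x.im ∧ x.im < 2 * Real.pi * l}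

theorem exists_norm_barnesIntegrand_le (l : ℤ) {x : ℂ} (hx : x ∈ windowStrip l) :
    ∃ C : ℝ, 0 < C ∧ ∀ ε s : ℂ, ‖ε‖ ≤ 1 / 12 → -1 / 6 ≤ s.re → s.re ≤ 5 / 6 →
      (1 ≤ |s.im| ∨ s.re = -1 / 6) → ‖barnesIntegrand l x ε s‖ ≤ C / (1 + s.im ^ 2) := by
  obtain ⟨K, hK0, hK⟩ := exists_norm_gammaQuot_le
  obtain ⟨δ, hδ⟩ : ∃ δ : ℝ, δ = min (x.im - 2 * Real.pi * (l - 1)) (2 * Real.pi * l - x.im) :=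
    ⟨_, rfl⟩
  have hδ0 : 0 < δ := by
    rw [hδ, lt_min_iff]
    exact ⟨sub_pos.2 hx.1, sub_pos.2 hx.2⟩
  have hδ1 : 2 * Real.pi * (l - 1) + δ ≤ x.im := by
    linarith [hδ ▸ min_le_left (x.im - 2 * Real.pi * (l - 1)) (2 * Real.pi * l - x.im)]
  have hδ2 : x.im ≤ 2 * Real.pi * l - δ := by
    linarith [hδ ▸ min_le_right (x.im - 2 * Real.pi * (l - 1)) (2 * Real.pi * l - x.im)]
  refine ⟨K * (2 * Real.exp (Real.pi * (|(l : ℝ)| + 1)) * Real.exp |x.re| * (1 + 2 / δ ^ 2)),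
    by positivity, fun ε s hε hs1 hs2 hs => ?_⟩
  have h1 := hK s hs1 hs2 hs
  have h2 := norm_exp_mul_barnesKernel_le l hε hs hδ1 hδ2
  have h3 : Real.exp (s.re * x.re) ≤ Real.exp |x.re| := by
    refine Real.exp_le_exp.2 ((le_abs_self _).trans ?_)
    rw [abs_mul]
    have : |s.re| ≤ 1 := abs_le.2 ⟨by linarith, by linarith⟩
    nlinarith [abs_nonneg x.re]
  rw [barnesIntegrand, mul_assoc, norm_mul, mul_div_assoc, mul_div_assoc]
  refine mul_le_mul h1 (h2.trans ?_) (norm_nonneg _) hK0.le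
  gcongr
  exact one_add_sq_mul_exp_neg_le hδ0 s.im

theorem differentiableOn_gammaQuot : DifferentiableOn ℂ gammaQuot {s : ℂ | -1 / 3 < s.re} := by
  intro s hs
  have hs' : -1 / 3 < s.re := hs
  have h1 : DifferentiableAt ℂ (fun s : ℂ => Gamma (1 + 3 * s)) s :=
    ((analyticAt_Gamma (s := 1 + 3 * s) (by simp; linarith)).differentiableAt).comp s
      (by fun_prop)
  have h2 : DifferentiableAt ℂ (fun s : ℂ => Gamma (1 + s)) s :=
    ((analyticAt_Gamma (s := 1 + s) (by simp; linarith)).differentiableAt).comp s (by fun_prop)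
  exact ((h1.pow 2).div (h2.pow 6) (pow_ne_zero _ (Gamma_ne_zero_of_re_pos (by
    simp; linarith)))).differentiableWithinAt

theorem differentiableOn_gammaDual : DifferentiableOn ℂ gammaDual {t : ℂ | 0 < t.re} := by
  intro t ht
  have ht' : 0 < t.re := ht
  have h1 : DifferentiableAt ℂ (fun t : ℂ => Gamma (3 * t)) t :=
    ((analyticAt_Gamma (s := 3 * t) (by simpa using ht')).differentiableAt).comp t
      (by fun_prop)
  have h2 : DifferentiableAt ℂ Gamma t := (analyticAt_Gamma ht').differentiableAt
  exact ((h2.pow 6).div (h1.pow 2) (pow_ne_zero _ (Gamma_ne_zero_of_re_pos (by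
    simpa using ht')))).differentiableWithinAt

theorem summable_gammaQuot {x ε : ℂ} (hx : x.re < -6 * Real.log 3) (hε : ‖ε‖ ≤ 1 / 12) :
    Summable fun n : ℕ => gammaQuot (n + ε) * exp ((n + ε) * x) := by
  have hre := abs_le.1 ((abs_re_le_norm ε).trans hε)
  exact Summable.of_norm_bounded ((summable_geometric_of_lt_one (by positivity)
    (exp_mul_re_lt_one hx)).mul_right ‖gammaQuot ε * exp (ε * x)‖)
    fun n => norm_gammaQuot_mul_exp_le (by linarith) x n

/-- The only pole in this strip is that of the kernel at n+ε, since `gammaQuot` is holomorphic for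
Re s > -1/3. -/
theorem barnesIntegrand_strip (l : ℤ) {x ε : ℂ} (hx : x ∈ windowStrip l) (hε : ‖ε‖ ≤ 1 / 12)
    (n : ℕ) :
    Integrable (fun t : ℝ => barnesIntegrand l x ε ((n - 1 / 6 : ℝ) + t * I)) ∧
    Integrable (fun t : ℝ => barnesIntegrand l x ε ((n + 5 / 6 : ℝ) + t * I)) ∧
      (∫ t : ℝ, barnesIntegrand l x ε ((n + 5 / 6 : ℝ) + t * I)) -
        ∫ t : ℝ, barnesIntegrand l x ε ((n - 1 / 6 : ℝ) + t * I) =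
          -I * (gammaQuot (n + ε) * exp ((n + ε) * x)) := by
  have hre := abs_le.1 ((abs_re_le_norm ε).trans hε)
  have hn0 : (0 : ℝ) ≤ n := Nat.cast_nonneg n
  obtain ⟨C, hC0, hC⟩ := exists_norm_barnesIntegrand_le l hx
  have hV : IsOpen {s : ℂ | -1 / 3 < s.re} := isOpen_lt continuous_const continuous_re
  refine integral_line_sub_of_barnesKernel (F := barnesIntegrand l x ε)
    (f := fun s => gammaQuot s * exp (s * x)) (s₀ := n + ε) l
    (C := ((3 : ℝ) ^ 6 * Real.exp x.re) ^ n * C) (V := {s : ℂ | -1 / 3 < s.re})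
    ?_ ?_ ?_ ?_ hV ?_ ?_ ?_ ?_
  · simp; linarith
  · simp; linarith
  · simp; linarith
  · simp; linarith
  · intro s h1 h2
    simp only [Set.mem_ofPred_eq]
    linarith
  · exact differentiableOn_gammaQuot.mul (by fun_prop)
  · intro s _ _ _
    rw [barnesIntegrand, ← barnesKernel_sub_int l n (s - ε)]
    congr 2
    push_cast
    ring
  · intro s h1 h2 h3
    have h4 := norm_barnesIntegrand_le l x ε (s := s - n) (by simp; linarith) n
    have h5 := hC ε (s - n) hε (by simp; linarith) (by simp; linarith) (Or.inl (by simpa using h3))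
    rw [add_sub_cancel] at h4
    rw [sub_im, natCast_im, sub_zero] at h5
    refine h4.trans ?_
    rw [mul_div_assoc]
    gcongr

/-- The terms are differences of integrals over consecutive lines Re s = n-1/6, which decay
geometrically because 3⁶e^{Re x} < 1; the sum telescopes to the first line. -/
theorem hasSum_gammaQuot (l : ℤ) {x ε : ℂ} (hx : x ∈ windowStrip l) (hε : ‖ε‖ ≤ 1 / 12)
    (hxr : x.re < -6 * Real.log 3) :
    HasSum (fun n : ℕ => gammaQuot (n + ε) * exp ((n + ε) * x)) (-I * barnesIntegral l x ε) := by
  set A : ℕ → ℂ := fun n => ∫ t : ℝ, barnesIntegrand l x ε ((n - 1 / 6 : ℝ) + t * I) with hA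
  have hstep : ∀ n, A (n + 1) - A n = -I * (gammaQuot (n + ε) * exp ((n + ε) * x)) := by
    intro n
    rw [← (barnesIntegrand_strip l hx hε n).2.2, hA]
    simp only
    rw [show (((n + 1 : ℕ) : ℝ) - 1 / 6 : ℝ) = n + 5 / 6 by push_cast; ring]
  have hA0 : A 0 = barnesIntegral l x ε := by
    rw [hA, barnesIntegral]
    simp only
    norm_num
  have hint := (barnesIntegrand_strip l hx hε 0).1
  have hbound : ∀ n, ‖A n‖ ≤ ((3 : ℝ) ^ 6 * Real.exp x.re) ^ n *
      ∫ t : ℝ, ‖barnesIntegrand l x ε (((0 : ℕ) - 1 / 6 : ℝ) + t * I)‖ := by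
    intro n
    rw [← integral_const_mul]
    refine norm_integral_le_of_norm_le (hint.norm.const_mul _) (Eventually.of_forall fun t => ?_)
    have := norm_barnesIntegrand_le l x ε (s := (((0 : ℕ) - 1 / 6 : ℝ) : ℂ) + t * I)
      (by simp; norm_num) n
    refine le_trans (le_of_eq ?_) this
    congr 2
    push_cast
    ring
  have hlim : Tendsto A atTop (𝓝 0) := by
    refine squeeze_zero_norm hbound ?_
    simpa using (tendsto_pow_atTop_nhds_zero_of_lt_one (by positivity)
      (exp_mul_re_lt_one hxr)).mul_const _
  rw [(summable_gammaQuot hxr hε).hasSum_iff_tendsto_nat]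
  have hsum : ∀ N, ∑ n ∈ Finset.range N, gammaQuot (n + ε) * exp ((n + ε) * x) =
      I * (A N - A 0) := by
    intro N
    rw [← Finset.sum_range_sub, Finset.mul_sum]
    refine Finset.sum_congr rfl fun n _ => ?_
    rw [hstep, ← mul_assoc, mul_neg, I_mul_I]
    ring
  simp only [hsum]
  have := (hlim.sub_const (A 0)).const_mul I
  rw [hA0] at this ⊢
  convert this using 2
  ring

theorem dualIntegrand_eq (l : ℤ) (x ε : ℂ) {t : ℂ} (ht : 0 < t.re)
    (h : sin (Real.pi * (3 * t)) ≠ 0) : dualIntegrand l x ε t = barnesIntegrand l x ε (-t) := by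
  rw [dualIntegrand, barnesIntegrand, gammaQuot_neg ht h, neg_mul]
  ring

theorem exists_norm_dualIntegrand_le (l : ℤ) {x : ℂ} (hx : x ∈ windowStrip l) :
    ∃ C : ℝ, 0 < C ∧ ∀ ε t : ℂ, ‖ε‖ ≤ 1 / 12 → 1 / 6 ≤ t.re → t.re ≤ 7 / 6 →
      (1 ≤ |t.im| ∨ t.re = 1 / 6) → ‖dualIntegrand l x ε t‖ ≤ C / (1 + t.im ^ 2) := by
  obtain ⟨K, hK0, hK⟩ := exists_norm_gammaDual_le (c := 1 / 6) (by norm_num)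
  obtain ⟨δ, hδ⟩ : ∃ δ : ℝ, δ = min (x.im - 2 * Real.pi * (l - 1)) (2 * Real.pi * l - x.im) :=
    ⟨_, rfl⟩
  have hδ0 : 0 < δ := by
    rw [hδ, lt_min_iff]
    exact ⟨sub_pos.2 hx.1, sub_pos.2 hx.2⟩
  have hδ1 : 2 * Real.pi * (l - 1) + δ ≤ x.im := by
    linarith [hδ ▸ min_le_left (x.im - 2 * Real.pi * (l - 1)) (2 * Real.pi * l - x.im)]
  have hδ2 : x.im ≤ 2 * Real.pi * l - δ := by
    linarith [hδ ▸ min_le_right (x.im - 2 * Real.pi * (l - 1)) (2 * Real.pi * l - x.im)]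
  refine ⟨K * (2 * Real.exp (Real.pi * (|(l : ℝ)| + 1)) * Real.exp (2 * |x.re|) * (1 + 2 / δ ^ 2)),
    by positivity, fun ε t hε ht1 ht2 ht => ?_⟩
  have h1 := hK t ht1
  have h2 := norm_exp_mul_barnesKernel_le (s := -t) l hε
    (ht.imp (fun h => by simpa using h) fun h => by simp; linarith) hδ1 hδ2
  have h3 : Real.exp ((-t).re * x.re) ≤ Real.exp (2 * |x.re|) := by
    refine Real.exp_le_exp.2 ((le_abs_self _).trans ?_)
    rw [abs_mul, neg_re, abs_neg]
    have : |t.re| ≤ 2 := abs_le.2 ⟨by linarith, by linarith⟩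
    nlinarith [abs_nonneg x.re]
  have h4 : ‖sinFactor t‖ ≤ 1 :=
    ht.elim norm_sinFactor_le_of_im norm_sinFactor_le_of_re
  rw [neg_im, abs_neg] at h2
  rw [dualIntegrand, show gammaDual t * exp (-(t * x)) * sinFactor t * barnesKernel l (-t - ε) =
    gammaDual t * (sinFactor t * (exp (-t * x) * barnesKernel l (-t - ε))) by rw [neg_mul]; ring,
    norm_mul, norm_mul, mul_div_assoc, mul_div_assoc]
  refine mul_le_mul h1 ((mul_le_of_le_one_left (norm_nonneg _) h4).trans (h2.trans ?_))
    (by positivity) hK0.le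
  gcongr
  exact one_add_sq_mul_exp_neg_le hδ0 t.im

theorem norm_dualIntegrand_strip_le (l : ℤ) {x ε : ℂ} {C : ℝ}
    (hC : ∀ t : ℂ, 1 / 6 ≤ t.re → t.re ≤ 7 / 6 →
      1 ≤ |t.im| → ‖dualIntegrand l x ε t‖ ≤ C / (1 + t.im ^ 2)) (n : ℕ) (t : ℂ)
    (h1 : n + 1 / 6 ≤ t.re) (h2 : t.re ≤ n + 7 / 6) (h3 : 1 ≤ |t.im|) :
    ‖dualIntegrand l x ε t‖ ≤
      ((((3 : ℝ) ^ 6)⁻¹ * Real.exp (-x.re)) ^ n * C) / (1 + t.im ^ 2) := by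
  have h4 := norm_dualIntegrand_le l x ε (t := t - n) (by simp; linarith) n
  have h5 := hC (t - n) (by simp; linarith) (by simp; linarith) (by simpa using h3)
  rw [add_sub_cancel] at h4
  rw [sub_im, natCast_im, sub_zero] at h5
  refine h4.trans ?_
  rw [mul_div_assoc]
  gcongr

theorem ne_int_of_re {u : ℂ} {n : ℤ} (h1 : n < u.re) (h2 : u.re < n + 1) : ∀ k : ℤ, u ≠ k := by
  intro k hk
  rw [hk, intCast_re] at h1 h2
  have h3 : n < k := by exact_mod_cast h1
  have h4 : k < n + 1 := by exact_mod_cast h2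
  omega

theorem differentiableOn_residueFun (x : ℂ) :
    DifferentiableOn ℂ (residueFun x) {t : ℂ | 0 < t.re} := by
  unfold residueFun
  exact (DifferentiableOn.mul (by fun_prop) differentiableOn_gammaDual).mul (by fun_prop)

/-- The double zero of sin(3πt) at n+(r+1)/3 is the only pole here; the kernel is regular there. -/
theorem dualIntegrand_strip_third (l : ℤ) {x ε : ℂ} (hx : x ∈ windowStrip l) (hε : ‖ε‖ ≤ 1 / 12)
    (n r : ℕ) (hr : r ≤ 1) :
    (∫ t : ℝ, dualIntegrand l x ε ((n + 1 / 6 + (r + 1) / 3 : ℝ) + t * I)) -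
      ∫ t : ℝ, dualIntegrand l x ε ((n + 1 / 6 + r / 3 : ℝ) + t * I) =
        2 * Real.pi / 9 * deriv (fun t => residueFun x t * barnesKernel l (-t - ε))
          (n + (r + 1) / 3) := by
  have hre := abs_le.1 ((abs_re_le_norm ε).trans hε)
  have hn0 : (0 : ℝ) ≤ n := Nat.cast_nonneg n
  have hr0 : (0 : ℝ) ≤ r := Nat.cast_nonneg r
  have hr1 : (r : ℝ) ≤ 1 := by exact_mod_cast hr
  have hpi : (Real.pi : ℂ) ≠ 0 := ofReal_ne_zero.2 Real.pi_ne_zero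
  obtain ⟨C, hC0, hC⟩ := exists_norm_dualIntegrand_le l hx
  -- The margin 1/9 exceeds 1/12, so no pole of the kernel enters V.
  set V : Set ℂ := {t : ℂ | n + 1 / 9 < t.re} ∩ {t : ℂ | t.re < n + 8 / 9} with hV
  have hVo : IsOpen V :=
    (isOpen_lt continuous_const continuous_re).inter (isOpen_lt continuous_re continuous_const)
  have hkd : DifferentiableOn ℂ (fun t => residueFun x t * barnesKernel l (-t - ε)) V := by
    refine ((differentiableOn_residueFun x).mono fun t ht => ?_).mul fun t ht => ?_
    · have : n + 1 / 9 < t.re := ht.1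
      simp only [Set.mem_ofPred_eq]
      linarith
    · have h1 : n + 1 / 9 < t.re := ht.1
      have h2 : t.re < n + 8 / 9 := ht.2
      have h3 : ∀ k : ℤ, -t - ε ≠ k := ne_int_of_re (n := -n - 1) (by
        push_cast; simp; linarith) (by push_cast; simp; linarith)
      exact (DifferentiableAt.comp t (f := fun t : ℂ => -t - ε) (differentiableAt_barnesKernel l h3)
        (by fun_prop)).differentiableWithinAt
  -- The constant is 2π·π²/(3π)² = 2π/9; the π² is what remains of π⁶/π⁴.
  have hmain := (integral_line_sub_of_sin_sq (F := dualIntegrand l x ε) (α := 3)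
    (a := n + 1 / 6 + r / 3) (b := n + 1 / 6 + (r + 1) / 3) (s₀ := n + (r + 1) / 3)
    (ψ := fun t => Real.pi ^ 2 * (residueFun x t * barnesKernel l (-t - ε)))
    (C := (((3 : ℝ) ^ 6)⁻¹ * Real.exp (-x.re)) ^ n * C) (V := V) (by norm_num)
    (by simp; linarith) (by simp) (by simp; linarith) (by simp; linarith) hVo
    (fun t h1 h2 => ⟨by simp only [Set.mem_ofPred_eq]; linarith, by
      simp only [Set.mem_ofPred_eq]; linarith⟩) (hkd.const_mul _) ?_ ?_).2.2
  · rw [hmain, deriv_const_mul_field]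
    push_cast
    field_simp
    norm_num
    ring
  · intro t h1 h2 _
    have h3 : sin (Real.pi * t) ≠ 0 := by
      rw [Ne, sin_pi_mul_eq_zero_iff]
      rintro ⟨k, hk⟩
      exact ne_int_of_re (n := n) (u := t) (by push_cast; linarith) (by push_cast; linarith) k hk
    have h4 : sin (Real.pi * (3 * t)) ^ 2 =
        sin (Real.pi * (((3 : ℝ) : ℂ) * (t - (n + (r + 1) / 3)))) ^ 2 := by
      rw [← sin_pi_mul_add_nat_pow_even (((3 : ℝ) : ℂ) * (t - (n + (r + 1) / 3))) (3 * n + r + 1)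
        (k := 2) (by decide)]
      congr 3
      push_cast
      ring
    rw [dualIntegrand, sinFactor_eq h3, h4, residueFun, mul_comm t x]
    field_simp
  · intro t h1 h2 h3
    exact norm_dualIntegrand_strip_le l (fun t g1 g2 g3 => hC ε t hε g1 g2 (Or.inl g3)) n t
      (by linarith) (by linarith) h3

/-- Near integers `sinFactor` is regular, so only the kernel has a pole, at t = n+1-ε. Reversing the
sign of its argument replaces l by 1-l. -/
theorem dualIntegrand_strip_int (l : ℤ) {x ε : ℂ} (hx : x ∈ windowStrip l) (hε : ‖ε‖ ≤ 1 / 12)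
    (n : ℕ) :
    (∫ t : ℝ, dualIntegrand l x ε ((n + 7 / 6 : ℝ) + t * I)) -
      ∫ t : ℝ, dualIntegrand l x ε ((n + 5 / 6 : ℝ) + t * I) =
        I * (gammaDual (n + 1 - ε) * exp (-((n + 1 - ε) * x)) * sinFactor (n + 1 - ε)) := by
  have hre := abs_le.1 ((abs_re_le_norm ε).trans hε)
  have hn0 : (0 : ℝ) ≤ n := Nat.cast_nonneg n
  have hpi : (Real.pi : ℂ) ≠ 0 := ofReal_ne_zero.2 Real.pi_ne_zero
  obtain ⟨C, hC0, hC⟩ := exists_norm_dualIntegrand_le l hx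
  set V : Set ℂ := {t : ℂ | 0 < t.re} ∩ {t : ℂ | 3 - 4 * sin (Real.pi * t) ^ 2 ≠ 0} with hV
  have hVo : IsOpen V :=
    (isOpen_lt continuous_const continuous_re).inter (isOpen_ne_fun (by fun_prop) continuous_const)
  have hd : DifferentiableOn ℂ (fun t => -(gammaDual t * exp (-(t * x)) * sinFactor t)) V := by
    refine (((differentiableOn_gammaDual.mono Set.inter_subset_left).mul (by fun_prop)).mul
      ?_).neg
    unfold sinFactor
    refine DifferentiableOn.div (by fun_prop) (by fun_prop) fun t ht => ?_
    exact mul_ne_zero (pow_ne_zero _ hpi) (pow_ne_zero _ ht.2)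
  have hmain := (integral_line_sub_of_barnesKernel (F := dualIntegrand l x ε)
    (a := n + 5 / 6) (b := n + 7 / 6) (s₀ := n + 1 - ε) (1 - l)
    (f := fun t => -(gammaDual t * exp (-(t * x)) * sinFactor t))
    (C := (((3 : ℝ) ^ 6)⁻¹ * Real.exp (-x.re)) ^ n * C) (V := V)
    (by simp; linarith) (by simp; linarith) (by simp; linarith) (by simp; linarith) hVo
    ?_ hd ?_ ?_).2.2
  · rw [hmain]
    ring
  · intro t h1 h2
    refine ⟨by simp only [Set.mem_ofPred_eq]; linarith, three_sub_four_sin_sq_ne_zero fun j hj => ?_⟩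
    have h3 : 3 * t.re = j := by simpa using congrArg re hj
    have h4 : ((3 * n + 2 : ℤ) : ℝ) < j := by push_cast; linarith
    have h5 : (j : ℝ) < ((3 * n + 4 : ℤ) : ℝ) := by push_cast; linarith
    have h6 : (3 * n + 2 : ℤ) < j := by exact_mod_cast h4
    have h7 : j < (3 * n + 4 : ℤ) := by exact_mod_cast h5
    exact ⟨n + 1, by omega⟩
  · intro t _ _ _
    rw [dualIntegrand, show -t - ε = -(t - (n + 1 - ε)) - ((n + 1 : ℤ) : ℂ) by push_cast; ring,
      barnesKernel_sub_int, barnesKernel_neg]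
    ring
  · intro t h1 h2 h3
    exact norm_dualIntegrand_strip_le l (fun t g1 g2 g3 => hC ε t hε g1 g2 (Or.inl g3)) n t
      (by linarith) (by linarith) h3

/-- The sum of the residues of the Barnes integrand with `-(n + 1) - 1/6 < Re s < -n - 1/6`. -/
noncomputable def residueSum (l : ℤ) (x ε : ℂ) (n : ℕ) : ℂ :=
  2 * Real.pi / 9 * deriv (fun t => residueFun x t * barnesKernel l (-t - ε)) (n + (0 + 1) / 3) +
  2 * Real.pi / 9 * deriv (fun t => residueFun x t * barnesKernel l (-t - ε)) (n + (1 + 1) / 3) +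
  I * (gammaDual (n + 1 - ε) * exp (-((n + 1 - ε) * x)) * sinFactor (n + 1 - ε))

/-- Each unit strip is cut at n+1/2 and n+5/6 to isolate its three poles. The integrals over Re t =
n+1/6 decay geometrically, uniformly in ε; uniformity is needed to integrate over the ε-circle. -/
theorem hasSum_residueSum (l : ℤ) {x : ℂ} (hx : x ∈ windowStrip l) (hxr : -6 * Real.log 3 < x.re) :
    (∀ ε : ℂ, ‖ε‖ ≤ 1 / 12 → HasSum (residueSum l x ε) (-barnesIntegral l x ε)) ∧
    ∃ u : ℕ → ℝ, Summable u ∧ ∀ ε : ℂ, ‖ε‖ ≤ 1 / 12 → ∀ n, ‖residueSum l x ε n‖ ≤ u n := by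
  obtain ⟨C, hC0, hC⟩ := exists_norm_dualIntegrand_le l hx
  obtain ⟨ρ, hρ⟩ : ∃ ρ : ℝ, ρ = ((3 : ℝ) ^ 6)⁻¹ * Real.exp (-x.re) := ⟨_, rfl⟩
  have hρ0 : 0 ≤ ρ := by rw [hρ]; positivity
  have hρ1 : ρ < 1 := by rw [hρ]; exact exp_neg_mul_re_lt_one hxr
  set G : ℂ → ℕ → ℂ := fun ε n => ∫ t : ℝ, dualIntegrand l x ε ((n + 1 / 6 : ℝ) + t * I) with hG
  have hstep : ∀ ε, ‖ε‖ ≤ 1 / 12 → ∀ n, G ε (n + 1) - G ε n = residueSum l x ε n := by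
    intro ε hε n
    have h0 := dualIntegrand_strip_third l hx hε n 0 (by norm_num)
    have h1 := dualIntegrand_strip_third l hx hε n 1 le_rfl
    have h2 := dualIntegrand_strip_int l hx hε n
    rw [show (n + 1 / 6 + (((1 : ℕ) : ℝ) + 1) / 3 : ℝ) = n + 5 / 6 by push_cast; ring,
      show (n + 1 / 6 + ((1 : ℕ) : ℝ) / 3 : ℝ) = n + 1 / 2 by push_cast; ring] at h1
    rw [show (n + 1 / 6 + (((0 : ℕ) : ℝ) + 1) / 3 : ℝ) = n + 1 / 2 by push_cast; ring,
      show (n + 1 / 6 + ((0 : ℕ) : ℝ) / 3 : ℝ) = n + 1 / 6 by push_cast; ring] at h0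
    rw [Nat.cast_zero] at h0
    rw [Nat.cast_one] at h1
    rw [residueSum, ← h0, ← h1, ← h2, hG]
    simp only
    rw [show (((n + 1 : ℕ) : ℝ) + 1 / 6 : ℝ) = n + 7 / 6 by push_cast; ring]
    ring
  have hbound : ∀ ε, ‖ε‖ ≤ 1 / 12 → ∀ n, ‖G ε n‖ ≤ ρ ^ n * (C * Real.pi) := by
    intro ε hε n
    have hi := integrable_inv_one_add_sq.const_mul (ρ ^ n * C)
    have h1 : ‖G ε n‖ ≤ ∫ t : ℝ, ρ ^ n * C * (1 + t ^ 2)⁻¹ := by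
      refine norm_integral_le_of_norm_le hi (Eventually.of_forall fun t => ?_)
      have h2 := norm_dualIntegrand_le l x ε (t := ((1 / 6 : ℝ) : ℂ) + t * I) (by simp) n
      have h3 := hC ε (((1 / 6 : ℝ) : ℂ) + t * I) hε (by simp) (by simp; norm_num)
        (Or.inr (by simp))
      rw [← hρ] at h2
      have h4 : (((1 / 6 : ℝ) : ℂ) + t * I).im = t := by simp
      rw [h4] at h3
      have h5 : ((n + 1 / 6 : ℝ) : ℂ) + t * I = n + (((1 / 6 : ℝ) : ℂ) + t * I) := by
        push_cast
        ring
      rw [h5, mul_assoc, ← div_eq_mul_inv]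
      exact h2.trans (by gcongr)
    rwa [integral_const_mul, integral_univ_inv_one_add_sq, mul_assoc] at h1
  have hres : ∀ ε, ‖ε‖ ≤ 1 / 12 → ∀ n, ‖residueSum l x ε n‖ ≤ ρ ^ n * (2 * (C * Real.pi)) := by
    intro ε hε n
    rw [← hstep ε hε n]
    have hp : 0 ≤ C * Real.pi := by have := Real.pi_pos; positivity
    have h1 : ρ ^ (n + 1) ≤ ρ ^ n := pow_le_pow_of_le_one hρ0 hρ1.le (Nat.le_succ n)
    have h2 := hbound ε hε (n + 1)
    have h3 := hbound ε hε n
    have h4 := mul_le_mul_of_nonneg_right h1 hp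
    linarith [norm_sub_le (G ε (n + 1)) (G ε n)]
  have hsu := (summable_geometric_of_lt_one hρ0 hρ1).mul_right (2 * (C * Real.pi))
  refine ⟨fun ε hε => ?_, _, hsu, hres⟩
  rw [(Summable.of_norm_bounded hsu (hres ε hε)).hasSum_iff_tendsto_nat]
  have hsum : ∀ N, ∑ n ∈ Finset.range N, residueSum l x ε n = G ε N - G ε 0 := by
    intro N
    rw [← Finset.sum_range_sub]
    exact Finset.sum_congr rfl fun n _ => (hstep ε hε n).symm
  have hlim : Tendsto (G ε) atTop (𝓝 0) := by
    refine squeeze_zero_norm (hbound ε hε) ?_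
    simpa using (tendsto_pow_atTop_nhds_zero_of_lt_one hρ0 hρ1).mul_const (C * Real.pi)
  -- The line Re t = 1/6 is Re s = -1/6 traversed backwards.
  have hG0 : G ε 0 = barnesIntegral l x ε := by
    rw [barnesIntegral, ← integral_neg_eq_self, hG]
    refine integral_congr_ae (Eventually.of_forall fun t => ?_)
    simp only
    rw [dualIntegrand_eq l x ε (by simp) (sin_three_mul_ne_zero_of_re (by simp))]
    congr 1
    push_cast
    ring
  simp only [hsum]
  have := hlim.sub_const (G ε 0)
  rw [hG0, zero_sub] at this
  simpa only [hG0] using this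

end Barnes

/-! ### Taking jets in ε by Cauchy integrals; holomorphy in x. -/

section Jets

open MeasureTheory Filter Topology Complex TruncAlg Metric

/-- For integrands holomorphic in the parameter, a bound on the integrand suffices: Cauchy's
estimate on circles of radius R/3 bounds the derivative. -/
theorem differentiableAt_integral_of_norm_le {α : Type*} [MeasurableSpace α] {μ : Measure α}
    {F : ℂ → α → ℂ} {x₀ : ℂ} {R : ℝ} (hR : 0 < R)
    (hmeas : ∀ x ∈ ball x₀ R, AEStronglyMeasurable (F x) μ)
    (hdiff : ∀ a, DifferentiableOn ℂ (fun x => F x a) (ball x₀ R)) {bound : α → ℝ}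
    (hb : ∀ x ∈ ball x₀ R, ∀ a, ‖F x a‖ ≤ bound a) (hi : Integrable bound μ) :
    DifferentiableAt ℂ (fun x => ∫ a, F x a ∂μ) x₀ := by
  have hx0 : x₀ ∈ ball x₀ R := mem_ball_self hR
  have hda : ∀ a, ∀ x ∈ ball x₀ R, HasDerivAt (fun x => F x a) (deriv (fun x => F x a) x) x :=
    fun a x hx => ((hdiff a).differentiableAt (isOpen_ball.mem_nhds hx)).hasDerivAt
  have hsub : ∀ x ∈ ball x₀ (R / 2), closedBall x (R / 3) ⊆ ball x₀ R := fun x hx =>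
    closedBall_subset_ball' (by have := mem_ball.1 hx; linarith)
  set h : ℕ → ℂ := fun n => ((R / 2 * (1 / ((n : ℝ) + 1)) : ℝ) : ℂ) with hh
  have hh0 : ∀ n, h n ≠ 0 := fun n => by
    rw [hh]
    exact ofReal_ne_zero.2 (by positivity)
  have hhb : ∀ n, x₀ + h n ∈ ball x₀ R := fun n => by
    rw [mem_ball, dist_eq, add_sub_cancel_left, hh, norm_real, Real.norm_eq_abs,
      abs_of_pos (by positivity)]
    have : 1 / ((n : ℝ) + 1) ≤ 1 := by
      rw [div_le_one (by positivity)]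
      linarith [(Nat.cast_nonneg n : (0 : ℝ) ≤ n)]
    nlinarith
  have hhl : Tendsto h atTop (𝓝[≠] 0) := by
    refine tendsto_nhdsWithin_iff.2 ⟨?_, Eventually.of_forall hh0⟩
    have := (tendsto_one_div_add_atTop_nhds_zero_nat (𝕜 := ℝ)).const_mul (R / 2)
    rw [mul_zero] at this
    exact (continuous_ofReal.tendsto' 0 0 ofReal_zero).comp this
  refine (hasDerivAt_integral_of_dominated_loc_of_deriv_le (s := ball x₀ (R / 2))
    (F := F) (F' := fun x a => deriv (fun x => F x a) x) (bound := fun a => bound a / (R / 3))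
    (ball_mem_nhds x₀ (by linarith)) ?_ ?_ ?_ ?_ (hi.div_const _) ?_).2.differentiableAt
  · filter_upwards [isOpen_ball.mem_nhds hx0] with x hx using hmeas x hx
  · exact hi.mono' (hmeas x₀ hx0) (Eventually.of_forall fun a => hb x₀ hx0 a)
  -- The derivative is measurable as a limit of difference quotients along the sequence h.
  · refine aestronglyMeasurable_of_tendsto_ae (u := atTop)
      (f := fun (n : ℕ) a => (h n)⁻¹ • (F (x₀ + h n) a - F x₀ a))
      (fun n => ((hmeas _ (hhb n)).sub (hmeas x₀ hx0)).const_smul (h n)⁻¹) ?_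
    refine Eventually.of_forall fun a => ?_
    exact ((hasDerivAt_iff_tendsto_slope_zero.1 (hda a x₀ hx0)).comp hhl)
  · refine Eventually.of_forall fun a x hx => ?_
    refine norm_deriv_le_of_forall_mem_sphere_norm_le (by linarith) ?_ fun y hy =>
      hb y (hsub x hx (sphere_subset_closedBall hy)) a
    exact ((hdiff a).mono ((closure_ball_subset_closedBall).trans (hsub x hx))).diffContOnCl
  · exact Eventually.of_forall fun a x hx => hda a x (ball_subset_ball (by linarith) hx)

/-- The Taylor polynomial in `ℂ[x]/(xⁿ)` of a function at `0`, from its values on a circle. -/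
noncomputable def circleTaylor (n : ℕ) (r : ℝ) (c : ℂ) (φ : ℂ → ℂ) : TruncAlg n :=
  ∑ k ∈ Finset.range n, ((2 * Real.pi * I)⁻¹ • ∮ s in C(0, r), (1 / s ^ (k + 1)) • φ s) •
    (c • gen n) ^ k

theorem circleTaylor_eq_taylor (n : ℕ) {r : ℝ} (hr : 0 < r) (c : ℂ) {φ : ℂ → ℂ}
    (hφ : DifferentiableOn ℂ φ (closedBall 0 r)) : circleTaylor n r c φ = taylor n φ 0 c := by
  refine Finset.sum_congr rfl fun k _ => ?_
  have h := hφ.circleIntegral_one_div_sub_center_pow_smul hr k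
  simp only [sub_zero] at h
  rw [h, smul_smul, smul_eq_mul]
  have := two_pi_I_ne_zero
  congr 1
  field_simp

theorem circleTaylor_const_mul (n : ℕ) (r : ℝ) (c w : ℂ) (φ : ℂ → ℂ) :
    circleTaylor n r c (fun s => w * φ s) = w • circleTaylor n r c φ := by
  rw [circleTaylor, circleTaylor, Finset.smul_sum]
  refine Finset.sum_congr rfl fun k _ => ?_
  have : (fun s => (1 / s ^ (k + 1)) • (w * φ s)) = fun s => w • ((1 / s ^ (k + 1)) • φ s) :=
    funext fun s => by simp only [smul_eq_mul]; ring
  rw [this, circleIntegral.integral_smul, smul_smul, smul_smul]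
  congr 1
  simp only [smul_eq_mul]
  ring

theorem exists_norm_circleTaylor_le (n : ℕ) {r : ℝ} (hr : 0 < r) (c : ℂ) :
    ∃ K : ℝ, 0 ≤ K ∧ ∀ (φ : ℂ → ℂ) (M : ℝ), (∀ s ∈ sphere (0 : ℂ) r, ‖φ s‖ ≤ M) →
      ‖circleTaylor n r c φ‖ ≤ K * M := by
  refine ⟨∑ k ∈ Finset.range n, r * (1 / r ^ (k + 1)) * ‖(c • gen n) ^ k‖, by positivity,
    fun φ M h => ?_⟩
  rw [Finset.sum_mul]
  refine (norm_sum_le _ _).trans (Finset.sum_le_sum fun k _ => ?_)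
  rw [norm_smul]
  have h1 := circleIntegral.norm_two_pi_i_inv_smul_integral_le_of_norm_le_const (c := 0) hr.le
    (f := fun s => (1 / s ^ (k + 1)) • φ s) (C := 1 / r ^ (k + 1) * M) fun s hs => by
      have hs' : ‖s‖ = r := by simpa using hs
      rw [norm_smul, norm_div, norm_one, norm_pow, hs']
      exact mul_le_mul_of_nonneg_left (h s hs) (by positivity)
  calc _ ≤ r * (1 / r ^ (k + 1) * M) * ‖(c • gen n) ^ k‖ := by gcongr
    _ = _ := by ring

/-- Dominated convergence on the circle. No holomorphy of the sum g is required, so the Barnes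
integral need not be differentiated in ε. -/
theorem hasSum_circleTaylor (n : ℕ) {r : ℝ} (hr : 0 < r) (c : ℂ) {φ : ℕ → ℂ → ℂ} {g : ℂ → ℂ}
    {u : ℕ → ℝ} (hφ : ∀ m, ContinuousOn (φ m) (sphere 0 r))
    (hu : ∀ m, ∀ s ∈ sphere (0 : ℂ) r, ‖φ m s‖ ≤ u m) (hs : Summable u)
    (hg : ∀ s ∈ sphere (0 : ℂ) r, HasSum (fun m => φ m s) (g s)) :
    HasSum (fun m => circleTaylor n r c (φ m)) (circleTaylor n r c g) := by
  refine hasSum_sum fun k _ => ?_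
  have key : HasSum (fun m => ∮ s in C(0, r), (1 / s ^ (k + 1)) • φ m s)
      (∮ s in C(0, r), (1 / s ^ (k + 1)) • g s) := by
    have hn : ∀ θ : ℝ, ‖deriv (circleMap 0 r) θ‖ = r := fun θ => by simp [abs_of_pos hr]
    have hmem : ∀ θ : ℝ, circleMap 0 r θ ∈ sphere (0 : ℂ) r := circleMap_mem_sphere 0 hr.le
    refine intervalIntegral.hasSum_integral_of_dominated_convergence
      (fun m _ => r * (1 / r ^ (k + 1) * u m)) (fun m => ?_) (fun m => ?_) ?_ ?_ ?_
    · refine Continuous.aestronglyMeasurable ?_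
      have h1 : ∀ θ, circleMap 0 r θ ^ (k + 1) ≠ 0 := fun θ =>
        pow_ne_zero _ (circleMap_ne_center hr.ne')
      simp only [deriv_circleMap]
      have h2 : Continuous fun θ => φ m (circleMap 0 r θ) :=
        (hφ m).comp_continuous (continuous_circleMap 0 r) hmem
      have h3 := continuous_circleMap 0 r
      exact (h3.mul continuous_const).smul ((continuous_const.div (h3.pow _) h1).smul h2)
    · refine Eventually.of_forall fun θ _ => ?_
      have hθ : ‖circleMap 0 r θ‖ = r := by simpa using hmem θ
      rw [norm_smul, norm_smul, hn, norm_div, norm_one, norm_pow, hθ]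
      have := hu m _ (hmem θ)
      gcongr
    · exact Eventually.of_forall fun θ _ => (hs.mul_left _).mul_left _
    · exact intervalIntegrable_const
    · exact Eventually.of_forall fun θ _ => ((hg _ (hmem θ)).const_smul _).const_smul _
  exact (key.const_smul _).smul_const _

/-- Makes visible that each jet is an exponential times a polynomial in X, hence entire in X. -/
theorem taylor_mul_exp (n : ℕ) {g : ℂ → ℂ} (hg : AnalyticAt ℂ g 0) (a b c X : ℂ) :
    taylor n (fun s => g s * exp ((a + b * s) * X)) 0 c =
      taylor n g 0 c * ∑ k ∈ Finset.range n,
        (exp (a * X) * X ^ k * b ^ k / (k.factorial : ℂ)) • (c • gen n) ^ k := by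
  rw [TruncAlg.taylor_mul hg (by fun_prop)]
  congr 1
  have : (fun s => exp ((a + b * s) * X)) = fun s => exp (a * X) * exp ((b * X) * s) :=
    funext fun s => by rw [← exp_add]; ring_nf
  rw [this, taylor_const_mul, TruncAlg.taylor.eq_1, Finset.smul_sum]
  refine Finset.sum_congr rfl fun k _ => ?_
  rw [iteratedDeriv_cexp_const_mul, smul_smul]
  simp only [mul_zero, exp_zero, mul_one]
  congr 1
  ring

theorem differentiable_taylor_mul_exp (n : ℕ) {g : ℂ → ℂ} (hg : AnalyticAt ℂ g 0) (a b c : ℂ) :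
    Differentiable ℂ fun X => taylor n (fun s => g s * exp ((a + b * s) * X)) 0 c := by
  simp only [taylor_mul_exp n hg]
  have h1 : Differentiable ℂ fun X : ℂ => ∑ k ∈ Finset.range n,
      (exp (a * X) * X ^ k * b ^ k / (k.factorial : ℂ)) • (c • gen n) ^ k :=
    Differentiable.fun_sum fun k _ => Differentiable.smul_const (by fun_prop) _
  exact (LinearMap.toContinuousLinearMap
    (LinearMap.mulLeft ℂ (taylor n g 0 c))).differentiable.comp h1

/-- Convergence and holomorphy in `X` of a series of Taylor polynomials with exponential terms. -/
theorem summable_taylor_mul_exp (n : ℕ) {r : ℝ} (hr : 0 < r) {g : ℕ → ℂ → ℂ} {K ρ : ℝ}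
    (hg : ∀ m, DifferentiableOn ℂ (g m) (closedBall 0 r)) (hρ : 0 < ρ)
    (hK : ∀ m, ∀ s ∈ closedBall (0 : ℂ) r, ‖g m s‖ ≤ K * ρ ^ m) (a b c : ℂ) :
    (∀ X : ℂ, ρ * Real.exp X.re < 1 → (∃ u : ℕ → ℝ, Summable u ∧
      ∀ m, ∀ s ∈ sphere (0 : ℂ) r, ‖g m s * exp ((a + m + b * s) * X)‖ ≤ u m) ∧
      Summable fun m : ℕ => taylor n (fun s => g m s * exp ((a + m + b * s) * X)) 0 c) ∧
    DifferentiableOn ℂ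
      (fun X => ∑' m : ℕ, taylor n (fun s => g m s * exp ((a + m + b * s) * X)) 0 c)
      {X : ℂ | ρ * Real.exp X.re < 1} := by
  obtain ⟨K', hK'0, hK'⟩ := exists_norm_circleTaylor_le n hr c
  have hK0 : 0 ≤ K := by simpa using (norm_nonneg _).trans (hK 0 0 (mem_closedBall_self hr.le))
  have hga : ∀ m, AnalyticAt ℂ (g m) 0 := fun m => (hg m).analyticAt (closedBall_mem_nhds 0 hr)
  have hcirc : ∀ m X, circleTaylor n r c (fun s => g m s * exp ((a + m + b * s) * X)) =
      taylor n (fun s => g m s * exp ((a + m + b * s) * X)) 0 c := fun m X =>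
    circleTaylor_eq_taylor n hr c ((hg m).mul (by fun_prop))
  have hbd : ∀ (β R : ℝ) (X : ℂ), X.re < β → ‖X‖ < R → ∀ m, ∀ s ∈ sphere (0 : ℂ) r,
      ‖g m s * exp ((a + m + b * s) * X)‖ ≤
        (ρ * Real.exp β) ^ m * (K * Real.exp ((‖a‖ + ‖b‖ * r) * R)) := by
    intro β R X hβ hR m s hs
    have hs' : ‖s‖ = r := by simpa using hs
    have h1 : ‖exp ((a + m + b * s) * X)‖ ≤ Real.exp β ^ m * Real.exp ((‖a‖ + ‖b‖ * r) * R) := by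
      rw [show (a + m + b * s) * X = m * X + (a + b * s) * X by ring, exp_add, norm_mul,
        exp_nat_mul, norm_pow, norm_exp X]
      refine mul_le_mul (pow_le_pow_left₀ (Real.exp_pos _).le (Real.exp_le_exp.2 hβ.le) m) ?_
        (norm_nonneg _) (by positivity)
      rw [norm_exp]
      refine Real.exp_le_exp.2 ((le_abs_self _).trans ((abs_re_le_norm _).trans ?_))
      rw [norm_mul]
      refine mul_le_mul ((norm_add_le _ _).trans ?_) hR.le (norm_nonneg _) (by positivity)
      rw [norm_mul, hs']
    rw [norm_mul]
    calc _ ≤ (K * ρ ^ m) * (Real.exp β ^ m * Real.exp ((‖a‖ + ‖b‖ * r) * R)) :=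
          mul_le_mul (hK m s (sphere_subset_closedBall hs)) h1 (norm_nonneg _) (by positivity)
      _ = _ := by rw [mul_pow]; ring
  have hsum : ∀ β R : ℝ, ρ * Real.exp β < 1 →
      Summable fun m : ℕ => (ρ * Real.exp β) ^ m * (K * Real.exp ((‖a‖ + ‖b‖ * r) * R)) :=
    fun β R h => (summable_geometric_of_lt_one (by positivity) h).mul_right _
  -- Some room beyond Re X gives a bound uniform on a neighbourhood of X.
  have hex : ∀ X : ℂ, ρ * Real.exp X.re < 1 → ∃ β, X.re < β ∧ ρ * Real.exp β < 1 := by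
    intro X hX
    have h1 : ∀ᶠ β in 𝓝[>] X.re, ρ * Real.exp β < 1 :=
      nhdsWithin_le_nhds ((isOpen_lt (by fun_prop) continuous_const).mem_nhds hX)
    obtain ⟨β, h2, h3⟩ := (h1.and self_mem_nhdsWithin).exists
    exact ⟨β, h3, h2⟩
  refine ⟨fun X hX => ?_, fun X hX => ?_⟩
  · obtain ⟨β, hβ, hβ1⟩ := hex X hX
    have hR : ‖X‖ < ‖X‖ + 1 := lt_add_one _
    refine ⟨⟨_, hsum β _ hβ1, hbd β _ X hβ hR⟩, ?_⟩
    refine Summable.of_norm_bounded ((hsum β (‖X‖ + 1) hβ1).mul_left K') fun m => ?_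
    rw [← hcirc]
    exact hK' _ _ (hbd β _ X hβ hR m)
  · obtain ⟨β, hβ, hβ1⟩ := hex X hX
    set U : Set ℂ := {Y : ℂ | Y.re < β} ∩ ball 0 (‖X‖ + 1) with hU
    have hUo : IsOpen U := (isOpen_lt continuous_re continuous_const).inter isOpen_ball
    have hXU : X ∈ U := ⟨hβ, by simp⟩
    have : CompleteSpace (TruncAlg n) := FiniteDimensional.complete ℂ _
    have hd := differentiableOn_tsum_of_summable_norm
      (F := fun (m : ℕ) X => taylor n (fun s => g m s * exp ((a + m + b * s) * X)) 0 c)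
      ((hsum β (‖X‖ + 1) hβ1).mul_left K')
      (fun m => (differentiable_taylor_mul_exp n (hga m) (a + m) b c).differentiableOn) hUo
      (fun m Y hY => by
        rw [← hcirc]
        exact hK' _ _ (hbd β _ Y hY.1 (by simpa using hY.2) m))
    exact (hd.differentiableAt (hUo.mem_nhds hXU)).differentiableWithinAt

theorem continuous_barnesIntegrand (l : ℤ) (x : ℂ) : Continuous fun p : ℝ × ℝ =>
    barnesIntegrand l x (circleMap 0 (1 / 12) p.1) (((-1 / 6 : ℝ) : ℂ) + p.2 * I) := by
  unfold barnesIntegrand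
  have hline : Continuous fun p : ℝ × ℝ => ((-1 / 6 : ℝ) : ℂ) + p.2 * I := by fun_prop
  have h1 : Continuous fun p : ℝ × ℝ => gammaQuot (((-1 / 6 : ℝ) : ℂ) + p.2 * I) :=
    differentiableOn_gammaQuot.continuousOn.comp_continuous hline fun p => by
      simp only [Set.mem_ofPred_eq, add_re, ofReal_re, mul_re, I_re, mul_zero, ofReal_im, I_im,
        mul_one, sub_self, add_zero]
      norm_num
  have h2 : Continuous fun p : ℝ × ℝ => exp ((((-1 / 6 : ℝ) : ℂ) + p.2 * I) * x) := by fun_prop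
  refine (h1.mul h2).mul ?_
  have hu : Continuous fun p : ℝ × ℝ =>
      ((-1 / 6 : ℝ) : ℂ) + p.2 * I - circleMap 0 (1 / 12) p.1 :=
    hline.sub ((continuous_circleMap 0 (1 / 12)).comp continuous_fst)
  have hne : ∀ p : ℝ × ℝ, ∀ k : ℤ,
      ((-1 / 6 : ℝ) : ℂ) + p.2 * I - circleMap 0 (1 / 12) p.1 ≠ k := fun p => by
    have h3 : ‖circleMap 0 (1 / 12) p.1‖ = 1 / 12 := by
      rw [norm_circleMap_zero, abs_of_pos (by norm_num)]
    have h4 := abs_le.1 ((abs_re_le_norm _).trans h3.le)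
    refine ne_int_of_re (n := -1) ?_ ?_
    · rw [sub_re]
      simp only [add_re, ofReal_re, mul_re, I_re, mul_zero, ofReal_im, I_im, mul_one, sub_self,
        add_zero]
      push_cast
      linarith
    · rw [sub_re]
      simp only [add_re, ofReal_re, mul_re, I_re, mul_zero, ofReal_im, I_im, mul_one, sub_self,
        add_zero]
      push_cast
      linarith
  rw [continuous_iff_continuousAt]
  intro p
  exact ContinuousAt.comp (f := fun p : ℝ × ℝ =>
    ((-1 / 6 : ℝ) : ℂ) + p.2 * I - circleMap 0 (1 / 12) p.1)
    (differentiableAt_barnesKernel l (hne p)).continuousAt hu.continuousAt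

theorem exists_ball_norm_barnesIntegrand_le (l : ℤ) {x₀ : ℂ} (hx : x₀ ∈ windowStrip l) :
    ∃ R C : ℝ, 0 < R ∧ 0 ≤ C ∧ ∀ x ∈ ball x₀ R, ∀ ε : ℂ, ‖ε‖ ≤ 1 / 12 → ∀ t : ℝ,
      ‖barnesIntegrand l x ε (((-1 / 6 : ℝ) : ℂ) + t * I)‖ ≤ C * (1 + t ^ 2)⁻¹ := by
  obtain ⟨K, hK0, hK⟩ := exists_norm_gammaQuot_le
  obtain ⟨δ, hδ⟩ : ∃ δ : ℝ, δ = min (x₀.im - 2 * Real.pi * (l - 1)) (2 * Real.pi * l - x₀.im) :=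
    ⟨_, rfl⟩
  have hδ0 : 0 < δ := by
    rw [hδ, lt_min_iff]
    exact ⟨sub_pos.2 hx.1, sub_pos.2 hx.2⟩
  have hδ1 : δ ≤ x₀.im - 2 * Real.pi * (l - 1) := hδ ▸ min_le_left _ _
  have hδ2 : δ ≤ 2 * Real.pi * l - x₀.im := hδ ▸ min_le_right _ _
  refine ⟨δ / 2, K * (2 * Real.exp (Real.pi * (|(l : ℝ)| + 1)) * Real.exp (‖x₀‖ + δ) *
    (1 + 2 / (δ / 2) ^ 2)), by linarith, by positivity, fun x hxb ε hε t => ?_⟩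
  have hd : ‖x - x₀‖ < δ / 2 := by simpa [dist_eq] using hxb
  have him := abs_lt.1 ((abs_im_le_norm _).trans_lt hd)
  rw [sub_im] at him
  have hs : (((-1 / 6 : ℝ) : ℂ) + t * I).re = -1 / 6 := by simp
  have hsi : (((-1 / 6 : ℝ) : ℂ) + t * I).im = t := by simp
  have h1 := hK (((-1 / 6 : ℝ) : ℂ) + t * I) hs.ge (by rw [hs]; norm_num) (Or.inr hs)
  have h2 := norm_exp_mul_barnesKernel_le l (x := x) (δ := δ / 2) hε (Or.inr hs) (by linarith)
    (by linarith)
  rw [hsi, hs] at h2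
  have h3 : Real.exp (-1 / 6 * x.re) ≤ Real.exp (‖x₀‖ + δ) := by
    refine Real.exp_le_exp.2 ?_
    have h4 : ‖x‖ ≤ ‖x₀‖ + ‖x - x₀‖ := by
      rw [add_comm]
      exact norm_le_norm_sub_add x x₀
    have h5 := abs_le.1 (abs_re_le_norm x)
    linarith [norm_nonneg x]
  rw [barnesIntegrand, mul_assoc, norm_mul, mul_assoc K]
  refine mul_le_mul h1 (h2.trans ?_) (norm_nonneg _) hK0.le
  rw [mul_assoc (2 * Real.exp (Real.pi * (|(l : ℝ)| + 1)) * Real.exp (‖x₀‖ + δ)), ← div_eq_mul_inv]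
  gcongr
  exact one_add_sq_mul_exp_neg_le (by linarith) t

/-- Holomorphic dependence on x passes first through the Barnes integral, then through the circle
integral; one locally uniform majorant C/(1+t²) serves both. -/
theorem differentiableOn_circleTaylor_barnesIntegral (l : ℤ) (n : ℕ) (c : ℂ) :
    DifferentiableOn ℂ (fun x => circleTaylor n (1 / 12) c (barnesIntegral l x))
      (windowStrip l) := by
  intro x₀ hx
  refine DifferentiableAt.differentiableWithinAt ?_
  obtain ⟨R, C, hR, hC0, hC⟩ := exists_ball_norm_barnesIntegrand_le l hx
  have hint : Integrable fun t : ℝ => C * (1 + t ^ 2)⁻¹ := integrable_inv_one_add_sq.const_mul C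
  have hcirc : ∀ θ : ℝ, ‖circleMap 0 (1 / 12) θ‖ = 1 / 12 := fun θ => by
    rw [norm_circleMap_zero, abs_of_pos (by norm_num)]
  have hB : ∀ θ : ℝ, DifferentiableOn ℂ
      (fun x => barnesIntegral l x (circleMap 0 (1 / 12) θ)) (ball x₀ R) := by
    intro θ x hxb
    refine DifferentiableAt.differentiableWithinAt ?_
    obtain ⟨R', hR', hsub⟩ := Metric.isOpen_iff.1 isOpen_ball x hxb
    refine differentiableAt_integral_of_norm_le hR' (fun y _ => ?_) (fun t => ?_)
      (fun y hy t => hC y (hsub hy) _ (hcirc θ).le t) hint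
    · exact ((continuous_barnesIntegrand l y).comp
        (Continuous.prodMk continuous_const continuous_id)).aestronglyMeasurable
    · unfold barnesIntegrand
      fun_prop
  have hBn : ∀ x ∈ ball x₀ R, ∀ θ : ℝ,
      ‖barnesIntegral l x (circleMap 0 (1 / 12) θ)‖ ≤ C * Real.pi := by
    intro x hxb θ
    have := norm_integral_le_of_norm_le hint
      (Eventually.of_forall fun t => hC x hxb _ (hcirc θ).le t)
    rwa [integral_const_mul, integral_univ_inv_one_add_sq] at this
  have hBm : ∀ x, StronglyMeasurable fun θ : ℝ => barnesIntegral l x (circleMap 0 (1 / 12) θ) :=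
    fun x => (continuous_barnesIntegrand l x).stronglyMeasurable.integral_prod_right'
  unfold circleTaylor
  refine DifferentiableAt.fun_sum fun k _ => (DifferentiableAt.fun_const_smul ?_ _).smul_const _
  unfold circleIntegral
  simp only [intervalIntegral.integral_of_le Real.two_pi_pos.le]
  have hcont : Continuous fun θ : ℝ =>
      deriv (circleMap 0 (1 / 12)) θ * (1 / circleMap 0 (1 / 12) θ ^ (k + 1)) := by
    simp only [deriv_circleMap]
    have h3 := continuous_circleMap 0 (1 / 12)
    exact (h3.mul continuous_const).mul (continuous_const.div (h3.pow _) fun θ =>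
      pow_ne_zero _ (circleMap_ne_center (by norm_num)))
  refine differentiableAt_integral_of_norm_le hR (fun x _ => ?_) (fun θ => ?_)
    (bound := fun _ => 1 / 12 * (1 / (1 / 12) ^ (k + 1)) * (C * Real.pi)) (fun x hxb θ => ?_)
    (integrable_const _)
  · simp only [smul_eq_mul, ← mul_assoc]
    exact (hcont.stronglyMeasurable.mul (hBm x)).aestronglyMeasurable
  · exact ((hB θ).fun_const_smul _).fun_const_smul _
  · rw [norm_smul, norm_smul, ← mul_assoc]
    refine mul_le_mul (le_of_eq ?_) (hBn x hxb θ) (norm_nonneg _) (by positivity)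
    rw [norm_div, norm_one, norm_pow, hcirc, deriv_circleMap, norm_mul, hcirc, norm_I, mul_one]

end Jets

/-! ### Convergence on the two half-planes. -/

section Halfplanes

open Filter Topology Complex TruncAlg Metric

theorem re_mem_of_mem_closedBall {s : ℂ} (hs : s ∈ closedBall (0 : ℂ) (1 / 12)) :
    -(1 / 12) ≤ s.re ∧ s.re ≤ 1 / 12 :=
  abs_le.1 ((abs_re_le_norm s).trans (by simpa using hs))

theorem differentiableOn_gammaQuot_add (m : ℕ) :
    DifferentiableOn ℂ (fun s => gammaQuot (m + s)) (closedBall 0 (1 / 12)) := by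
  refine differentiableOn_gammaQuot.comp (by fun_prop) fun s hs => ?_
  have := re_mem_of_mem_closedBall hs
  have hm : (0 : ℝ) ≤ m := Nat.cast_nonneg m
  simp only [Set.mem_ofPred_eq, add_re, natCast_re]
  linarith

theorem exists_norm_gammaQuot_add_nat_le :
    ∃ K : ℝ, ∀ m : ℕ, ∀ s ∈ closedBall (0 : ℂ) (1 / 12),
      ‖gammaQuot (m + s)‖ ≤ K * ((3 : ℝ) ^ 6) ^ m := by
  obtain ⟨K, hK⟩ := (isCompact_closedBall (0 : ℂ) (1 / 12)).exists_bound_of_continuousOn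
    (differentiableOn_gammaQuot_add 0).continuousOn
  refine ⟨K, fun m s hs => ?_⟩
  have h1 := hK s hs
  simp only [Nat.cast_zero, zero_add] at h1
  have h2 := norm_gammaQuot_add_nat_le (s := s)
    (by have := re_mem_of_mem_closedBall hs; linarith) m
  rw [add_comm (m : ℂ), mul_comm K]
  exact h2.trans (mul_le_mul_of_nonneg_left h1 (by positivity))

theorem summable_taylor_gammaQuot :
    (∀ x : ℂ, x.re < -6 * Real.log 3 → (∃ u : ℕ → ℝ, Summable u ∧
      ∀ m : ℕ, ∀ s ∈ sphere (0 : ℂ) (1 / 12), ‖gammaQuot (m + s) * exp ((m + s) * x)‖ ≤ u m) ∧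
      Summable fun m : ℕ => taylor 4 (fun s => gammaQuot (m + s) * exp ((m + s) * x)) 0
        (2 * Real.pi * I)⁻¹) ∧
    DifferentiableOn ℂ (fun x => ∑' m : ℕ,
      taylor 4 (fun s => gammaQuot (m + s) * exp ((m + s) * x)) 0 (2 * Real.pi * I)⁻¹)
      {x : ℂ | x.re < -6 * Real.log 3} := by
  obtain ⟨K, hK⟩ := exists_norm_gammaQuot_add_nat_le
  have h := summable_taylor_mul_exp 4 (r := 1 / 12) (by norm_num)
    (g := fun m s => gammaQuot (m + s)) differentiableOn_gammaQuot_add (by positivity) hK 0 1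
    (2 * Real.pi * I)⁻¹
  simp only [zero_add, one_mul] at h
  exact ⟨fun x hx => h.1 x (exp_mul_re_lt_one hx), h.2.mono fun x hx => exp_mul_re_lt_one hx⟩

/-- A linear left inverse is continuous in finite dimension. This carries convergence from the
𝔥-series back to the I-series. -/
theorem summable_of_summable_map {E F : Type*} [NormedAddCommGroup E] [NormedSpace ℂ E]
    [FiniteDimensional ℂ E] [NormedAddCommGroup F] [NormedSpace ℂ F] [FiniteDimensional ℂ F]
    {f : ℕ → E} (L : E →ₗ[ℂ] F) (hL : Function.Injective L) (h : Summable fun m => L (f m)) :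
    Summable f := by
  obtain ⟨R, hR⟩ := L.exists_leftInverse_of_injective (LinearMap.ker_eq_bot.2 hL)
  have h2 := (LinearMap.toContinuousLinearMap R).summable h
  refine h2.congr fun m => ?_
  exact LinearMap.congr_fun hR (f m)

theorem scale_injective (n : ℕ) (m : ℤ) {c : ℂ} (hc : c ≠ 0) :
    Function.Injective (scale n m c) := by
  intro a b hab
  have h1 := scale_scale_inv n m c⁻¹ (inv_ne_zero hc)
  rw [inv_inv] at h1
  rw [← h1 a, ← h1 b, hab]

theorem mul_left_injective_of_isUnit {R : Type*} [CommRing R] {w : R} (hw : IsUnit w) :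
    Function.Injective fun a => Ring.inverse w * a := by
  intro a b hab
  obtain ⟨w, rfl⟩ := hw
  simpa [Ring.inverse_unit] using hab

theorem summable_termGW_and_hGW_eq {x z : ℂ} (hz : z ≠ 0) (hx : x.re < -6 * Real.log 3) :
    Summable (termGW x z) ∧ hGW x z = z • ∑' m : ℕ,
      taylor 4 (fun s => gammaQuot (m + s) * exp ((m + s) * x)) 0 (2 * Real.pi * I)⁻¹ := by
  set L : HGW →ₗ[ℂ] HGW := (powDegGW (2 * Real.pi * I)⁻¹).comp
    ((LinearMap.mulLeft ℂ (Ring.inverse gammaGW)).comp (powGrGW z)) with hL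
  have hLi : Function.Injective L :=
    (scale_injective 4 0 (inv_ne_zero two_pi_I_ne_zero)).comp
      ((mul_left_injective_of_isUnit isUnit_gammaGW).comp (scale_injective 4 0 hz))
  have hLt : ∀ n, L (termGW x z n) =
      z • taylor 4 (fun s => gammaQuot (n + s) * exp ((n + s) * x)) 0 (2 * Real.pi * I)⁻¹ :=
    fun n => hGW_term x z hz n
  have hs := (summable_taylor_gammaQuot.1 x hx).2
  have h1 : Summable (termGW x z) := summable_of_summable_map L hLi (by
    simp only [hLt]
    exact hs.const_smul z)
  refine ⟨h1, ?_⟩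
  have h2 := (LinearMap.toContinuousLinearMap L).map_tsum h1
  rw [← hs.tsum_const_smul z]
  simp only [← hLt]
  exact h2

theorem differentiableOn_gammaDual_mul_sin (m r : ℕ) : DifferentiableOn ℂ
    (fun s => gammaDual ((m + (r + 1) / 3) + 1 / 3 * s) *
      (sin (Real.pi * ((m + (r + 1) / 3) + 1 / 3 * s)) / Real.pi) ^ 6) (closedBall 0 (1 / 12)) := by
  refine DifferentiableOn.mul ?_ (by fun_prop)
  refine differentiableOn_gammaDual.comp (by fun_prop) fun s hs => ?_
  have := re_mem_of_mem_closedBall hs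
  have hm : (0 : ℝ) ≤ m := Nat.cast_nonneg m
  have hr : (0 : ℝ) ≤ r := Nat.cast_nonneg r
  simp
  linarith

theorem exists_norm_gammaDual_mul_sin_le (r : ℕ) :
    ∃ K : ℝ, ∀ m : ℕ, ∀ s ∈ closedBall (0 : ℂ) (1 / 12),
      ‖gammaDual ((m + (r + 1) / 3) + 1 / 3 * s) *
      (sin (Real.pi * ((m + (r + 1) / 3) + 1 / 3 * s)) / Real.pi) ^ 6‖ ≤
        K * (((3 : ℝ) ^ 6)⁻¹) ^ m := by
  obtain ⟨K, hK⟩ := (isCompact_closedBall (0 : ℂ) (1 / 12)).exists_bound_of_continuousOn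
    (differentiableOn_gammaDual_mul_sin 0 r).continuousOn
  refine ⟨K, fun m s hs => ?_⟩
  have h1 := hK s hs
  simp only [Nat.cast_zero, zero_add] at h1
  set w : ℂ := (r + 1) / 3 + 1 / 3 * s with hw
  have hwr : 0 < w.re := by
    have := re_mem_of_mem_closedBall hs
    have hr : (0 : ℝ) ≤ r := Nat.cast_nonneg r
    rw [hw]
    simp
    linarith
  have h2 := norm_gammaDual_add_nat_le hwr m
  rw [show (m + (r + 1) / 3 : ℂ) + 1 / 3 * s = w + m by rw [hw]; ring, div_pow (sin _),
    sin_pi_mul_add_nat_pow_even w m (by decide), ← div_pow (sin _), norm_mul, mul_comm K]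
  rw [norm_mul] at h1
  calc _ ≤ ((3 : ℝ) ^ 6)⁻¹ ^ m * ‖gammaDual w‖ * ‖(sin (Real.pi * w) / Real.pi) ^ 6‖ := by gcongr
    _ ≤ _ := by
      rw [mul_assoc]
      exact mul_le_mul_of_nonneg_left h1 (by positivity)

/-- The general series statement is applied with X = -x and ρ = 3⁻⁶, the exponential being split off
from `residueFun`. -/
theorem summable_taylor_residueFun (r : ℕ) :
    (∀ x : ℂ, -6 * Real.log 3 < x.re →
      Summable fun m : ℕ => taylor 2 (fun s => residueFun x ((m + (r + 1) / 3) + 1 / 3 * s)) 0 1) ∧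
    DifferentiableOn ℂ (fun x => ∑' m : ℕ,
      taylor 2 (fun s => residueFun x ((m + (r + 1) / 3) + 1 / 3 * s)) 0 1)
      {x : ℂ | -6 * Real.log 3 < x.re} := by
  obtain ⟨K, hK⟩ := exists_norm_gammaDual_mul_sin_le r
  have h := summable_taylor_mul_exp 2 (r := 1 / 12) (by norm_num)
    (g := fun m s => gammaDual ((m + (r + 1) / 3) + 1 / 3 * s) *
      (sin (Real.pi * ((m + (r + 1) / 3) + 1 / 3 * s)) / Real.pi) ^ 6)
    (fun m => differentiableOn_gammaDual_mul_sin m r) (by positivity) hK ((r + 1) / 3) (1 / 3) 1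
  have hfun : ∀ (m : ℕ) (x : ℂ), (fun s => gammaDual ((m + (r + 1) / 3) + 1 / 3 * s) *
      (sin (Real.pi * ((m + (r + 1) / 3) + 1 / 3 * s)) / Real.pi) ^ 6 *
      exp (((r + 1) / 3 + m + 1 / 3 * s) * -x)) =
      fun s => residueFun x ((m + (r + 1) / 3) + 1 / 3 * s) := fun m x => funext fun s => by
    rw [residueFun, show ((r + 1) / 3 + m + 1 / 3 * s) * -x =
      -(x * ((m + (r + 1) / 3) + 1 / 3 * s)) by ring]
    ring
  refine ⟨fun x hx => ?_, ?_⟩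
  · have := (h.1 (-x) (exp_neg_mul_re_lt_one hx)).2
    simpa only [hfun] using this
  · have := h.2.comp (differentiable_neg (𝕜 := ℂ)).differentiableOn
      (s := {x : ℂ | -6 * Real.log 3 < x.re}) fun x hx => exp_neg_mul_re_lt_one hx
    simpa only [Function.comp_def, hfun] using this

theorem isUnit_gammaFJRWComponent {r : ℕ} (hr : r ≤ 1) : IsUnit (gammaFJRWComponent r) := by
  have h := isUnit_gammaFJRW
  rw [gammaFJRW_eq, Prod.isUnit_iff] at h
  interval_cases r
  exacts [h.1, h.2]

theorem summable_factorFJRW {y z : ℂ} (hz : z ≠ 0) (hy : -6 * Real.log 3 < (-3 * y).re) {r : ℕ}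
    (hr : r ≤ 1) :
    Summable (fun m => factorFJRW y z (3 * m + r)) ∧
    Ring.inverse (gammaFJRWComponent r) * (z ^ (2 * r) • scale 2 0 z
      (∑' m, factorFJRW y z (3 * m + r))) =
      z • ∑' m : ℕ, taylor 2 (fun s => residueFun (-3 * y) ((m + (r + 1) / 3) + 1 / 3 * s)) 0 1 := by
  set L : TruncAlg 2 →ₗ[ℂ] TruncAlg 2 :=
    (LinearMap.mulLeft ℂ (Ring.inverse (gammaFJRWComponent r))).comp
      (z ^ (2 * r) • scale 2 0 z) with hL
  have hLi : Function.Injective L :=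
    (mul_left_injective_of_isUnit (isUnit_gammaFJRWComponent hr)).comp
      ((smul_right_injective _ (pow_ne_zero (2 * r) hz)).comp (scale_injective 2 0 hz))
  have hLt : ∀ m : ℕ, L (factorFJRW y z (3 * m + r)) =
      z • taylor 2 (fun s => residueFun (-3 * y) ((m + (r + 1) / 3) + 1 / 3 * s)) 0 1 :=
    fun m => hFJRW_factor y z hz m r hr
  have hs := (summable_taylor_residueFun r).1 (-3 * y) hy
  have h1 : Summable (fun m => factorFJRW y z (3 * m + r)) := summable_of_summable_map L hLi (by
    simp only [hLt]
    exact hs.const_smul z)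
  refine ⟨h1, ?_⟩
  have h2 := (LinearMap.toContinuousLinearMap L).map_tsum h1
  rw [← hs.tsum_const_smul z]
  simp only [← hLt]
  exact h2

theorem hasSum_termFJRW {y z : ℂ} (hz : z ≠ 0) (hy : -6 * Real.log 3 < (-3 * y).re) :
    HasSum (termFJRW y z) (∑' m, factorFJRW y z (3 * m + 0), ∑' m, factorFJRW y z (3 * m + 1)) := by
  have h0 := (summable_factorFJRW hz hy (r := 0) (by norm_num)).1.hasSum
  have h1 := (summable_factorFJRW hz hy (r := 1) le_rfl).1.hasSum
  refine HasSum.prodMk (f := fun d => (termFJRW y z d).1) (g := fun d => (termFJRW y z d).2) ?_ ?_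
  -- The first component lives on d = 3m, the second on d = 3m+1; the other terms vanish.
  · have hi : Function.Injective fun m : ℕ => 3 * m + 0 := fun a b h => by simpa using h
    rw [← hi.hasSum_iff]
    · refine h0.congr_fun fun m => ?_
      simp [termFJRW]
    · intro d hd
      have : d % 3 ≠ 0 := fun h => hd ⟨d / 3, by simp only; omega⟩
      simp only [termFJRW, if_neg this]
      split_ifs <;> rfl
  · have hi : Function.Injective fun m : ℕ => 3 * m + 1 := fun a b h => by simpa using h
    rw [← hi.hasSum_iff]
    · refine h1.congr_fun fun m => ?_
      simp [termFJRW]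
    · intro d hd
      have : d % 3 ≠ 1 := fun h => hd ⟨d / 3, by simp only; omega⟩
      simp only [termFJRW, if_neg this]
      split_ifs <;> rfl

theorem ringInverse_prodMk {R S : Type*} [CommRing R] [CommRing S] {a : R} {b : S} (ha : IsUnit a)
    (hb : IsUnit b) : Ring.inverse (a, b) = (Ring.inverse a, Ring.inverse b) := by
  have h : (a, b) * (Ring.inverse a, Ring.inverse b) = 1 :=
    Prod.ext (Ring.mul_inverse_cancel _ ha) (Ring.mul_inverse_cancel _ hb)
  rw [← mul_one (Ring.inverse (a, b)), ← h, ← mul_assoc,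
    Ring.inverse_mul_cancel _ (Prod.isUnit_iff.2 ⟨ha, hb⟩), one_mul]

theorem scale_add_nat (n : ℕ) (k : ℕ) (c : ℂ) (hc : c ≠ 0) (a : TruncAlg n) :
    scale n k c a = c ^ k • scale n 0 c a := by
  refine ext_coeff fun i hi => ?_
  rw [map_smul, coeff_scale _ _ _ _ _ hi, coeff_scale _ _ _ _ _ hi, add_zero, zpow_add₀ hc,
    smul_eq_mul, zpow_natCast, zpow_natCast]
  ring

theorem hFJRW_eq {y z : ℂ} (hz : z ≠ 0) (hy : -6 * Real.log 3 < (-3 * y).re) :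
    hFJRW y z = z • powDegFJRW (2 * Real.pi * I)⁻¹
      (∑' m : ℕ, taylor 2 (fun s => residueFun (-3 * y) ((m + ((0 : ℕ) + 1) / 3) + 1 / 3 * s)) 0 1,
       ∑' m : ℕ, taylor 2 (fun s => residueFun (-3 * y) ((m + ((1 : ℕ) + 1) / 3) + 1 / 3 * s)) 0 1)
    := by
  have h0 := (summable_factorFJRW hz hy (r := 0) (by norm_num)).2
  have h1 := (summable_factorFJRW hz hy (r := 1) le_rfl).2
  rw [hFJRW, IFJRW, (hasSum_termFJRW hz hy).tsum_eq, gammaFJRW_eq,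
    ringInverse_prodMk (isUnit_gammaFJRWComponent (by norm_num)) (isUnit_gammaFJRWComponent le_rfl),
    ← map_smul]
  congr 1
  refine Prod.ext ?_ ?_
  · refine Eq.trans ?_ h0
    rw [mul_zero, pow_zero, one_smul]
    rfl
  · refine Eq.trans ?_ h1
    rw [← scale_add_nat 2 (2 * 1) z hz]
    rfl

end Halfplanes

/-! ### Identification of the residues with 𝕌_l. -/

section Residues

open Filter Topology Complex TruncAlg Metric

namespace TruncAlg

variable {n : ℕ}

/-- A jet without constant term is divisible by the generator. -/
theorem taylor_pow_eq_zero {f : ℂ → ℂ} {a : ℂ} (h : f a = 0) (c : ℂ) :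
    TruncAlg.taylor n f a c ^ n = 0 := by
  have hd : gen n ∣ TruncAlg.taylor n f a c := by
    refine Finset.dvd_sum fun k _ => ?_
    rcases k with _ | k
    · simp [h]
    · rw [Algebra.smul_def, pow_succ, Algebra.smul_def c]
      exact ⟨algebraMap ℂ _ (iteratedDeriv (k + 1) f a / ((k + 1).factorial : ℂ)) *
        (algebraMap ℂ _ c * gen n) ^ k * algebraMap ℂ _ c, by ring⟩
  obtain ⟨b, hb⟩ := hd
  rw [hb, mul_pow, gen_pow, zero_mul]

theorem taylor_zpow {f : ℂ → ℂ} {a c : ℂ} (hf : AnalyticAt ℂ f a) (h0 : f a ≠ 0)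
    {w : (TruncAlg n)ˣ} (hw : TruncAlg.taylor n f a c = w) (l : ℤ) :
    TruncAlg.taylor n (fun s => f s ^ l) a c = ((w ^ l : (TruncAlg n)ˣ) : TruncAlg n) := by
  rcases l with l | l
  · simp only [Int.ofNat_eq_natCast, zpow_natCast, Units.val_pow_eq_pow_val]
    rw [TruncAlg.taylor_pow hf, hw]
  · simp only [zpow_negSucc]
    rw [taylor_inv (hf.fun_pow _) (pow_ne_zero _ h0), TruncAlg.taylor_pow hf, hw,
      ← Units.val_pow_eq_pow_val, Ring.inverse_unit]

end TruncAlg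

/-- The function `ζᵏ e^{2πiε}`. -/
noncomputable def rotatedExp (k : ℕ) (ε : ℂ) : ℂ := zeta ^ k * exp (2 * Real.pi * I * ε)

theorem rotatedExp_ne_zero (k : ℕ) (ε : ℂ) : rotatedExp k ε ≠ 0 :=
  mul_ne_zero (pow_ne_zero _ zeta_ne_zero) (exp_ne_zero _)

theorem differentiable_rotatedExp (k : ℕ) : Differentiable ℂ (rotatedExp k) := by
  unfold rotatedExp
  fun_prop

theorem taylor_rotatedExp (k : ℕ) :
    TruncAlg.taylor 4 (rotatedExp k) 0 (2 * Real.pi * I)⁻¹ = zetaExp k := by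
  unfold rotatedExp
  rw [taylor_const_mul, taylor_exp, mul_inv_cancel₀ two_pi_I_ne_zero, one_smul]
  rfl

/-- At t = n+(r+1)/3 the kernel sees only t mod 1: this is where ζᵏ enters, with k = r+1. -/
theorem exp_eq_rotatedExp (n r : ℕ) (ε : ℂ) :
    exp (-(2 * Real.pi * I) * (-(n + (r + 1) / 3) - ε)) = rotatedExp (r + 1) ε := by
  rw [rotatedExp, zeta, ← exp_nat_mul, ← exp_add,
    show -(2 * Real.pi * I) * (-(n + (r + 1) / 3) - ε) = ((r + 1 : ℕ) : ℂ) *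
      (2 * Real.pi * I / 3) + 2 * Real.pi * I * ε + n * (2 * Real.pi * I) by push_cast; ring,
    exp_add _ (n * (2 * Real.pi * I)), exp_nat_mul_two_pi_mul_I, mul_one]

theorem neg_sub_ne_int (n : ℕ) {r : ℕ} (hr : r ≤ 1) {ε : ℂ} (hε : ε ∈ closedBall (0 : ℂ) (1 / 12)) :
    ∀ k : ℤ, -(n + (r + 1) / 3 : ℂ) - ε ≠ k := by
  have h := re_mem_of_mem_closedBall hε
  have h2 : (-(n + (r + 1) / 3 : ℂ) - ε).re = -(n + (r + 1) / 3) - ε.re := by simp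
  have h3 : (0 : ℝ) ≤ r := Nat.cast_nonneg r
  have h4 : (r : ℝ) ≤ 1 := by exact_mod_cast hr
  refine ne_int_of_re (n := -n - 1) ?_ ?_
  · rw [h2]
    push_cast
    linarith
  · rw [h2]
    push_cast
    linarith

theorem one_sub_rotatedExp_ne_zero {r : ℕ} (hr : r ≤ 1) {ε : ℂ}
    (hε : ε ∈ closedBall (0 : ℂ) (1 / 12)) : 1 - rotatedExp (r + 1) ε ≠ 0 := by
  rw [← exp_eq_rotatedExp 0]
  exact one_sub_exp_ne_zero (neg_sub_ne_int 0 hr hε)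

/-- The value of the residue at `t = n + (r + 1) / 3`, as a function of `ε`. -/
noncomputable def residueJet (l : ℤ) (r : ℕ) (v₀ v₁ ε : ℂ) : ℂ :=
  (v₁ + 2 * Real.pi * I * v₀ * l) * (rotatedExp (r + 1) ε ^ l * (1 - rotatedExp (r + 1) ε)⁻¹) +
    2 * Real.pi * I * v₀ *
      (rotatedExp (r + 1) ε ^ (l + 1) * ((1 - rotatedExp (r + 1) ε) ^ 2)⁻¹)

theorem deriv_residueFun_mul_barnesKernel (l : ℤ) (x : ℂ) (n : ℕ) {r : ℕ} (hr : r ≤ 1) {ε : ℂ}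
    (hε : ε ∈ closedBall (0 : ℂ) (1 / 12)) :
    deriv (fun t => residueFun x t * barnesKernel l (-t - ε)) (n + (r + 1) / 3) =
      residueJet l r (residueFun x (n + (r + 1) / 3)) (deriv (residueFun x) (n + (r + 1) / 3)) ε := by
  have hne := neg_sub_ne_int n hr hε
  have ht : (n + (r + 1) / 3 : ℂ) ∈ {t : ℂ | 0 < t.re} := by
    simp only [Set.mem_ofPred_eq]
    have : (n + (r + 1) / 3 : ℂ).re = n + (r + 1) / 3 := by simp
    rw [this]
    positivity
  have h1 : HasDerivAt (residueFun x) _ (n + (r + 1) / 3 : ℂ) :=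
    ((differentiableOn_residueFun x).differentiableAt
      ((isOpen_lt continuous_const continuous_re).mem_nhds ht)).hasDerivAt
  have h2 : HasDerivAt (fun t : ℂ => -t - ε) (-1) (n + (r + 1) / 3 : ℂ) :=
    (hasDerivAt_neg _).sub_const ε
  have h3 := HasDerivAt.comp (n + (r + 1) / 3 : ℂ) (h := fun t => -t - ε)
    (differentiableAt_barnesKernel l hne).hasDerivAt h2
  have h4 := (h1.mul h3).deriv
  have hE : ∀ k : ℤ, exp (k * (-(2 * Real.pi * I) * (-(n + (r + 1) / 3) - ε))) =
      rotatedExp (r + 1) ε ^ k := fun k => by rw [exp_int_mul, exp_eq_rotatedExp]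
  have hE1 := hE (l + 1)
  push_cast at hE1
  refine h4.trans ?_
  simp only [Function.comp_def]
  rw [deriv_barnesKernel l hne, barnesKernel, hE, hE1, exp_eq_rotatedExp, residueJet]
  ring

theorem differentiableOn_residueJet (l : ℤ) {r : ℕ} (hr : r ≤ 1) (v₀ v₁ : ℂ) :
    DifferentiableOn ℂ (residueJet l r v₀ v₁) (closedBall 0 (1 / 12)) := by
  have hE : DifferentiableOn ℂ (rotatedExp (r + 1)) (closedBall 0 (1 / 12)) :=
    (differentiable_rotatedExp (r + 1)).differentiableOn
  have h0 : ∀ ε ∈ closedBall (0 : ℂ) (1 / 12), rotatedExp (r + 1) ε ≠ 0 := fun ε _ =>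
    rotatedExp_ne_zero _ _
  have hz : ∀ k : ℤ, DifferentiableOn ℂ (fun ε => rotatedExp (r + 1) ε ^ k)
      (closedBall 0 (1 / 12)) := fun k => hE.zpow (Or.inl h0)
  have h1 : DifferentiableOn ℂ (fun ε => 1 - rotatedExp (r + 1) ε) (closedBall 0 (1 / 12)) :=
    (differentiableOn_const 1).sub hE
  have h2 := fun ε hε => one_sub_rotatedExp_ne_zero (r := r) hr (ε := ε) hε
  unfold residueJet
  exact (((hz l).mul (h1.fun_inv h2)).const_mul _).add
    (((hz (l + 1)).mul ((h1.fun_pow 2).fun_inv fun ε hε => pow_ne_zero 2 (h2 ε hε))).const_mul _)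

/-- Substituting ε = p/(2πi) turns ζᵏe^{2πiε} into ζᵏeᵖ. The factors 3 and 9 undo the normalisations
in 𝕌_l. -/
theorem taylor_residueJet (l : ℤ) {r : ℕ} (hr : r ≤ 1) (v₀ v₁ : ℂ) :
    TruncAlg.taylor 4 (residueJet l r v₀ v₁) 0 (2 * Real.pi * I)⁻¹ =
      (3 * v₁) • imageHyp l (r + 1) + (2 * Real.pi * I * 9 * v₀) • imageOne l (r + 1) := by
  have hE : AnalyticAt ℂ (rotatedExp (r + 1)) 0 := (differentiable_rotatedExp (r + 1)).analyticAt 0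
  have h0 := rotatedExp_ne_zero (r + 1) 0
  have h2 := one_sub_rotatedExp_ne_zero hr (mem_closedBall_self (x := (0 : ℂ)) (by norm_num))
  have hT := taylor_rotatedExp (r + 1)
  have h1 : AnalyticAt ℂ (fun ε => 1 - rotatedExp (r + 1) ε) 0 := analyticAt_const.sub hE
  have hz : ∀ k : ℤ, AnalyticAt ℂ (fun ε => rotatedExp (r + 1) ε ^ k) 0 := fun k =>
    hE.fun_zpow h0
  have hTs : TruncAlg.taylor 4 (fun ε => 1 - rotatedExp (r + 1) ε) 0 (2 * Real.pi * I)⁻¹ =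
      1 - (zetaExp (r + 1) : HGW) := by
    have : (fun ε => 1 - rotatedExp (r + 1) ε) = fun ε => 1 + (-1) * rotatedExp (r + 1) ε :=
      funext fun ε => by ring
    rw [this, TruncAlg.taylor_add analyticAt_const (analyticAt_const.fun_mul hE),
      TruncAlg.taylor_one, taylor_const_mul, hT]
    module
  have hi := h1.fun_inv h2
  have hi2 := (h1.fun_pow 2).fun_inv (pow_ne_zero 2 h2)
  unfold residueJet
  rw [TruncAlg.taylor_add (analyticAt_const.fun_mul ((hz l).fun_mul hi))
      (analyticAt_const.fun_mul ((hz (l + 1)).fun_mul hi2)), taylor_const_mul, taylor_const_mul,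
    TruncAlg.taylor_mul (hz l) hi, TruncAlg.taylor_mul (hz (l + 1)) hi2, taylor_inv h1 h2,
    taylor_inv (h1.fun_pow 2) (pow_ne_zero 2 h2), TruncAlg.taylor_pow h1, hTs,
    taylor_zpow hE h0 hT, taylor_zpow hE h0 hT, imageHyp, imageOne]
  module

/-- The contribution of the residue at `t = n + 1 - ε`. -/
noncomputable def integerResidue (x : ℂ) (n : ℕ) (ε : ℂ) : ℂ :=
  gammaDual (n + 1 - ε) * exp (-((n + 1 - ε) * x)) * sinFactor (n + 1 - ε)

theorem integerResidue_eq (x : ℂ) (n : ℕ) (ε : ℂ) :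
    integerResidue x n ε = sin (Real.pi * (-ε)) ^ 4 * (gammaDual (n + 1 - ε) *
      exp (-((n + 1 - ε) * x)) * (Real.pi ^ 4 * (3 - 4 * sin (Real.pi * (-ε)) ^ 2) ^ 2)⁻¹) := by
  have h := sinFactor_add_nat (-ε) (n + 1)
  rw [show -ε + ((n + 1 : ℕ) : ℂ) = n + 1 - ε by push_cast; ring] at h
  rw [integerResidue, h, sinFactor]
  ring

theorem differentiableOn_integerResidue_factor (x : ℂ) (n : ℕ) :
    DifferentiableOn ℂ (fun ε => gammaDual (n + 1 - ε) * exp (-((n + 1 - ε) * x)) *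
      (Real.pi ^ 4 * (3 - 4 * sin (Real.pi * (-ε)) ^ 2) ^ 2)⁻¹) (closedBall 0 (1 / 12)) := by
  have h1 : DifferentiableOn ℂ (fun ε : ℂ => gammaDual (n + 1 - ε)) (closedBall 0 (1 / 12)) := by
    refine differentiableOn_gammaDual.comp (by fun_prop) fun s hs => ?_
    have := re_mem_of_mem_closedBall hs
    have hm : (0 : ℝ) ≤ n := Nat.cast_nonneg n
    simp
    linarith
  refine (h1.mul (by fun_prop)).mul (DifferentiableOn.fun_inv (by fun_prop) fun ε hε => ?_)
  have hre := re_mem_of_mem_closedBall hε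
  refine mul_ne_zero (pow_ne_zero _ (ofReal_ne_zero.2 Real.pi_ne_zero)) (pow_ne_zero 2
    (three_sub_four_sin_sq_ne_zero fun j hj => ?_))
  have h3 : -(3 * ε.re) = j := by simpa using congrArg re hj
  have h4 : ((-1 : ℤ) : ℝ) < j := by push_cast; linarith
  have h5 : (j : ℝ) < ((1 : ℤ) : ℝ) := by push_cast; linarith
  have h6 : (-1 : ℤ) < j := by exact_mod_cast h4
  have h7 : j < (1 : ℤ) := by exact_mod_cast h5
  exact ⟨0, by omega⟩

theorem differentiableOn_integerResidue (x : ℂ) (n : ℕ) :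
    DifferentiableOn ℂ (integerResidue x n) (closedBall 0 (1 / 12)) := by
  rw [show integerResidue x n = _ from funext (integerResidue_eq x n)]
  exact DifferentiableOn.mul (by fun_prop) (differentiableOn_integerResidue_factor x n)

/-- The factor sin⁴(πε) has a fourth-order zero and p⁴ = 0, so the kernel poles on the left leave no
trace. -/
theorem taylor_integerResidue (x : ℂ) (n : ℕ) (c : ℂ) :
    TruncAlg.taylor 4 (integerResidue x n) 0 c = 0 := by
  have h := (differentiableOn_integerResidue_factor x n).analyticAt
    (closedBall_mem_nhds 0 (by norm_num))
  have hs : AnalyticAt ℂ (fun ε : ℂ => sin (Real.pi * (-ε))) 0 := by fun_prop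
  rw [show integerResidue x n = _ from funext (integerResidue_eq x n),
    TruncAlg.taylor_mul (hs.fun_pow 4) h, TruncAlg.taylor_pow hs,
    taylor_pow_eq_zero (by simp), zero_mul]

/-- The residue sum as a holomorphic function of `ε`. -/
noncomputable def residueSumJet (l : ℤ) (x : ℂ) (n : ℕ) (ε : ℂ) : ℂ :=
  (2 * Real.pi / 9 * residueJet l 0 (residueFun x (n + ((0 : ℕ) + 1) / 3))
      (deriv (residueFun x) (n + ((0 : ℕ) + 1) / 3)) ε +
    2 * Real.pi / 9 * residueJet l 1 (residueFun x (n + ((1 : ℕ) + 1) / 3))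
      (deriv (residueFun x) (n + ((1 : ℕ) + 1) / 3)) ε) +
    I * integerResidue x n ε

theorem residueSum_eq_residueSumJet (l : ℤ) (x : ℂ) (n : ℕ) {ε : ℂ}
    (hε : ε ∈ closedBall (0 : ℂ) (1 / 12)) : residueSum l x ε n = residueSumJet l x n ε := by
  rw [residueSumJet, ← deriv_residueFun_mul_barnesKernel l x n (by norm_num) hε,
    ← deriv_residueFun_mul_barnesKernel l x n le_rfl hε, residueSum, integerResidue]
  simp only [Nat.cast_zero, Nat.cast_one]

theorem differentiableOn_residueSumJet (l : ℤ) (x : ℂ) (n : ℕ) :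
    DifferentiableOn ℂ (residueSumJet l x n) (closedBall 0 (1 / 12)) :=
  (((differentiableOn_residueJet l (by norm_num) _ _).const_mul _).add
    ((differentiableOn_residueJet l le_rfl _ _).const_mul _)).add
    ((differentiableOn_integerResidue x n).const_mul _)

theorem taylor_residueSumJet (l : ℤ) (x : ℂ) (n : ℕ) :
    I • TruncAlg.taylor 4 (residueSumJet l x n) 0 (2 * Real.pi * I)⁻¹ =
      U l (powDegFJRW (2 * Real.pi * I)⁻¹
        (TruncAlg.taylor 2 (fun s => residueFun x ((n + ((0 : ℕ) + 1) / 3) + 1 / 3 * s)) 0 1,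
         TruncAlg.taylor 2 (fun s => residueFun x ((n + ((1 : ℕ) + 1) / 3) + 1 / 3 * s)) 0 1)) := by
  have hnhds := closedBall_mem_nhds (0 : ℂ) (show (0 : ℝ) < 1 / 12 by norm_num)
  have h0 := (differentiableOn_residueJet l (r := 0) (by norm_num)
    (residueFun x (n + ((0 : ℕ) + 1) / 3))
    (deriv (residueFun x) (n + ((0 : ℕ) + 1) / 3))).analyticAt hnhds
  have h1 := (differentiableOn_residueJet l (r := 1) le_rfl
    (residueFun x (n + ((1 : ℕ) + 1) / 3))
    (deriv (residueFun x) (n + ((1 : ℕ) + 1) / 3))).analyticAt hnhds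
  have h2 := (differentiableOn_integerResidue x n).analyticAt hnhds
  unfold residueSumJet
  rw [TruncAlg.taylor_add ((analyticAt_const.fun_mul h0).fun_add (analyticAt_const.fun_mul h1))
      (analyticAt_const.fun_mul h2),
    TruncAlg.taylor_add (analyticAt_const.fun_mul h0) (analyticAt_const.fun_mul h1), taylor_const_mul,
    taylor_const_mul, taylor_const_mul, taylor_integerResidue,
    taylor_residueJet l (by norm_num), taylor_residueJet l le_rfl, taylor_comp_affine,
    taylor_comp_affine]
  simp only [U, powDegFJRW, LinearMap.prodMap_apply, LinearMap.coprod_apply, LinearMap.add_apply,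
    LinearMap.smulRight_apply, coeff_scale 2 _ _ _ 0 (by norm_num),
    coeff_scale 2 _ _ _ 1 (by norm_num), coeff_taylor _ _ _ (show 0 < 2 by norm_num),
    coeff_taylor _ _ _ (show 1 < 2 by norm_num), iteratedDeriv_zero, iteratedDeriv_one]
  -- The grading deg₀ gives (2πi)² on 𝟙⁽ᵏ⁾ and 2πi on H⁽ᵏ⁾, matching i·(2π/9)·(2πi·9) and i·(2π/9)·3
  -- = 2πi/3, the last 1/3 coming from the direction H/3.
  have e0 : ((2 * Real.pi * I : ℂ)⁻¹) ^ (((0 : ℕ) : ℤ) + -2) = (2 * Real.pi * I) ^ 2 := by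
    rw [inv_zpow', ← zpow_natCast]
    norm_num
  have e1 : ((2 * Real.pi * I : ℂ)⁻¹) ^ (((1 : ℕ) : ℤ) + -2) = 2 * Real.pi * I := by
    rw [inv_zpow']
    norm_num
  rw [e0, e1]
  simp only [Nat.factorial_zero, Nat.factorial_one, Nat.cast_one, div_one, pow_zero, mul_one,
    pow_one, zero_add, Nat.reduceAdd]
  module

theorem hGW_eq_circleTaylor (l : ℤ) {x z : ℂ} (hz : z ≠ 0) (hx : x.re < -6 * Real.log 3)
    (hl : x ∈ windowStrip l) :
    hGW x z = -(z * I) • circleTaylor 4 (1 / 12) (2 * Real.pi * I)⁻¹ (barnesIntegral l x) := by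
  have hd : ∀ m : ℕ, DifferentiableOn ℂ (fun s => gammaQuot (m + s) * exp ((m + s) * x))
      (closedBall 0 (1 / 12)) := fun m => (differentiableOn_gammaQuot_add m).mul (by fun_prop)
  obtain ⟨u, hu, hb⟩ := (summable_taylor_gammaQuot.1 x hx).1
  have h := hasSum_circleTaylor 4 (r := 1 / 12) (by norm_num) (2 * Real.pi * I)⁻¹
    (fun m => (hd m).continuousOn.mono sphere_subset_closedBall) hb hu
    (fun s hs => hasSum_gammaQuot l hl (by simpa using (mem_sphere.1 hs).le) hx)
  rw [circleTaylor_const_mul] at h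
  simp only [fun m => circleTaylor_eq_taylor 4 (show (0 : ℝ) < 1 / 12 by norm_num)
    (2 * Real.pi * I)⁻¹ (hd m)] at h
  rw [(summable_termGW_and_hGW_eq hz hx).2, h.tsum_eq]
  module

theorem U_hFJRW_eq_circleTaylor (l : ℤ) {x y z : ℂ} (hz : z ≠ 0) (hx : -6 * Real.log 3 < x.re)
    (hxy : x = -3 * y) (hl : x ∈ windowStrip l) :
    U l (hFJRW y z) =
      -(z * I) • circleTaylor 4 (1 / 12) (2 * Real.pi * I)⁻¹ (barnesIntegral l x) := by
  obtain ⟨hsum, u, hu, hb⟩ := hasSum_residueSum l hl hx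
  have hm : ∀ s ∈ sphere (0 : ℂ) (1 / 12), ‖s‖ ≤ 1 / 12 := fun s hs => by
    simpa using (mem_sphere.1 hs).le
  have h := hasSum_circleTaylor 4 (r := 1 / 12) (by norm_num) (2 * Real.pi * I)⁻¹
    (φ := residueSumJet l x) (g := fun s => -1 * barnesIntegral l x s) (u := u)
    (fun m => (differentiableOn_residueSumJet l x m).continuousOn.mono sphere_subset_closedBall)
    (fun m s hs => by
      rw [← residueSum_eq_residueSumJet l x m (sphere_subset_closedBall hs)]
      exact hb s (hm s hs) m) hu
    (fun s hs => by
      have := hsum s (hm s hs)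
      simp only [neg_one_mul]
      refine this.congr_fun fun m => ?_
      exact (residueSum_eq_residueSumJet l x m (sphere_subset_closedBall hs)).symm)
  rw [circleTaylor_const_mul] at h
  simp only [fun m => circleTaylor_eq_taylor 4 (show (0 : ℝ) < 1 / 12 by norm_num)
    (2 * Real.pi * I)⁻¹ (differentiableOn_residueSumJet l x m)] at h
  have h2 := h.const_smul I
  simp only [taylor_residueSumJet] at h2
  have h3 := ((summable_taylor_residueFun 0).1 x hx).hasSum.prodMk
    ((summable_taylor_residueFun 1).1 x hx).hasSum
  have h4 := (LinearMap.toContinuousLinearMap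
    ((U l).comp (powDegFJRW (2 * Real.pi * I)⁻¹))).hasSum h3
  have h5 := h2.unique h4
  rw [hFJRW_eq hz (hxy ▸ hx), ← hxy, map_smul]
  refine (congrArg (z • ·) h5.symm).trans ?_
  module

end Residues

/-! ### Gluing and uniqueness of the continuation. -/

section Continuation

open Filter Topology Complex TruncAlg Metric

theorem differentiableOn_hGW {z : ℂ} (hz : z ≠ 0) :
    DifferentiableOn ℂ (fun x => hGW x z) {x : ℂ | x.re < -6 * Real.log 3} :=
  (summable_taylor_gammaQuot.2.fun_const_smul z).congr fun _ hx =>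
    (summable_termGW_and_hGW_eq hz hx).2

theorem differentiableOn_U_hFJRW (l : ℤ) {z : ℂ} (hz : z ≠ 0) :
    DifferentiableOn ℂ (fun x => U l (hFJRW (-x / 3) z)) {x : ℂ | -6 * Real.log 3 < x.re} := by
  have h := (LinearMap.toContinuousLinearMap
    (z • (U l).comp (powDegFJRW (2 * Real.pi * I)⁻¹))).differentiable.comp_differentiableOn
    ((summable_taylor_residueFun 0).2.prodMk (summable_taylor_residueFun 1).2)
  refine h.congr fun x hx => ?_
  have hx3 : -3 * (-x / 3) = x := by ring
  have hx' : -6 * Real.log 3 < (-3 * (-x / 3)).re := by rwa [hx3]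
  rw [hFJRW_eq hz hx', hx3, map_smul]
  rfl

/-- The continuation of `𝔥_GW` through the window `w_l`. -/
noncomputable def continuationGW (l : ℤ) (z x : ℂ) : HGW :=
  if x.re < -6 * Real.log 3 then hGW x z
  else if -6 * Real.log 3 < x.re then U l (hFJRW (-x / 3) z)
  else -(z * I) • circleTaylor 4 (1 / 12) (2 * Real.pi * I)⁻¹ (barnesIntegral l x)

theorem continuationGW_of_lt (l : ℤ) (z : ℂ) {x : ℂ} (hx : x.re < -6 * Real.log 3) :
    continuationGW l z x = hGW x z :=
  if_pos hx

theorem continuationGW_of_gt (l : ℤ) (z : ℂ) {x : ℂ} (hx : -6 * Real.log 3 < x.re) :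
    continuationGW l z x = U l (hFJRW (-x / 3) z) := by
  rw [continuationGW, if_neg hx.not_gt, if_pos hx]

/-- All three branches agree with the Barnes integral on the whole horizontal strip, so it supplies
analyticity across the window. -/
theorem continuationGW_of_mem (l : ℤ) {z x : ℂ} (hz : z ≠ 0) (hx : x ∈ windowStrip l) :
    continuationGW l z x =
      -(z * I) • circleTaylor 4 (1 / 12) (2 * Real.pi * I)⁻¹ (barnesIntegral l x) := by
  rw [continuationGW]
  split_ifs with h1 h2
  · exact hGW_eq_circleTaylor l hz h1 hx
  · exact U_hFJRW_eq_circleTaylor l hz h2 (by ring) hx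
  · rfl

theorem windowDomain_eq (l : ℤ) : windowDomain l =
    ({x | x.re < -6 * Real.log 3} ∪ windowStrip l) ∪ {x | -6 * Real.log 3 < x.re} := by
  ext x
  have h1 : 2 * ((l : ℝ) - 1) * Real.pi = 2 * Real.pi * (l - 1) := by ring
  have h2 : 2 * (l : ℝ) * Real.pi = 2 * Real.pi * l := by ring
  simp only [windowDomain, windowStrip, Set.mem_union, Set.mem_ofPred_eq, h1, h2]
  constructor
  · intro h
    rcases lt_trichotomy x.re (-6 * Real.log 3) with h3 | h3 | h3
    exacts [Or.inl (Or.inl h3), Or.inl (Or.inr (h h3)), Or.inr h3]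
  · rintro ((h | h) | h) h3
    exacts [absurd h3 h.ne, h, absurd h3 h.ne']

theorem isOpen_windowStrip (l : ℤ) : IsOpen (windowStrip l) :=
  (isOpen_lt continuous_const continuous_im).inter (isOpen_lt continuous_im continuous_const)

theorem convex_windowStrip (l : ℤ) : Convex ℝ (windowStrip l) :=
  (convex_halfSpace_im_gt _).inter (convex_halfSpace_im_lt _)

theorem isPreconnected_windowDomain (l : ℤ) : IsPreconnected (windowDomain l) := by
  have hmem : ∀ a : ℝ, (⟨a, Real.pi * (2 * l - 1)⟩ : ℂ) ∈ windowStrip l := fun a => by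
    have := Real.pi_pos
    constructor
    · simp only
      linarith
    · simp only
      linarith
  rw [windowDomain_eq]
  -- The strip meets both half-planes; common points are chosen on its central line, at distance 1
  -- from the critical line.
  refine IsPreconnected.union ⟨-6 * Real.log 3 + 1, Real.pi * (2 * l - 1)⟩ (Or.inr (hmem _)) ?_
    (IsPreconnected.union ⟨-6 * Real.log 3 - 1, Real.pi * (2 * l - 1)⟩ ?_ (hmem _)
      (convex_halfSpace_re_lt _).isPreconnected (convex_windowStrip l).isPreconnected)
    (convex_halfSpace_re_gt _).isPreconnected
  · simp only [Set.mem_ofPred_eq]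
    linarith
  · simp only [Set.mem_ofPred_eq]
    linarith

theorem analyticOnNhd_continuationGW (l : ℤ) {z : ℂ} (hz : z ≠ 0) :
    AnalyticOnNhd ℂ (continuationGW l z) (windowDomain l) := by
  have : CompleteSpace HGW := FiniteDimensional.complete ℂ _
  have h1 : AnalyticOnNhd ℂ (continuationGW l z) {x | x.re < -6 * Real.log 3} :=
    ((differentiableOn_hGW hz).congr fun x hx => continuationGW_of_lt l z hx).analyticOnNhd
      (isOpen_lt continuous_re continuous_const)
  have h2 : AnalyticOnNhd ℂ (continuationGW l z) {x | -6 * Real.log 3 < x.re} :=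
    ((differentiableOn_U_hFJRW l hz).congr fun x hx => continuationGW_of_gt l z hx).analyticOnNhd
      (isOpen_lt continuous_const continuous_re)
  have h3 : AnalyticOnNhd ℂ (continuationGW l z) (windowStrip l) :=
    (((differentiableOn_circleTaylor_barnesIntegral l 4 _).fun_const_smul (-(z * I))).congr
      fun x hx => continuationGW_of_mem l hz hx).analyticOnNhd (isOpen_windowStrip l)
  rw [windowDomain_eq]
  rintro x ((hx | hx) | hx)
  exacts [h1 x hx, h3 x hx, h2 x hx]

end Continuation

theorem mainTheorem2 (l : ℤ) (z : ℂ) (hz : z ≠ 0) :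
    -- the series that define the two functions converge on the two half-planes
    (∀ x : ℂ, x.re < -6 * Real.log 3 → Summable (termGW x z)) ∧
    (∀ y : ℂ, -6 * Real.log 3 < (-3 * y).re → Summable (termFJRW y z)) ∧
    -- the analytic continuation of `𝔥_GW` through the window `w_l` exists
    (∃ F : ℂ → HGW, AnalyticOnNhd ℂ F (windowDomain l) ∧
      ∀ x : ℂ, x.re < -6 * Real.log 3 → F x = hGW x z) ∧
    -- it coincides with `𝕌_l 𝔥_FJRW` after `log v = -3 log u`
    (∀ F : ℂ → HGW, AnalyticOnNhd ℂ F (windowDomain l) →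
      (∀ x : ℂ, x.re < -6 * Real.log 3 → F x = hGW x z) →
      ∀ x y : ℂ, -6 * Real.log 3 < x.re → x = -3 * y → F x = U l (hFJRW y z)) := by
  refine ⟨fun x hx => (summable_termGW_and_hGW_eq hz hx).1,
    fun y hy => (hasSum_termFJRW hz hy).summable,
    ⟨continuationGW l z, analyticOnNhd_continuationGW l hz,
      fun x hx => continuationGW_of_lt l z hx⟩, fun F hF hFx x y hx hxy => ?_⟩
  have hx₀ : (⟨-6 * Real.log 3 - 1, 0⟩ : ℂ) ∈ {x : ℂ | x.re < -6 * Real.log 3} := by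
    simp only [Set.mem_ofPred_eq]
    linarith
  -- Identity theorem: any continuation agrees with the constructed one near a point of the left
  -- half-plane.
  have heq : Set.EqOn F (continuationGW l z) (windowDomain l) :=
    hF.eqOn_of_preconnected_of_eventuallyEq (analyticOnNhd_continuationGW l hz)
      (isPreconnected_windowDomain l) (z₀ := ⟨-6 * Real.log 3 - 1, 0⟩)
      (by rw [windowDomain_eq]; exact Or.inl (Or.inl hx₀))
      (by
        filter_upwards [(isOpen_lt Complex.continuous_re continuous_const).mem_nhds hx₀] with w hw
        rw [hFx w hw, continuationGW_of_lt l z hw])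
  rw [heq (by rw [windowDomain_eq]; exact Or.inr hx), continuationGW_of_gt l z hx, hxy,
    show -(-3 * y) / 3 = y by ring]
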